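/- Let $n,m\in\mathbb{N}$, $t_0<T$, $U\subseteq\mathbb{R}^m$, $f:\mathbb{R}^n\times U\times[t_0,T]\to\mathbb{R}^n$ and $F:\mathbb{R}^n\times U\times[t_0,T]\to\mathbb{R}$. For $\tau\in[t_0,T)$ an admissible control is a Lebesgue measurable map $u:[\tau,T]\to U$; for an initial datum $(x^0,\tau)\in\mathbb{R}^n\times[t_0,T)$ its trajectory is the absolutely continuous solution of $\dot x=f(x,u,t)$ a.e. on $[\tau,T]$, $x(\tau)=x^0$, and its cost is $\int_\tau^T F(x,u,t)\,dt$. It is a standing assumption that for every initial datum every admissible control has a trajectory on all of $[\tau,T]$. A control is optimal for $(x^0,\tau)$ if its cost is at most that of every admissible control with the same initial datum. Put $\mathscr{H}(x,p,u,t)=\sum_{i=1}^n p_if_i(x,u,t)-F(x,u,t)$ and $H(x,p,t)=\sup_{u\in U}\mathscr{H}(x,p,u,t)$. An admissible control $u$ satisfies the Pontryagin maximum condition for $(x^0,\tau)$ if the solution $(x,p)$ of $\dot x=\partial_p\mathscr{H}(x,p,u,t)$, $\dot p=-\partial_x\mathscr{H}(x,p,u,t)$ a.e. on $[\tau,T]$,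 $x(\tau)=x^0$, $p(T)=0$, satisfies $\mathscr{H}(x(t),p(t),u(t),t)\ge\mathscr{H}(x(t),p(t),w,t)$ for all $w\in U$ and a.e. $t\in[\tau,T]$. Assume: (H5) $f$ and $F$ are continuous, and there is a function $\omega:\mathbb{R}_+\times\mathbb{R}_+\to\mathbb{R}_+$, nondecreasing in both variables, with $\lim_{D\to0+}\omega(R,D)=0$ for all $R>0$, such that for all $\varphi\in\{f_1,\dots,f_n,F\}$, $t\in[t_0,T]$, $R>0$, $x,y\in\mathbb{R}^n$ with $\|x\|,\|y\|<R$ and $u\in U$: $|\varphi(x,u,t)-\varphi(y,u,t)|\le\omega(R,\|x-y\|)$. (H6) $f$ and $F$ are differentiable in $x$, $\partial_xf$ and $\partial_xF$ are continuous on $\mathbb{R}^n\times U\times[t_0,T]$, and there is a function $\omega_1:\mathbb{R}_+\to\mathbb{R}_+$ with $\lim_{r\to0+}\omega_1(r)=0$ such that for all $\varphi\in\{f_1,\dots,f_n,F\}$, $t\in[t_0,T]$ and $x\in\mathbb{R}^n$: $|\varphi(x+h,u,t)-\varphi(x,u,t)-\partial_x\varphi(x,u,t)h|\le\|h\|\,\omega_1(\|h\|)$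 for all sufficiently small $h$ (depending on $x,t$) and all $u\in U$. The Hamiltonian system $$\dot x=\partial_pH(x,p,t),\qquad \dot p=-\partial_xH(x,p,t),\qquad p(T)=0\qquad\text{on }[t_0,T]\qquad(*)$$ is complete: the partial derivatives $\partial_xH,\partial_pH$ exist on $\mathbb{R}^n\times\mathbb{R}^n\times[t_0,T]$; for every $\xi\in\mathbb{R}^n$, $(*)$ has exactly one solution on $[t_0,T]$ with $x(T)=\xi$; and whenever $(x^i,p^i)$ are solutions of $(*)$ and $\tau_i\in[t_0,T]$ with $(x^i(\tau_i),p^i(\tau_i),\tau_i)\to(\xi,\eta,\tau)$, then $(x^i,p^i)$ converges uniformly on $[t_0,T]$ to the solution $(x,p)$ of $(*)$ with $(x(\tau),p(\tau))=(\xi,\eta)$. $U$ is compact. Then Rozonoer's Hypothesis 3 holds: if for every initial datum $(x^0,\tau)\in\mathbb{R}^n\times[t_0,T)$ there is a unique (up to equality a.e.) control satisfying the Pontryagin maximum condition, then for every initial datum this control is optimal. -/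

import Mathlib

open Set Filter Topology MeasureTheory
open scoped NNReal

noncomputable section

/-- Data of the optimal control problem: minimize `∫_{t₀}^T F(x,u,t) dt` subject to
`x' = f(x,u,t)`, `u(t) ∈ U`, `x(t₀) = x⁰`, where `x ∈ ℝⁿ` and `U ⊆ ℝᵐ`.
Only the values of `f` and `F` on `ℝⁿ × U × [t₀, T]` are ever used. -/
structure ControlProblem (n m : ℕ) where
  f : EuclideanSpace ℝ (Fin n) → EuclideanSpace ℝ (Fin m) → ℝ → EuclideanSpace ℝ (Fin n)
  F : EuclideanSpace ℝ (Fin n) → EuclideanSpace ℝ (Fin m) → ℝ → ℝ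
  U : Set (EuclideanSpace ℝ (Fin m))
  t₀ : ℝ
  T : ℝ
  t₀_lt_T : t₀ < T

namespace ControlProblem

variable {n m : ℕ}

/-- `x` is absolutely continuous on `[a, b]` and `x' = y` almost everywhere there
(in integral form, i.e. `x` is a Carathéodory solution of `x' = y`). -/
def HasAEDerivOn {k : ℕ} (x y : ℝ → EuclideanSpace ℝ (Fin k)) (a b : ℝ) : Prop :=
  IntervalIntegrable y volume a b ∧ ∀ t ∈ Icc a b, x t = x a + ∫ s in a..t, y s

/-- The set `ℝⁿ × U × [t₀, T]`. -/
def domain (P : ControlProblem n m) :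
    Set (EuclideanSpace ℝ (Fin n) × EuclideanSpace ℝ (Fin m) × ℝ) :=
  univ ×ˢ P.U ×ˢ Icc P.t₀ P.T

/-- Admissible controls with initial time `τ`: Lebesgue measurable maps `[τ, T] → U`. -/
def IsAdmissible (P : ControlProblem n m) (τ : ℝ) (u : ℝ → EuclideanSpace ℝ (Fin m)) : Prop :=
  (∀ t ∈ Icc τ P.T, u t ∈ P.U) ∧ AEMeasurable u (volume.restrict (Icc τ P.T))

/-- `x` solves `x' = f(x, u, t)` on `[τ, T]` with `x(τ) = x⁰`. -/
def IsTrajectory (P : ControlProblem n m) (x₀ : EuclideanSpace ℝ (Fin n)) (τ : ℝ)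
    (u : ℝ → EuclideanSpace ℝ (Fin m)) (x : ℝ → EuclideanSpace ℝ (Fin n)) : Prop :=
  ContinuousOn x (Icc τ P.T) ∧ HasAEDerivOn x (fun t => P.f (x t) (u t) t) τ P.T ∧ x τ = x₀

/-- The cost `∫_τ^T F(x, u, t) dt`. -/
def cost (P : ControlProblem n m) (τ : ℝ) (u : ℝ → EuclideanSpace ℝ (Fin m))
    (x : ℝ → EuclideanSpace ℝ (Fin n)) : ℝ :=
  ∫ t in τ..P.T, P.F (x t) (u t) t

/-- Every admissible control has a state trajectory on the whole of `[τ, T]`, whatever the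
initial datum `(x⁰, τ)`, so that its cost is defined. -/
def HasTrajectories (P : ControlProblem n m) : Prop :=
  ∀ τ ∈ Ico P.t₀ P.T, ∀ x₀ : EuclideanSpace ℝ (Fin n), ∀ u, P.IsAdmissible τ u →
    ∃ x, P.IsTrajectory x₀ τ u x

/-- `u` is an optimal control for the initial datum `(x⁰, τ)`. -/
def IsOptimal (P : ControlProblem n m) (x₀ : EuclideanSpace ℝ (Fin n)) (τ : ℝ)
    (u : ℝ → EuclideanSpace ℝ (Fin m)) : Prop :=
  P.IsAdmissible τ u ∧ ∃ x, P.IsTrajectory x₀ τ u x ∧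
    ∀ v y, P.IsAdmissible τ v → P.IsTrajectory x₀ τ v y → P.cost τ u x ≤ P.cost τ v y

/-- The control Hamiltonian `ℋ(x, p, u, t) = ⟨p, f(x, u, t)⟩ - F(x, u, t)`. -/
def controlHamiltonian (P : ControlProblem n m) (x p : EuclideanSpace ℝ (Fin n))
    (u : EuclideanSpace ℝ (Fin m)) (t : ℝ) : ℝ :=
  ∑ i, p i * P.f x u t i - P.F x u t

/-- `(x, p)` solves on `[τ, T]` the control Hamiltonian system `x' = ∂ℋ/∂p`, `p' = -∂ℋ/∂x`
of the control `u`, with `x(τ) = x⁰` and `p(T) = 0`. -/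
def IsControlHamiltonianSolution (P : ControlProblem n m) (x₀ : EuclideanSpace ℝ (Fin n)) (τ : ℝ)
    (u : ℝ → EuclideanSpace ℝ (Fin m)) (x p : ℝ → EuclideanSpace ℝ (Fin n)) : Prop :=
  ContinuousOn x (Icc τ P.T) ∧ ContinuousOn p (Icc τ P.T) ∧
  HasAEDerivOn x
    (fun t => gradient (fun q => P.controlHamiltonian (x t) q (u t) t) (p t)) τ P.T ∧
  HasAEDerivOn p
    (fun t => -gradient (fun y => P.controlHamiltonian y (p t) (u t) t) (x t)) τ P.T ∧
  x τ = x₀ ∧ p P.T = 0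

/-- The admissible control `u` satisfies the Pontryagin maximum condition on `[τ, T]` for the
initial datum `(x⁰, τ)`. -/
def SatisfiesPMP (P : ControlProblem n m) (x₀ : EuclideanSpace ℝ (Fin n)) (τ : ℝ)
    (u : ℝ → EuclideanSpace ℝ (Fin m)) : Prop :=
  P.IsAdmissible τ u ∧ ∃ x p, P.IsControlHamiltonianSolution x₀ τ u x p ∧
    ∀ᵐ t ∂(volume.restrict (Icc τ P.T)), ∀ w ∈ P.U,
      P.controlHamiltonian (x t) (p t) w t ≤ P.controlHamiltonian (x t) (p t) (u t) t

/-- Rozonoer's third hypothesis: if for every initial datum `(x⁰, τ)` there is a unique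
(up to equality a.e.) control satisfying the Pontryagin maximum condition, then this control
is optimal. -/
def RozonoerHypothesis3 (P : ControlProblem n m) : Prop :=
  (∀ τ ∈ Ico P.t₀ P.T, ∀ x₀ : EuclideanSpace ℝ (Fin n),
    ∃ u, P.SatisfiesPMP x₀ τ u ∧
      ∀ v, P.SatisfiesPMP x₀ τ v → v =ᵐ[volume.restrict (Icc τ P.T)] u) →
  ∀ τ ∈ Ico P.t₀ P.T, ∀ x₀ : EuclideanSpace ℝ (Fin n), ∀ u,
    P.SatisfiesPMP x₀ τ u → P.IsOptimal x₀ τ u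

/-- The Hamiltonian `H(x, p, t) = sup_{u ∈ U} ℋ(x, p, u, t)`. -/
def hamiltonian (P : ControlProblem n m) (x p : EuclideanSpace ℝ (Fin n)) (t : ℝ) : ℝ :=
  ⨆ u : P.U, P.controlHamiltonian x p u t

/-- The partial derivatives `∂H/∂x`, `∂H/∂p` (Fréchet, in each block of variables) exist
everywhere, i.e. the right-hand side of the Hamiltonian system is defined. -/
def HamiltonianDifferentiable (P : ControlProblem n m) : Prop :=
  ∀ t ∈ Icc P.t₀ P.T, ∀ x p : EuclideanSpace ℝ (Fin n),
    DifferentiableAt ℝ (fun y => P.hamiltonian y p t) x ∧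
    DifferentiableAt ℝ (fun q => P.hamiltonian x q t) p

/-- `(x, p)` solves on `[t₀, T]` the Hamiltonian system
`x' = ∂H/∂p(x, p, t)`, `p' = -∂H/∂x(x, p, t)`, `p(T) = 0`. -/
def IsHamiltonianSolution (P : ControlProblem n m)
    (x p : ℝ → EuclideanSpace ℝ (Fin n)) : Prop :=
  ContinuousOn x (Icc P.t₀ P.T) ∧ ContinuousOn p (Icc P.t₀ P.T) ∧
  HasAEDerivOn x (fun t => gradient (fun q => P.hamiltonian (x t) q t) (p t)) P.t₀ P.T ∧
  HasAEDerivOn p (fun t => -gradient (fun y => P.hamiltonian y (p t) t) (x t)) P.t₀ P.T ∧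
  p P.T = 0

/-- The Hamiltonian system is complete: its right-hand side is defined everywhere, for every
`ξ` there is exactly one solution on `[t₀, T]` with `x(T) = ξ`, and whenever solutions
`(xⁱ, pⁱ)` satisfy `(xⁱ(τᵢ), pⁱ(τᵢ), τᵢ) → (ξ, η, τ)`, they converge uniformly on `[t₀, T]`
to the solution with `(x(τ), p(τ)) = (ξ, η)`. -/
structure IsCompleteHamiltonianSystem (P : ControlProblem n m) : Prop where
  differentiable : P.HamiltonianDifferentiable
  exists_solution : ∀ ξ : EuclideanSpace ℝ (Fin n),
    ∃ x p, P.IsHamiltonianSolution x p ∧ x P.T = ξ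
  unique_solution : ∀ x p y q, P.IsHamiltonianSolution x p → P.IsHamiltonianSolution y q →
    x P.T = y P.T → EqOn x y (Icc P.t₀ P.T) ∧ EqOn p q (Icc P.t₀ P.T)
  continuous_dependence : ∀ (X Q : ℕ → ℝ → EuclideanSpace ℝ (Fin n)) (σ : ℕ → ℝ)
    (ξ η : EuclideanSpace ℝ (Fin n)) (τ : ℝ),
    (∀ i, P.IsHamiltonianSolution (X i) (Q i)) → (∀ i, σ i ∈ Icc P.t₀ P.T) →
    τ ∈ Icc P.t₀ P.T →
    Tendsto (fun i => (X i (σ i), Q i (σ i), σ i)) atTop (𝓝 (ξ, η, τ)) →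
    ∃ x p, P.IsHamiltonianSolution x p ∧ x τ = ξ ∧ p τ = η ∧
      TendstoUniformlyOn X x atTop (Icc P.t₀ P.T) ∧
      TendstoUniformlyOn Q p atTop (Icc P.t₀ P.T)

/-- A modulus `ω : ℝ₊ × ℝ₊ → ℝ₊`: nondecreasing in both variables, with
`ω(R, D) → 0` as `D → 0+` for every `R > 0`. -/
def IsLocalModulus (ω : ℝ≥0 → ℝ≥0 → ℝ≥0) : Prop :=
  (∀ r R d D, r ≤ R → d ≤ D → ω r d ≤ ω R D) ∧
  ∀ R, 0 < R → Tendsto (ω R) (𝓝[>] 0) (𝓝 0)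

/-- `f` and `F` are continuous on `ℝⁿ × U × [t₀, T]`, and there is one modulus `ω` such that
every `φ ∈ {f₁, …, fₙ, F}` satisfies `|φ(x,u,t) - φ(y,u,t)| ≤ ω(R, ‖x - y‖)` for all
`x, y ∈ B_R`, `u ∈ U` and `t ∈ [t₀, T]`. -/
def UniformlyContinuousInState (P : ControlProblem n m) : Prop :=
  ContinuousOn (fun z : EuclideanSpace ℝ (Fin n) × EuclideanSpace ℝ (Fin m) × ℝ =>
    P.f z.1 z.2.1 z.2.2) P.domain ∧
  ContinuousOn (fun z : EuclideanSpace ℝ (Fin n) × EuclideanSpace ℝ (Fin m) × ℝ =>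
    P.F z.1 z.2.1 z.2.2) P.domain ∧
  ∃ ω : ℝ≥0 → ℝ≥0 → ℝ≥0, IsLocalModulus ω ∧
    ∀ t ∈ Icc P.t₀ P.T, ∀ R : ℝ≥0, 0 < R →
      ∀ x ∈ Metric.ball (0 : EuclideanSpace ℝ (Fin n)) R,
      ∀ y ∈ Metric.ball (0 : EuclideanSpace ℝ (Fin n)) R, ∀ u ∈ P.U,
        (∀ i, |P.f x u t i - P.f y u t i| ≤ ω R ‖x - y‖₊) ∧
        |P.F x u t - P.F y u t| ≤ ω R ‖x - y‖₊

/-- `f` and `F` are differentiable in `x`, the derivatives are continuous on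
`ℝⁿ × U × [t₀, T]`, and there is one modulus `ω₁` with `ω₁(r) → 0` as `r → 0` such that every
`φ ∈ {f₁, …, fₙ, F}` satisfies
`|φ(x + h, u, t) - φ(x, u, t) - ∂φ/∂x(x, u, t) h| ≤ ‖h‖ ω₁(‖h‖)` for small `h` and all `u ∈ U`,
at every `x` and every `t ∈ [t₀, T]`. -/
def UniformlyDifferentiableInState (P : ControlProblem n m) : Prop :=
  (∀ x : EuclideanSpace ℝ (Fin n), ∀ u ∈ P.U, ∀ t ∈ Icc P.t₀ P.T,
    DifferentiableAt ℝ (fun y => P.f y u t) x ∧ DifferentiableAt ℝ (fun y => P.F y u t) x) ∧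
  ContinuousOn (fun z : EuclideanSpace ℝ (Fin n) × EuclideanSpace ℝ (Fin m) × ℝ =>
    fderiv ℝ (fun y => P.f y z.2.1 z.2.2) z.1) P.domain ∧
  ContinuousOn (fun z : EuclideanSpace ℝ (Fin n) × EuclideanSpace ℝ (Fin m) × ℝ =>
    fderiv ℝ (fun y => P.F y z.2.1 z.2.2) z.1) P.domain ∧
  ∃ ω₁ : ℝ≥0 → ℝ≥0, Tendsto ω₁ (𝓝[>] 0) (𝓝 0) ∧
    ∀ t ∈ Icc P.t₀ P.T, ∀ x : EuclideanSpace ℝ (Fin n),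
      ∀ᶠ h in 𝓝 (0 : EuclideanSpace ℝ (Fin n)), ∀ u ∈ P.U,
        (∀ i, |P.f (x + h) u t i - P.f x u t i - (fderiv ℝ (fun y => P.f y u t) x h) i|
          ≤ ‖h‖ * ω₁ ‖h‖₊) ∧
        |P.F (x + h) u t - P.F x u t - fderiv ℝ (fun y => P.F y u t) x h| ≤ ‖h‖ * ω₁ ‖h‖₊

end ControlProblem

end

/-! The core is that every initial datum has an optimal control satisfying the Pontryagin condition;
the assumed uniqueness then identifies it almost everywhere with any given control satisfying that
condition.

No convexity of the velocity set is available for passing to weak limits of controls.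
Differentiability of `H` takes its place. If `u` maximizes `ℋ(x, p, ·, t)`, then `ℋ(·, ·, u, t)`
touches `H` from below at `(x, p)`, so `f = ∂H/∂p` and `∂ℋ/∂x = ∂H/∂x` there
(`eq_gradient_of_forall_le`), and `F = ⟨p, f⟩ - H`. All maximizers therefore carry the same data,
and along asymptotically maximizing controls the data converge even if the controls do not
(`tendsto_of_argmax`).

Let `u k` be a minimizing sequence with excess cost at most `ε k`, with trajectories `x k`, adjoint
curves `p k` and pointwise maximizers `v k` of `ℋ` along them. Switching from `u k` to `v k` on an
interval of length `d` lowers the cost by the integral of the gap in `ℋ`, up to an error `η * d`, as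
soon as `d ≤ δ` with `δ` independent of `k` (`exists_needle_estimate`). Near optimality bounds each
such gain by `ε k`; adding up over `N` short intervals bounds the total gap by `N * ε k + η`, so it
tends to zero (`tendsto_integral_gap`). On a subsequence the gap vanishes almost everywhere and the
curves converge by Arzelà–Ascoli. Dominated convergence shows that the limit curves belong to a
measurable maximizer along them, whose cost is the infimum (`exists_limit_extremal`,
`exists_optimal`).

The uniformity needs a common ball for all trajectories of one datum (`exists_trajectory_bound`),
and global existence is assumed without any growth condition. If the trajectories were unbounded,
unboundedness could be carried forward in time along pieces of controls, adjusting the initial point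
within nested balls. The concatenated control has a trajectory on the whole interval from the common
point of these balls. That trajectory is bounded, so the time steps are bounded below and run past
`T`, a contradiction. -/

/-! ### Carathéodory equations: Grönwall, global existence, truncation, dependence on the initial
value. -/

section ODE

variable {E : Type*} [NormedAddCommGroup E] [NormedSpace ℝ E]

/-- Integral form of Grönwall's inequality, forward in time. -/
theorem le_mul_exp_of_le_integral_forward {φ : ℝ → ℝ} {a b A L : ℝ} (hL : 0 ≤ L)
    (hφ : ContinuousOn φ (Icc a b))
    (h : ∀ t ∈ Icc a b, φ t ≤ A + L * ∫ s in a..t, φ s) :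
    ∀ t ∈ Icc a b, φ t ≤ A * Real.exp (L * (t - a)) := by
  intro t ht
  have hab : a ≤ b := ht.1.trans ht.2
  set ψ : ℝ → ℝ := IccExtend hab (fun s => φ s) with hψ
  have hψc : Continuous ψ := by
    refine Continuous.Icc_extend' ?_
    exact continuousOn_iff_continuous_domRestrict.1 hφ
  have hψe : ∀ s ∈ Icc a b, ψ s = φ s := fun s hs => by
    simp [hψ, IccExtend_of_mem hab _ hs]
  have hint : ∀ s ∈ Icc a b, ∫ r in a..s, ψ r = ∫ r in a..s, φ r := fun s hs => by
    refine intervalIntegral.integral_congr fun r hr => hψe r ?_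
    rw [uIcc_of_le hs.1] at hr
    exact ⟨hr.1, hr.2.trans hs.2⟩
  have hder : ∀ s, HasDerivAt (fun s => A + L * ∫ r in a..s, ψ r) (L * ψ s) s := fun s =>
    ((hψc.integral_hasStrictDerivAt a s).hasDerivAt.const_mul L).const_add A
  have key := le_gronwallBound_of_liminf_deriv_right_le (f := fun s => A + L * ∫ r in a..s, ψ r)
    (f' := fun s => L * ψ s) (δ := A) (K := L) (ε := 0) (a := a) (b := b)
    (fun s _ => (hder s).continuousAt.continuousWithinAt)
    (fun s _ r hr => (hder s).hasDerivWithinAt.liminf_right_slope_le hr)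
    (by simp)
    (fun s hs => by
      have hs' : s ∈ Icc a b := Ico_subset_Icc_self hs
      have := h s hs'
      rw [← hint s hs', ← hψe s hs'] at this
      have := mul_le_mul_of_nonneg_left this hL
      simpa using this) t ht
  rw [gronwallBound_ε0] at key
  refine le_trans ?_ key
  have := h t ht
  rwa [← hint t ht] at this

/-- Integral form of Grönwall's inequality around an arbitrary base point. -/
theorem le_mul_exp_of_le_integral {φ : ℝ → ℝ} {a b c A L : ℝ} (hL : 0 ≤ L)
    (hφ : ContinuousOn φ (Icc a b)) (hc : c ∈ Icc a b)
    (h : ∀ t ∈ Icc a b, φ t ≤ A + L * |∫ s in c..t, φ s|) (h0 : ∀ t ∈ Icc a b, 0 ≤ φ t) :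
    ∀ t ∈ Icc a b, φ t ≤ A * Real.exp (L * |t - c|) := by
  intro t ht
  rcases le_total c t with hct | hct
  · rw [abs_of_nonneg (sub_nonneg.2 hct)]
    have hsub : Icc c b ⊆ Icc a b := Icc_subset_Icc_left hc.1
    refine le_mul_exp_of_le_integral_forward hL (hφ.mono hsub) (fun s hs => ?_) t ⟨hct, ht.2⟩
    have := h s (hsub hs)
    rwa [abs_of_nonneg] at this
    exact intervalIntegral.integral_nonneg hs.1
      fun r hr => h0 r (hsub ⟨hr.1, hr.2.trans hs.2⟩)
  · rw [abs_of_nonpos (sub_nonpos.2 hct)]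
    have hmem : ∀ s ∈ Icc (-c) (-a), -s ∈ Icc a b := fun s hs =>
      ⟨by linarith [hs.2], by linarith [hs.1, hc.2]⟩
    have hcont : ContinuousOn (fun s => φ (-s)) (Icc (-c) (-a)) :=
      hφ.comp continuous_neg.continuousOn hmem
    have := le_mul_exp_of_le_integral_forward (φ := fun s => φ (-s)) (A := A) hL hcont
      (fun s hs => ?_) (-t) ⟨by linarith, by linarith [ht.1]⟩
    · simpa [neg_add_eq_sub] using this
    · have h1 := h (-s) (hmem s hs)
      rw [intervalIntegral.integral_comp_neg, neg_neg]
      rwa [intervalIntegral.integral_symm, abs_neg, abs_of_nonneg] at h1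
      exact intervalIntegral.integral_nonneg (by linarith [hs.1])
        fun r hr => h0 r ⟨by linarith [hr.1, (hmem s hs).1], hr.2.trans hc.2⟩

/-- A time-dependent vector field satisfying Carathéodory conditions, bounded and Lipschitz on
each ball of radius `R` with constant `K R`. -/
structure IsCaratheodoryField (g : ℝ → E → E) (K : ℝ → ℝ) : Prop where
  meas : ∀ y : ℝ → E, Continuous y → AEStronglyMeasurable (fun t => g t (y t)) volume
  bound : ∀ R t x, ‖x‖ ≤ R → ‖g t x‖ ≤ K R
  lip : ∀ R t x y, ‖x‖ ≤ R → ‖y‖ ≤ R → ‖g t x - g t y‖ ≤ K R * ‖x - y‖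

/-- A Carathéodory solution of `y' = g(t, y)` on `[a, b]`. -/
def IsODESolution (g : ℝ → E → E) (a b : ℝ) (y : ℝ → E) : Prop :=
  ContinuousOn y (Icc a b) ∧ ∀ t ∈ Icc a b, y t = y a + ∫ s in a..t, g s (y s)

namespace IsCaratheodoryField

variable {g : ℝ → E → E} {K : ℝ → ℝ}

theorem intervalIntegrable {E : Type*} [NormedAddCommGroup E] {g : ℝ → E → E}
    (hg : IsCaratheodoryField g K) {y : ℝ → E} (hy : Continuous y)
    (a b : ℝ) : IntervalIntegrable (fun t => g t (y t)) volume a b := by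
  obtain ⟨R, hR⟩ := isCompact_uIcc.exists_bound_of_continuousOn (f := y) (s := uIcc a b)
    hy.continuousOn
  rw [intervalIntegrable_iff]
  refine Measure.integrableOn_of_bounded (M := K R) measure_Ioc_lt_top.ne (hg.meas y hy) ?_
  refine (ae_restrict_mem measurableSet_uIoc).mono fun t ht => hg.bound R t _ ?_
  exact hR t (uIoc_subset_uIcc ht)

theorem intervalIntegrable_of_continuousOn {E : Type*} [NormedAddCommGroup E] {g : ℝ → E → E}
    (hg : IsCaratheodoryField g K) {y : ℝ → E} {a b c d : ℝ}
    (hy : ContinuousOn y (Icc a b)) (hc : c ∈ Icc a b) (hd : d ∈ Icc a b) :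
    IntervalIntegrable (fun t => g t (y t)) volume c d := by
  have hab : a ≤ b := hc.1.trans hc.2
  have := hg.intervalIntegrable (y := IccExtend hab (fun s => y s))
    (Continuous.Icc_extend' (continuousOn_iff_continuous_domRestrict.1 hy)) c d
  refine this.congr fun t ht => ?_
  have : t ∈ Icc a b := uIcc_subset_Icc hc hd (uIoc_subset_uIcc ht)
  simp [IccExtend_of_mem hab _ this]

end IsCaratheodoryField

theorem IsODESolution.sub_eq {g : ℝ → E → E} {K : ℝ → ℝ} (hg : IsCaratheodoryField g K)
    {a b : ℝ} {y : ℝ → E} (hy : IsODESolution g a b y) {c t : ℝ} (hc : c ∈ Icc a b)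
    (ht : t ∈ Icc a b) : y t = y c + ∫ s in c..t, g s (y s) := by
  have hab : a ≤ b := hc.1.trans hc.2
  have ha : a ∈ Icc a b := left_mem_Icc.2 hab
  rw [hy.2 t ht, hy.2 c hc, add_assoc, intervalIntegral.integral_add_adjacent_intervals]
  · exact hg.intervalIntegrable_of_continuousOn hy.1 ha hc
  · exact hg.intervalIntegrable_of_continuousOn hy.1 hc ht

theorem IsODESolution.of_sub_eq {g : ℝ → E → E} {K : ℝ → ℝ} (hg : IsCaratheodoryField g K)
    {a b c : ℝ} {y : ℝ → E} (hyc : ContinuousOn y (Icc a b)) (hc : c ∈ Icc a b)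
    (hy : ∀ t ∈ Icc a b, y t = y c + ∫ s in c..t, g s (y s)) : IsODESolution g a b y := by
  have hab : a ≤ b := hc.1.trans hc.2
  have ha : a ∈ Icc a b := left_mem_Icc.2 hab
  refine ⟨hyc, fun t ht => ?_⟩
  rw [hy t ht, hy a ha, add_assoc, intervalIntegral.integral_add_adjacent_intervals]
  · exact hg.intervalIntegrable_of_continuousOn hyc hc ha
  · exact hg.intervalIntegrable_of_continuousOn hyc ha ht

theorem IsODESolution.mono {g : ℝ → E → E} {K : ℝ → ℝ} (hg : IsCaratheodoryField g K)
    {a b c d : ℝ} {y : ℝ → E} (hy : IsODESolution g a b y) (hc : a ≤ c) (hd : d ≤ b) :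
    IsODESolution g c d y := by
  rcases le_or_gt c d with hcd | hcd
  · refine .of_sub_eq hg (hy.1.mono (Icc_subset_Icc hc hd)) (left_mem_Icc.2 hcd) fun t ht => ?_
    exact hy.sub_eq hg ⟨hc, hcd.trans hd⟩ ⟨hc.trans ht.1, ht.2.trans hd⟩
  · simp [IsODESolution, Icc_eq_empty (not_le.2 hcd)]

/-- Two solutions bounded by `R` separate at most exponentially, in both time directions. -/
theorem IsODESolution.norm_sub_le {g : ℝ → E → E} {K : ℝ → ℝ} (hg : IsCaratheodoryField g K)
    {a b c R : ℝ} {y z : ℝ → E} (hy : IsODESolution g a b y) (hz : IsODESolution g a b z)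
    (hyR : ∀ t ∈ Icc a b, ‖y t‖ ≤ R) (hzR : ∀ t ∈ Icc a b, ‖z t‖ ≤ R) (hc : c ∈ Icc a b) :
    ∀ t ∈ Icc a b, ‖y t - z t‖ ≤ ‖y c - z c‖ * Real.exp (K R * |t - c|) := by
  have hK : 0 ≤ K R := (norm_nonneg _).trans (hg.bound R c _ (hyR c hc))
  refine le_mul_exp_of_le_integral hK (hy.1.sub hz.1).norm hc (fun t ht => ?_)
    fun t _ => norm_nonneg _
  have hsub := uIcc_subset_Icc hc ht
  rw [hy.sub_eq hg hc ht, hz.sub_eq hg hc ht, add_sub_add_comm, ← intervalIntegral.integral_sub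
    (hg.intervalIntegrable_of_continuousOn hy.1 hc ht)
    (hg.intervalIntegrable_of_continuousOn hz.1 hc ht)]
  refine (norm_add_le _ _).trans (add_le_add le_rfl ?_)
  have hi : IntervalIntegrable (fun s => K R * ‖y s - z s‖) volume c t :=
    (((hy.1.sub hz.1).norm.mono hsub).const_smul (K R)).intervalIntegrable
  refine (intervalIntegral.norm_integral_le_abs_of_norm_le
    (g := fun s => K R * ‖y s - z s‖) ?_ hi).trans ?_
  · refine (ae_restrict_mem measurableSet_uIoc).mono fun s hs => ?_
    have := hsub (uIoc_subset_uIcc hs)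
    exact hg.lip R s _ _ (hyR s this) (hzR s this)
  · rw [intervalIntegral.integral_const_mul, abs_mul, abs_of_nonneg hK]

theorem IsODESolution.eqOn {g : ℝ → E → E} {K : ℝ → ℝ} (hg : IsCaratheodoryField g K)
    {a b c : ℝ} {y z : ℝ → E} (hy : IsODESolution g a b y) (hz : IsODESolution g a b z)
    (hc : c ∈ Icc a b) (h : y c = z c) : EqOn y z (Icc a b) := by
  obtain ⟨R, hR⟩ := isCompact_Icc.exists_bound_of_continuousOn hy.1
  obtain ⟨S, hS⟩ := isCompact_Icc.exists_bound_of_continuousOn hz.1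
  intro t ht
  have := hy.norm_sub_le hg hz (R := max R S) (fun t ht => (hR t ht).trans (le_max_left _ _))
    (fun t ht => (hS t ht).trans (le_max_right _ _)) hc t ht
  rw [h, sub_self, norm_zero, zero_mul] at this
  exact sub_eq_zero.1 (norm_le_zero_iff.1 this)

/-- Global existence for a Carathéodory field which is globally Lipschitz. -/
theorem exists_solution_of_lipschitz [CompleteSpace E] {g : ℝ → E → E} {L C a b c : ℝ}
    (hmeas : ∀ y : ℝ → E, Continuous y → AEStronglyMeasurable (fun t => g t (y t)) volume)
    (hbd : ∀ t, ‖g t 0‖ ≤ C) (hlip : ∀ t x y, ‖g t x - g t y‖ ≤ L * ‖x - y‖)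
    (hc : c ∈ Icc a b) (y₀ : E) :
    ∃ y : ℝ → E, Continuous y ∧ ∀ t ∈ Icc a b, y t = y₀ + ∫ s in c..t, g s (y s) := by
  have hab : a ≤ b := hc.1.trans hc.2
  have hne : Nonempty (Icc a b) := ⟨⟨c, hc⟩⟩
  rcases subsingleton_or_nontrivial E with hE | ⟨⟨e₁, e₂, he⟩⟩
  · exact ⟨fun _ => 0, continuous_const, fun t _ => Subsingleton.elim _ _⟩
  -- The Lipschitz bound forces a sign on `L` only if there are two distinct points, which is why
  -- the trivial space is split off.
  have hL : 0 ≤ L := by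
    have h1 := (norm_nonneg _).trans (hlip c e₁ e₂)
    exact nonneg_of_mul_nonneg_left h1 (norm_pos_iff.2 (sub_ne_zero.2 he))
  have hint : ∀ y : ℝ → E, Continuous y → ∀ c d, IntervalIntegrable (fun t => g t (y t))
      volume c d := by
    intro y hy c d
    obtain ⟨R, hR⟩ := isCompact_uIcc.exists_bound_of_continuousOn (f := y) (s := uIcc c d)
      hy.continuousOn
    rw [intervalIntegrable_iff]
    refine Measure.integrableOn_of_bounded (M := C + L * R) measure_Ioc_lt_top.ne (hmeas y hy) ?_
    refine (ae_restrict_mem measurableSet_uIoc).mono fun t ht => ?_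
    calc ‖g t (y t)‖ = ‖g t 0 + (g t (y t) - g t 0)‖ := by simp
      _ ≤ C + L * R := by
        refine (norm_add_le _ _).trans (add_le_add (hbd t) ((hlip _ _ _).trans ?_))
        rw [sub_zero]
        exact mul_le_mul_of_nonneg_left (hR t (uIoc_subset_uIcc ht)) hL
  have hext : ∀ α : C(Icc a b, E), Continuous (IccExtend hab α) := fun α => α.continuous.Icc_extend'
  let Φ : C(Icc a b, E) → C(Icc a b, E) := fun α =>
    ⟨fun t => y₀ + ∫ s in c..t, g s (IccExtend hab α s),
      (continuous_const.add ((intervalIntegral.continuous_primitive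
        (hint _ (hext α)) c).comp continuous_subtype_val))⟩
  have hΦ : ∀ α (t : Icc a b), Φ α t = y₀ + ∫ s in c..t, g s (IccExtend hab α s) :=
    fun _ _ => rfl
  -- Iterating the Picard map gains a factor `1 / k!`, so some iterate is a contraction on the whole
  -- interval, however long; the fixed point of that iterate is also fixed by `Φ`.
  have hit : ∀ (k : ℕ) (α β : C(Icc a b, E)) (t : Icc a b),
      ‖(Φ^[k] α) t - (Φ^[k] β) t‖ ≤ (L * |(t : ℝ) - c|) ^ k / k.factorial * dist α β := by
    intro k α β
    induction k with
    | zero => intro t; simpa [dist_eq_norm] using (α - β).norm_coe_le_norm t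
    | succ k ih =>
      intro t
      have hsub := uIcc_subset_Icc hc t.2
      rw [Function.iterate_succ_apply', Function.iterate_succ_apply', hΦ, hΦ,
        add_sub_add_left_eq_sub, ← intervalIntegral.integral_sub (hint _ (hext _) _ _)
          (hint _ (hext _) _ _)]
      have hcont : Continuous fun s : ℝ =>
        L * ((L * |s - c|) ^ k / k.factorial * dist α β) := by fun_prop
      refine (intervalIntegral.norm_integral_le_abs_of_norm_le
        (g := fun s => L * ((L * |s - c|) ^ k / k.factorial * dist α β)) ?_
        (hcont.intervalIntegrable _ _)).trans ?_
      · refine (ae_restrict_mem measurableSet_uIoc).mono fun s hs => ?_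
        have hs' := hsub (uIoc_subset_uIcc hs)
        rw [IccExtend_of_mem _ _ hs', IccExtend_of_mem _ _ hs']
        exact (hlip _ _ _).trans (mul_le_mul_of_nonneg_left (ih ⟨s, hs'⟩) hL)
      · have e1 : ∀ s : ℝ, L * ((L * |s - c|) ^ k / k.factorial * dist α β)
            = (L ^ (k + 1) / k.factorial * dist α β) * |s - c| ^ k := fun s => by
          rw [mul_pow]; ring
        simp_rw [e1]
        rw [intervalIntegral.integral_const_mul, abs_mul,
          intervalIntegral.abs_intervalIntegral_eq, integral_pow_abs_sub_uIoc,
          abs_of_nonneg (by positivity), abs_of_nonneg (by positivity)]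
        apply le_of_eq
        rw [Nat.factorial_succ]
        push_cast
        field_simp
        rw [mul_pow]
        ring
  obtain ⟨k, hk⟩ := ((FloorSemiring.tendsto_pow_div_factorial_atTop
    (L * (b - a))).eventually (gt_mem_nhds zero_lt_one)).exists
  have hk0 : 0 ≤ (L * (b - a)) ^ k / k.factorial := by
    have := sub_nonneg.2 hab
    positivity
  have hcontr : ContractingWith ⟨(L * (b - a)) ^ k / k.factorial, hk0⟩ Φ^[k] := by
    refine ⟨by exact_mod_cast hk, LipschitzWith.of_dist_le_mul fun α β => ?_⟩
    rw [ContinuousMap.dist_le (by positivity)]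
    intro t
    rw [dist_eq_norm]
    refine (hit k α β t).trans ?_
    have : |(t : ℝ) - c| ≤ b - a := abs_sub_le_of_le_of_le t.2.1 t.2.2 hc.1 hc.2
    refine mul_le_mul_of_nonneg_right ?_ dist_nonneg
    change _ ≤ (L * (b - a)) ^ k / k.factorial
    gcongr
  have hfix := hcontr.isFixedPt_fixedPoint_iterate
  set α := ContractingWith.fixedPoint Φ^[k] hcontr
  refine ⟨IccExtend hab α, hext α, fun t ht => ?_⟩
  have := congrArg (fun β : C(Icc a b, E) => β ⟨t, ht⟩) hfix
  simp only [hΦ] at this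
  rw [IccExtend_of_mem _ _ ht, ← this]

/-- Radial retraction of a normed space onto the closed ball of radius `R`. -/
noncomputable def radialClamp (R : ℝ) (x : E) : E := (R / max R ‖x‖) • x

theorem radialClamp_of_norm_le {R : ℝ} (hR : 0 < R) {x : E} (hx : ‖x‖ ≤ R) :
    radialClamp R x = x := by
  rw [radialClamp, max_eq_left hx, div_self hR.ne', one_smul]

theorem norm_radialClamp_le {R : ℝ} (hR : 0 < R) (x : E) : ‖radialClamp R x‖ ≤ R := by
  have hm : 0 < max R ‖x‖ := lt_max_of_lt_left hR
  rw [radialClamp, norm_smul, Real.norm_of_nonneg (by positivity), div_mul_eq_mul_div,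
    div_le_iff₀ hm]
  exact mul_le_mul_of_nonneg_left (le_max_right _ _) hR.le

theorem norm_radialClamp_sub_le {R : ℝ} (hR : 0 < R) (x y : E) :
    ‖radialClamp R x - radialClamp R y‖ ≤ 2 * ‖x - y‖ := by
  have hx : 0 < max R ‖x‖ := lt_max_of_lt_left hR
  have hy : 0 < max R ‖y‖ := lt_max_of_lt_left hR
  -- The constant 2 arises here: one `‖x - y‖` for moving the point at a fixed scale, one for the
  -- change of the scaling factor.
  have e : radialClamp R x - radialClamp R y
      = (R / max R ‖x‖) • (x - y) + (R / max R ‖x‖ - R / max R ‖y‖) • y := by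
    rw [radialClamp, radialClamp, smul_sub, sub_smul]; abel
  have h1 : ‖(R / max R ‖x‖) • (x - y)‖ ≤ ‖x - y‖ := by
    rw [norm_smul, Real.norm_of_nonneg (by positivity)]
    exact mul_le_of_le_one_left (norm_nonneg _) ((div_le_one hx).2 (le_max_left _ _))
  have h2 : ‖(R / max R ‖x‖ - R / max R ‖y‖) • y‖ ≤ ‖x - y‖ := by
    have e2 : R / max R ‖x‖ - R / max R ‖y‖
        = (R / max R ‖x‖) * ((max R ‖y‖ - max R ‖x‖) / max R ‖y‖) := by
      field_simp
    have h3 : |max R ‖y‖ - max R ‖x‖| ≤ ‖x - y‖ := by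
      refine (abs_max_sub_max_le_max R ‖y‖ R ‖x‖).trans ?_
      rw [sub_self, abs_zero, max_eq_right (abs_nonneg _), norm_sub_rev]
      exact abs_norm_sub_norm_le y x
    rw [e2, norm_smul, Real.norm_eq_abs, abs_mul, abs_of_nonneg (div_nonneg hR.le hx.le), abs_div,
      abs_of_pos hy]
    have h4 : R / max R ‖x‖ ≤ 1 := (div_le_one hx).2 (le_max_left _ _)
    have h5 : ‖y‖ / max R ‖y‖ ≤ 1 := (div_le_one hy).2 (le_max_right _ _)
    calc R / max R ‖x‖ * (|max R ‖y‖ - max R ‖x‖| / max R ‖y‖) * ‖y‖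
        = R / max R ‖x‖ * (|max R ‖y‖ - max R ‖x‖|) * (‖y‖ / max R ‖y‖) := by ring
      _ ≤ 1 * ‖x - y‖ * 1 := by gcongr
      _ = ‖x - y‖ := by ring
  rw [e, two_mul]
  exact (norm_add_le _ _).trans (add_le_add h1 h2)

theorem continuous_radialClamp {R : ℝ} (hR : 0 < R) : Continuous (radialClamp R : E → E) :=
  (LipschitzWith.of_dist_le_mul (K := 2) fun x y => by
    simpa [dist_eq_norm] using norm_radialClamp_sub_le hR x y).continuous

/-- Clamping the state makes a locally Lipschitz field globally Lipschitz, so that global existence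
applies. The factor 2 is the Lipschitz constant of the clamp. -/
theorem IsCaratheodoryField.truncate {g : ℝ → E → E} {K : ℝ → ℝ} (hg : IsCaratheodoryField g K)
    {R : ℝ} (hR : 0 < R) :
    IsCaratheodoryField (fun t x => g t (radialClamp R x)) (fun _ => 2 * K R) where
  meas y hy := hg.meas _ ((continuous_radialClamp hR).comp hy)
  bound S t x _ := by
    have := hg.bound R t _ (norm_radialClamp_le hR x)
    linarith [norm_nonneg (g t (radialClamp R x))]
  lip S t x y _ _ := by
    have hK : 0 ≤ K R := (norm_nonneg _).trans (hg.bound R t _ (norm_radialClamp_le hR x))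
    calc _ ≤ K R * ‖radialClamp R x - radialClamp R y‖ :=
          hg.lip R t _ _ (norm_radialClamp_le hR x) (norm_radialClamp_le hR y)
      _ ≤ K R * (2 * ‖x - y‖) := mul_le_mul_of_nonneg_left (norm_radialClamp_sub_le hR x y) hK
      _ = 2 * K R * ‖x - y‖ := by ring

theorem isODESolution_truncate_iff {g : ℝ → E → E} {a b R : ℝ} {y : ℝ → E} (hR : 0 < R)
    (hy : ∀ t ∈ Icc a b, ‖y t‖ ≤ R) :
    IsODESolution (fun t x => g t (radialClamp R x)) a b y ↔ IsODESolution g a b y := by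
  refine and_congr_right fun _ => forall₂_congr fun t ht => ?_
  have : ∫ s in a..t, g s (radialClamp R (y s)) = ∫ s in a..t, g s (y s) :=
    intervalIntegral.integral_congr fun s hs => by
      rw [uIcc_of_le ht.1] at hs
      simp only [radialClamp_of_norm_le hR (hy s ⟨hs.1, hs.2.trans ht.2⟩)]
  rw [this]

theorem IsCaratheodoryField.exists_truncated_solution [CompleteSpace E] {g : ℝ → E → E}
    {K : ℝ → ℝ} (hg : IsCaratheodoryField g K) {R a b c : ℝ} (hR : 0 < R) (hc : c ∈ Icc a b)
    (y₀ : E) : ∃ z, IsODESolution (fun t x => g t (radialClamp R x)) a b z ∧ z c = y₀ ∧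
      ∀ t ∈ Icc a b, ‖z t - y₀‖ ≤ K R * |t - c| := by
  have ht := hg.truncate hR
  obtain ⟨z, hzc, hz⟩ := exists_solution_of_lipschitz (c := c) (a := a) (b := b) ht.meas
    (fun t => ht.bound 0 t 0 (by simp))
    (fun t x y => ht.lip (max ‖x‖ ‖y‖) t x y (le_max_left _ _) (le_max_right _ _)) hc y₀
  have hzy : z c = y₀ := by simpa using hz c hc
  refine ⟨z, .of_sub_eq ht hzc.continuousOn hc (by rwa [hzy]), hzy, fun t ht => ?_⟩
  rw [hz t ht, add_sub_cancel_left]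
  exact intervalIntegral.norm_integral_le_of_norm_le_const fun s _ =>
    hg.bound R s _ (norm_radialClamp_le hR _)

/-- Near a solution there are solutions with any nearby value at a given time. -/
theorem IsODESolution.exists_near [CompleteSpace E] {g : ℝ → E → E} {K : ℝ → ℝ}
    (hg : IsCaratheodoryField g K) {a b c R : ℝ} {y : ℝ → E} (hy : IsODESolution g a b y)
    (hyR : ∀ t ∈ Icc a b, ‖y t‖ ≤ R) (hc : c ∈ Icc a b) {y₀ : E}
    (h : ‖y₀ - y c‖ * Real.exp (2 * K (R + 1) * (b - a)) ≤ 1) :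
    ∃ z, IsODESolution g a b z ∧ z c = y₀ ∧
      ∀ t ∈ Icc a b, ‖z t - y t‖ ≤ ‖y₀ - y c‖ * Real.exp (2 * K (R + 1) * (b - a)) := by
  have hR : 0 < R + 1 := by linarith [(norm_nonneg _).trans (hyR c hc)]
  have hyR' : ∀ t ∈ Icc a b, ‖y t‖ ≤ R + 1 := fun t ht => by linarith [hyR t ht]
  have hK : 0 ≤ K (R + 1) := (norm_nonneg _).trans (hg.bound (R + 1) c _ (hyR' c hc))
  -- Truncation at `R + 1` leaves room 1 around `y`; the Grönwall estimate keeps `z` within that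
  -- room, so the truncation is never active along `z`.
  obtain ⟨z, hz, hzc, -⟩ := hg.exists_truncated_solution hR hc y₀
  obtain ⟨S, hS⟩ := isCompact_Icc.exists_bound_of_continuousOn hz.1
  have hyt := (isODESolution_truncate_iff hR hyR').2 hy
  have key : ∀ t ∈ Icc a b,
      ‖z t - y t‖ ≤ ‖y₀ - y c‖ * Real.exp (2 * K (R + 1) * (b - a)) := fun t ht => by
    have := hz.norm_sub_le (hg.truncate hR) hyt (R := max S (R + 1))
      (fun t ht => (hS t ht).trans (le_max_left _ _))
      (fun t ht => (hyR' t ht).trans (le_max_right _ _)) hc t ht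
    rw [hzc] at this
    refine this.trans ?_
    have : |t - c| ≤ b - a := abs_sub_le_of_le_of_le ht.1 ht.2 hc.1 hc.2
    gcongr
  refine ⟨z, (isODESolution_truncate_iff hR fun t ht => ?_).1 hz, hzc, key⟩
  calc ‖z t‖ = ‖(z t - y t) + y t‖ := by simp
    _ ≤ 1 + R := (norm_add_le _ _).trans (add_le_add ((key t ht).trans h) (hyR t ht))
    _ = R + 1 := add_comm _ _

/-- The field truncated at `R + 1` has speed at most `K (R + 1)`, too slow to travel further than 1
in the given time. So the truncation is inactive, and uniqueness transfers the bound to `y`. -/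
theorem IsODESolution.norm_le_add_one [CompleteSpace E] {g : ℝ → E → E} {K : ℝ → ℝ}
    (hg : IsCaratheodoryField g K) {a b R : ℝ} {y : ℝ → E} (hy : IsODESolution g a b y)
    (hR : ‖y a‖ ≤ R) (h : K (R + 1) * (b - a) ≤ 1) : ∀ t ∈ Icc a b, ‖y t‖ ≤ R + 1 := by
  intro t ht
  have ha : a ∈ Icc a b := left_mem_Icc.2 (ht.1.trans ht.2)
  have hR' : 0 < R + 1 := by linarith [(norm_nonneg _).trans hR]
  have hK : 0 ≤ K (R + 1) := (norm_nonneg _).trans (hg.bound (R + 1) a (y a) (by linarith))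
  obtain ⟨z, hz, hzc, hzb⟩ := hg.exists_truncated_solution hR' ha (y a)
  have hzR : ∀ t ∈ Icc a b, ‖z t‖ ≤ R + 1 := fun t ht => by
    have h1 : K (R + 1) * |t - a| ≤ 1 := by
      rw [abs_of_nonneg (sub_nonneg.2 ht.1)]
      exact (mul_le_mul_of_nonneg_left (sub_le_sub_right ht.2 a) hK).trans h
    calc ‖z t‖ = ‖(z t - y a) + y a‖ := by simp
      _ ≤ 1 + R := (norm_add_le _ _).trans (add_le_add ((hzb t ht).trans h1) hR)
      _ = R + 1 := add_comm _ _
  rw [hy.eqOn hg ((isODESolution_truncate_iff hR' hzR).1 hz) ha hzc.symm ht]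
  exact hzR t ht

end ODE

/-! ### Regular problems: uniform bounds on balls, and trajectories as solutions of Carathéodory
equations. -/

theorem aemeasurable_ite {α β : Type*} [MeasurableSpace α] [MeasurableSpace β] {μ : Measure α}
    {f g : α → β} {p : α → Prop} [DecidablePred p] (hp : MeasurableSet {a | p a})
    (hf : AEMeasurable f μ) (hg : AEMeasurable g μ) :
    AEMeasurable (fun a => if p a then f a else g a) μ := by
  refine ⟨fun a => if p a then hf.mk f a else hg.mk g a,
    Measurable.ite hp hf.measurable_mk hg.measurable_mk, ?_⟩
  filter_upwards [hf.ae_eq_mk, hg.ae_eq_mk] with a h1 h2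
  rw [h1, h2]

namespace ControlProblem

variable {n m : ℕ}

/-- The regularity of the data which is used below: `f`, `F` and their state derivatives are
continuous, and the control set is compact. -/
structure IsRegular (P : ControlProblem n m) : Prop where
  f_cont : ContinuousOn (fun z : EuclideanSpace ℝ (Fin n) × EuclideanSpace ℝ (Fin m) × ℝ =>
    P.f z.1 z.2.1 z.2.2) P.domain
  F_cont : ContinuousOn (fun z : EuclideanSpace ℝ (Fin n) × EuclideanSpace ℝ (Fin m) × ℝ =>
    P.F z.1 z.2.1 z.2.2) P.domain
  diff : ∀ x : EuclideanSpace ℝ (Fin n), ∀ u ∈ P.U, ∀ t ∈ Icc P.t₀ P.T,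
    DifferentiableAt ℝ (fun y => P.f y u t) x ∧ DifferentiableAt ℝ (fun y => P.F y u t) x
  fderiv_f_cont :
    ContinuousOn (fun z : EuclideanSpace ℝ (Fin n) × EuclideanSpace ℝ (Fin m) × ℝ =>
      fderiv ℝ (fun y => P.f y z.2.1 z.2.2) z.1) P.domain
  fderiv_F_cont :
    ContinuousOn (fun z : EuclideanSpace ℝ (Fin n) × EuclideanSpace ℝ (Fin m) × ℝ =>
      fderiv ℝ (fun y => P.F y z.2.1 z.2.2) z.1) P.domain
  compact : IsCompact P.U

/-- A control defined on the whole time axis. -/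
def IsControl (P : ControlProblem n m) (u : ℝ → EuclideanSpace ℝ (Fin m)) : Prop :=
  (∀ t, u t ∈ P.U) ∧ AEMeasurable u volume

/-- `K R` bounds the data and their state derivatives over the ball of radius `R`. -/
structure IsBound (P : ControlProblem n m) (K : ℝ → ℝ) : Prop where
  mono : Monotone K
  nonneg : ∀ R, 0 ≤ K R
  f_le : ∀ R x, ‖x‖ ≤ R → ∀ u ∈ P.U, ∀ t ∈ Icc P.t₀ P.T, ‖P.f x u t‖ ≤ K R
  F_le : ∀ R x, ‖x‖ ≤ R → ∀ u ∈ P.U, ∀ t ∈ Icc P.t₀ P.T, |P.F x u t| ≤ K R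
  fderiv_f_le : ∀ R x, ‖x‖ ≤ R → ∀ u ∈ P.U, ∀ t ∈ Icc P.t₀ P.T,
    ‖fderiv ℝ (fun y => P.f y u t) x‖ ≤ K R
  fderiv_F_le : ∀ R x, ‖x‖ ≤ R → ∀ u ∈ P.U, ∀ t ∈ Icc P.t₀ P.T,
    ‖fderiv ℝ (fun y => P.F y u t) x‖ ≤ K R

variable {P : ControlProblem n m}

theorem IsRegular.exists_norm_le {G : Type*} [NormedAddCommGroup G] (hP : P.IsRegular)
    {φ : EuclideanSpace ℝ (Fin n) × EuclideanSpace ℝ (Fin m) × ℝ → G}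
    (hφ : ContinuousOn φ P.domain) (R : ℝ) :
    ∃ C, ∀ x, ‖x‖ ≤ R → ∀ u ∈ P.U, ∀ t ∈ Icc P.t₀ P.T, ‖φ (x, u, t)‖ ≤ C := by
  have hc : IsCompact (Metric.closedBall (0 : EuclideanSpace ℝ (Fin n)) R ×ˢ P.U ×ˢ
      Icc P.t₀ P.T) := (isCompact_closedBall _ _).prod (hP.compact.prod isCompact_Icc)
  obtain ⟨C, hC⟩ := hc.exists_bound_of_continuousOn
    (hφ.mono (prod_mono (subset_univ _) le_rfl))
  exact ⟨C, fun x hx u hu t ht => hC (x, u, t) ⟨by simpa using hx, hu, ht⟩⟩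

theorem IsRegular.exists_isBound (hP : P.IsRegular) : ∃ K, P.IsBound K := by
  choose C1 h1 using fun N : ℕ => hP.exists_norm_le hP.f_cont N
  choose C2 h2 using fun N : ℕ => hP.exists_norm_le hP.F_cont N
  choose C3 h3 using fun N : ℕ => hP.exists_norm_le hP.fderiv_f_cont N
  choose C4 h4 using fun N : ℕ => hP.exists_norm_le hP.fderiv_F_cont N
  let c : ℕ → ℝ := fun N => |C1 N| + |C2 N| + |C3 N| + |C4 N|
  -- Summing the constants of all integer radii up to `⌈R⌉₊`, instead of taking the last one, makes
  -- the bound monotone in `R`.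
  let K : ℝ → ℝ := fun R => ∑ j ∈ Finset.range (⌈R⌉₊ + 1), c j
  have hc0 : ∀ j, 0 ≤ c j := fun j => by positivity
  have hcK : ∀ R, c ⌈R⌉₊ ≤ K R := fun R =>
    Finset.single_le_sum (f := c) (fun j _ => hc0 j) (by simp)
  have hR : ∀ R (x : EuclideanSpace ℝ (Fin n)), ‖x‖ ≤ R → ‖x‖ ≤ (⌈R⌉₊ : ℝ) := fun R x hx =>
    hx.trans (Nat.le_ceil R)
  have a1 := fun j => le_abs_self (C1 j)
  have a2 := fun j => le_abs_self (C2 j)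
  have a3 := fun j => le_abs_self (C3 j)
  have a4 := fun j => le_abs_self (C4 j)
  have b1 := fun j => abs_nonneg (C1 j)
  have b2 := fun j => abs_nonneg (C2 j)
  have b3 := fun j => abs_nonneg (C3 j)
  have b4 := fun j => abs_nonneg (C4 j)
  have hc : ∀ j, C1 j ≤ c j ∧ C2 j ≤ c j ∧ C3 j ≤ c j ∧ C4 j ≤ c j := fun j => by
    have := a1 j; have := a2 j; have := a3 j; have := a4 j
    have := b1 j; have := b2 j; have := b3 j; have := b4 j
    simp only [c]
    refine ⟨?_, ?_, ?_, ?_⟩ <;> linarith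
  refine ⟨K, fun R S hRS => ?_, fun R => Finset.sum_nonneg fun j _ => hc0 j, ?_, ?_, ?_, ?_⟩
  · exact Finset.sum_le_sum_of_subset_of_nonneg
      (Finset.range_mono (Nat.add_le_add_right (Nat.ceil_mono hRS) 1)) fun j _ _ => hc0 j
  · exact fun R x hx u hu t ht =>
      (h1 _ x (hR R x hx) u hu t ht).trans ((hc _).1.trans (hcK R))
  · exact fun R x hx u hu t ht =>
      (h2 _ x (hR R x hx) u hu t ht).trans ((hc _).2.1.trans (hcK R))
  · exact fun R x hx u hu t ht =>
      (h3 _ x (hR R x hx) u hu t ht).trans ((hc _).2.2.1.trans (hcK R))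
  · exact fun R x hx u hu t ht =>
      (h4 _ x (hR R x hx) u hu t ht).trans ((hc _).2.2.2.trans (hcK R))

theorem IsBound.f_lip {K : ℝ → ℝ} (hK : P.IsBound K) (hP : P.IsRegular) {R : ℝ}
    {x y : EuclideanSpace ℝ (Fin n)} (hx : ‖x‖ ≤ R) (hy : ‖y‖ ≤ R)
    {u : EuclideanSpace ℝ (Fin m)} (hu : u ∈ P.U) {t : ℝ} (ht : t ∈ Icc P.t₀ P.T) :
    ‖P.f x u t - P.f y u t‖ ≤ K R * ‖x - y‖ :=
  (convex_closedBall (0 : EuclideanSpace ℝ (Fin n)) R).norm_image_sub_le_of_norm_fderiv_le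
    (𝕜 := ℝ) (f := fun y => P.f y u t)
    (fun z _ => (hP.diff z u hu t ht).1)
    (fun z hz => hK.fderiv_f_le R z (by simpa using hz) u hu t ht)
    (by simpa using hy) (by simpa using hx)

theorem IsBound.F_lip {K : ℝ → ℝ} (hK : P.IsBound K) (hP : P.IsRegular) {R : ℝ}
    {x y : EuclideanSpace ℝ (Fin n)} (hx : ‖x‖ ≤ R) (hy : ‖y‖ ≤ R)
    {u : EuclideanSpace ℝ (Fin m)} (hu : u ∈ P.U) {t : ℝ} (ht : t ∈ Icc P.t₀ P.T) :
    ‖P.F x u t - P.F y u t‖ ≤ K R * ‖x - y‖ :=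
  (convex_closedBall (0 : EuclideanSpace ℝ (Fin n)) R).norm_image_sub_le_of_norm_fderiv_le
    (𝕜 := ℝ) (f := fun y => P.F y u t)
    (fun z _ => (hP.diff z u hu t ht).2)
    (fun z hz => hK.fderiv_F_le R z (by simpa using hz) u hu t ht)
    (by simpa using hy) (by simpa using hx)

theorem IsRegular.aemeasurable_comp {G : Type*} [NormedAddCommGroup G] [MeasurableSpace G]
    [BorelSpace G] (hP : P.IsRegular)
    {φ : EuclideanSpace ℝ (Fin n) × EuclideanSpace ℝ (Fin m) × ℝ → G}
    (hφ : ContinuousOn φ P.domain) {y : ℝ → EuclideanSpace ℝ (Fin n)} (hy : AEMeasurable y volume)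
    {u : ℝ → EuclideanSpace ℝ (Fin m)} (hu : P.IsControl u) :
    AEMeasurable (fun t => if t ∈ Icc P.t₀ P.T then φ (y t, u t, t) else 0) volume := by
  classical
  have hd : MeasurableSet P.domain :=
    MeasurableSet.univ.prod (hP.compact.isClosed.measurableSet.prod measurableSet_Icc)
  have hm := hφ.measurable_piecewise (continuousOn_const (c := (0 : G))) hd
  have := hm.comp_aemeasurable (hy.prodMk (hu.2.prodMk aemeasurable_id))
  refine this.congr (ae_of_all _ fun t => ?_)
  simp only [Function.comp, Set.piecewise, domain, mem_prod, mem_univ, true_and, hu.1 t, id]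

/-- The vector field of the state equation driven by a control. -/
noncomputable def field (P : ControlProblem n m) (u : ℝ → EuclideanSpace ℝ (Fin m)) (t : ℝ)
    (x : EuclideanSpace ℝ (Fin n)) : EuclideanSpace ℝ (Fin n) :=
  open Classical in if t ∈ Icc P.t₀ P.T then P.f x (u t) t else 0

theorem field_of_mem (u : ℝ → EuclideanSpace ℝ (Fin m)) {t : ℝ} (ht : t ∈ Icc P.t₀ P.T)
    (x : EuclideanSpace ℝ (Fin n)) : P.field u t x = P.f x (u t) t := if_pos ht

theorem IsBound.isCaratheodoryField {K : ℝ → ℝ} (hK : P.IsBound K) (hP : P.IsRegular)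
    {u : ℝ → EuclideanSpace ℝ (Fin m)} (hu : P.IsControl u) :
    IsCaratheodoryField (P.field u) K where
  meas y hy := by
    have := (hP.aemeasurable_comp hP.f_cont hy.aemeasurable hu).aestronglyMeasurable
    refine this.congr (ae_of_all _ fun t => ?_)
    simp only [field]
  bound R t x hx := by
    by_cases ht : t ∈ Icc P.t₀ P.T
    · rw [field_of_mem u ht]
      exact hK.f_le R x hx _ (hu.1 t) t ht
    · simp only [field, if_neg ht, norm_zero]
      exact hK.nonneg R
  lip R t x y hx hy := by
    by_cases ht : t ∈ Icc P.t₀ P.T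
    · rw [field_of_mem u ht, field_of_mem u ht]
      exact hK.f_lip hP hx hy (hu.1 t) ht
    · simp only [field, if_neg ht, sub_zero, norm_zero]
      have := hK.nonneg R
      positivity

theorem IsControl.isAdmissible {u : ℝ → EuclideanSpace ℝ (Fin m)} (hu : P.IsControl u) (τ : ℝ) :
    P.IsAdmissible τ u :=
  ⟨fun t _ => hu.1 t, hu.2.restrict⟩

theorem isTrajectory_iff (hP : P.IsRegular) {u : ℝ → EuclideanSpace ℝ (Fin m)}
    (hu : P.IsControl u) {τ : ℝ} (hτ : τ ∈ Ico P.t₀ P.T) {x₀ : EuclideanSpace ℝ (Fin n)}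
    {x : ℝ → EuclideanSpace ℝ (Fin n)} :
    P.IsTrajectory x₀ τ u x ↔ IsODESolution (P.field u) τ P.T x ∧ x τ = x₀ := by
  obtain ⟨K, hK⟩ := hP.exists_isBound
  have hg := hK.isCaratheodoryField hP hu
  have hsub : ∀ t ∈ Icc τ P.T, t ∈ Icc P.t₀ P.T := fun t ht => ⟨hτ.1.trans ht.1, ht.2⟩
  have hint : ∀ t ∈ Icc τ P.T, ∫ s in τ..t, P.f (x s) (u s) s = ∫ s in τ..t, P.field u s (x s) :=
    fun t ht => intervalIntegral.integral_congr fun s hs => by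
      rw [uIcc_of_le ht.1] at hs
      exact (field_of_mem u (hsub s ⟨hs.1, hs.2.trans ht.2⟩) _).symm
  constructor
  · rintro ⟨hc, ⟨-, h⟩, h0⟩
    exact ⟨⟨hc, fun t ht => by rw [h t ht, hint t ht]⟩, h0⟩
  · rintro ⟨⟨hc, h⟩, h0⟩
    have hle := hτ.2.le
    refine ⟨hc, ⟨?_, fun t ht => by rw [h t ht, hint t ht]⟩, h0⟩
    refine (hg.intervalIntegrable_of_continuousOn hc (left_mem_Icc.2 hle)
      (right_mem_Icc.2 hle)).congr fun t ht => ?_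
    rw [uIoc_of_le hle] at ht
    exact field_of_mem u (hsub t (Ioc_subset_Icc_self ht)) _

/-- Every admissible control is the restriction of a control on the whole time axis. -/
theorem IsAdmissible.exists_isControl {τ : ℝ} (hτ : τ ≤ P.T) {u : ℝ → EuclideanSpace ℝ (Fin m)}
    (hu : P.IsAdmissible τ u) : ∃ v, P.IsControl v ∧ EqOn v u (Icc τ P.T) := by
  classical
  -- The value `u τ` is a point of `U` that is always at hand.
  refine ⟨fun t => if t ∈ Icc τ P.T then u t else u τ, ⟨fun t => ?_, ?_⟩,
    fun t ht => if_pos ht⟩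
  · dsimp only
    split_ifs with h
    · exact hu.1 t h
    · exact hu.1 τ (left_mem_Icc.2 hτ)
  · have h1 : AEMeasurable ((Icc τ P.T).indicator fun t => u t - u τ) volume :=
      (aemeasurable_indicator_iff measurableSet_Icc).2 (hu.2.sub aemeasurable_const)
    refine (h1.add_const (u τ)).congr (ae_of_all _ fun t => ?_)
    by_cases h : t ∈ Icc τ P.T <;> simp [h]

theorem isTrajectory_congr {τ : ℝ} {u v : ℝ → EuclideanSpace ℝ (Fin m)} (hτ : τ ≤ P.T)
    (h : u =ᵐ[volume.restrict (Icc τ P.T)] v) {x₀ : EuclideanSpace ℝ (Fin n)}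
    {x : ℝ → EuclideanSpace ℝ (Fin n)} (hx : P.IsTrajectory x₀ τ u x) :
    P.IsTrajectory x₀ τ v x := by
  obtain ⟨hc, ⟨hi, hx⟩, h0⟩ := hx
  have h' : ∀ᵐ t, t ∈ Icc τ P.T → u t = v t := (ae_restrict_iff' measurableSet_Icc).1 h
  refine ⟨hc, ⟨hi.congr_ae ?_, fun t ht => ?_⟩, h0⟩
  · rw [uIoc_of_le hτ]
    refine (ae_restrict_iff' measurableSet_Ioc).2 (h'.mono fun t ht hm => ?_)
    simp only [ht (Ioc_subset_Icc_self hm)]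
  · rw [hx t ht]
    congr 1
    refine intervalIntegral.integral_congr_ae (h'.mono fun s hs hm => ?_)
    rw [uIoc_of_le ht.1] at hm
    simp only [hs ⟨hm.1.le, hm.2.trans ht.2⟩]

theorem cost_congr {τ : ℝ} {u v : ℝ → EuclideanSpace ℝ (Fin m)} (hτ : τ ≤ P.T)
    (h : u =ᵐ[volume.restrict (Icc τ P.T)] v) {x y : ℝ → EuclideanSpace ℝ (Fin n)}
    (hxy : EqOn x y (Icc τ P.T)) : P.cost τ u x = P.cost τ v y := by
  have h' : ∀ᵐ t, t ∈ Icc τ P.T → u t = v t := (ae_restrict_iff' measurableSet_Icc).1 h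
  refine intervalIntegral.integral_congr_ae (h'.mono fun s hs hm => ?_)
  rw [uIoc_of_le hτ] at hm
  simp only [hs (Ioc_subset_Icc_self hm), hxy (Ioc_subset_Icc_self hm)]

theorem HasTrajectories.exists_solution (hT : P.HasTrajectories) (hP : P.IsRegular)
    {u : ℝ → EuclideanSpace ℝ (Fin m)} (hu : P.IsControl u) {τ : ℝ} (hτ : τ ∈ Ico P.t₀ P.T)
    (x₀ : EuclideanSpace ℝ (Fin n)) :
    ∃ x, IsODESolution (P.field u) τ P.T x ∧ x τ = x₀ := by
  obtain ⟨x, hx⟩ := hT τ hτ x₀ u (hu.isAdmissible τ)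
  exact ⟨x, (isTrajectory_iff hP hu hτ).1 hx⟩

end ControlProblem

/-! ### Concatenation of solutions. -/

section Gluing

variable {E : Type*} [NormedAddCommGroup E] [NormedSpace ℝ E]

theorem IsODESolution.congr_field {g h : ℝ → E → E} {a b : ℝ} {y : ℝ → E}
    (hy : IsODESolution g a b y) (hgh : ∀ t ∈ Ioc a b, ∀ x, g t x = h t x) :
    IsODESolution h a b y := by
  refine ⟨hy.1, fun t ht => ?_⟩
  rw [hy.2 t ht]
  congr 1
  refine intervalIntegral.integral_congr_ae (ae_of_all _ fun s hs => ?_)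
  rw [uIoc_of_le ht.1] at hs
  exact hgh s ⟨hs.1, hs.2.trans ht.2⟩ _

theorem IsODESolution.glue {g : ℝ → E → E} {K : ℝ → ℝ} (hg : IsCaratheodoryField g K)
    {a b c : ℝ} {y z : ℝ → E} (hab : a ≤ b) (hbc : b ≤ c)
    (hy : IsODESolution g a b y) (hz : IsODESolution g b c z) (h : y b = z b) :
    IsODESolution g a c (fun t => if t ≤ b then y t else z t) := by
  have hL : EqOn (fun t => if t ≤ b then y t else z t) y (Icc a b) := fun t ht => if_pos ht.2
  have hR : EqOn (fun t => if t ≤ b then y t else z t) z (Icc b c) := fun t ht => by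
    rcases ht.1.eq_or_lt with rfl | hlt
    · simpa using h
    · exact if_neg (not_le.2 hlt)
  have hc : ContinuousOn (fun t => if t ≤ b then y t else z t) (Icc a c) := by
    rw [← Icc_union_Icc_eq_Icc hab hbc]
    exact (hy.1.congr hL).union_of_isClosed (hz.1.congr hR) isClosed_Icc isClosed_Icc
  have hb : b ∈ Icc a c := ⟨hab, hbc⟩
  generalize (fun t => if t ≤ b then y t else z t) = Y at hL hR hc ⊢
  refine .of_sub_eq hg hc hb fun t ht => ?_
  have hbL : b ∈ Icc a b := right_mem_Icc.2 hab
  have hbR : b ∈ Icc b c := left_mem_Icc.2 hbc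
  rcases le_total t b with htb | htb
  · rw [hL ⟨ht.1, htb⟩, hL hbL, hy.sub_eq hg hbL ⟨ht.1, htb⟩]
    congr 1
    refine intervalIntegral.integral_congr fun s hs => ?_
    rw [hL (uIcc_subset_Icc hbL ⟨ht.1, htb⟩ hs)]
  · rw [hR ⟨htb, ht.2⟩, hR hbR, hz.sub_eq hg hbR ⟨htb, ht.2⟩]
    congr 1
    refine intervalIntegral.integral_congr fun s hs => ?_
    rw [hR (uIcc_subset_Icc hbR ⟨htb, ht.2⟩ hs)]

end Gluing

/-! ### Uniform boundedness of the trajectories from one initial datum. -/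

namespace ControlProblem

variable {n m : ℕ} {P : ControlProblem n m}

theorem IsControl.ite {u v : ℝ → EuclideanSpace ℝ (Fin m)} (hu : P.IsControl u)
    (hv : P.IsControl v) (p : ℝ → Prop) [DecidablePred p] (hp : MeasurableSet {t | p t}) :
    P.IsControl (fun t => if p t then u t else v t) :=
  ⟨fun t => by dsimp only; split_ifs; exacts [hu.1 t, hv.1 t], aemeasurable_ite hp hu.2 hv.2⟩

theorem field_congr {u v : ℝ → EuclideanSpace ℝ (Fin m)} {t : ℝ} (h : u t = v t)
    (x : EuclideanSpace ℝ (Fin n)) : P.field u t x = P.field v t x := by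
  simp only [field, h]

/-- The trajectories starting from `x` at time `s` are not uniformly bounded. -/
def IsUnboundedFrom (P : ControlProblem n m) (x : EuclideanSpace ℝ (Fin n)) (s : ℝ) : Prop :=
  ∀ M : ℝ, ∃ u y, P.IsControl u ∧ IsODESolution (P.field u) s P.T y ∧ y s = x ∧
    ∃ t ∈ Icc s P.T, M < ‖y t‖

/-- If all trajectories from `x` stayed in a ball of radius `M`, Grönwall with a constant depending
on `M` but not on the control would keep each `y j` with `j` large within 1 of the trajectory of `u
j` from `x`, hence below `M + 1`. -/
theorem isUnboundedFrom_of_tendsto (hP : P.IsRegular) (hT : P.HasTrajectories) {s : ℝ}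
    (hs : s ∈ Ico P.t₀ P.T) {u : ℕ → ℝ → EuclideanSpace ℝ (Fin m)}
    {y : ℕ → ℝ → EuclideanSpace ℝ (Fin n)} (hu : ∀ j, P.IsControl (u j))
    (hy : ∀ j, IsODESolution (P.field (u j)) s P.T (y j))
    (hbig : ∀ M : ℝ, ∀ᶠ j in atTop, ∃ t ∈ Icc s P.T, M < ‖y j t‖)
    {x : EuclideanSpace ℝ (Fin n)} (hx : Tendsto (fun j => y j s) atTop (𝓝 x)) :
    P.IsUnboundedFrom x s := by
  obtain ⟨K, hK⟩ := hP.exists_isBound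
  by_contra hcon
  unfold IsUnboundedFrom at hcon
  push Not at hcon
  obtain ⟨M, hM⟩ := hcon
  have hlim : Tendsto (fun j => ‖y j s - x‖ * Real.exp (2 * K (M + 1) * (P.T - s))) atTop (𝓝 0) := by
    have := (tendsto_iff_norm_sub_tendsto_zero.1 hx).mul_const
      (Real.exp (2 * K (M + 1) * (P.T - s)))
    simpa using this
  obtain ⟨j, hj, t, ht, hjt⟩ :=
    ((hlim.eventually (ge_mem_nhds zero_lt_one)).and (hbig (M + 1))).exists
  have hg := hK.isCaratheodoryField hP (hu j)
  obtain ⟨w, hw, hws⟩ := hT.exists_solution hP (hu j) hs x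
  have hwM := hM (u j) w (hu j) hw hws
  have hss : s ∈ Icc s P.T := left_mem_Icc.2 hs.2.le
  rw [← hws] at hj
  obtain ⟨z, hz, hzs, hzw⟩ := hw.exists_near hg hwM hss hj
  rw [(hy j).eqOn hg hz hss hzs.symm ht] at hjt
  have h1 := (hzw t ht).trans hj
  have h2 := hwM t ht
  have h3 : ‖z t‖ ≤ ‖z t - w t‖ + ‖w t‖ := by simpa using norm_add_le (z t - w t) (w t)
  linarith

/-- Over a short time the trajectories from `y s` stay in a fixed ball, so their positions at `s'`
accumulate at a point from which trajectories are again unbounded. Reaching that point exactly,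
rather than approximately, costs a small displacement of the starting point at time `s₀`. -/
theorem IsUnboundedFrom.exists_extension (hP : P.IsRegular) (hT : P.HasTrajectories)
    {K : ℝ → ℝ} (hK : P.IsBound K) {s₀ s s' r : ℝ} (hs₀ : P.t₀ ≤ s₀) (hs : s₀ ≤ s)
    {w : ℝ → EuclideanSpace ℝ (Fin m)} {y : ℝ → EuclideanSpace ℝ (Fin n)} (hw : P.IsControl w)
    (hy : IsODESolution (P.field w) s₀ s y) (hun : P.IsUnboundedFrom (y s) s)
    (hss' : s < s') (hs' : K (‖y s‖ + 1) * (s' - s) ≤ 1) (hr : 0 < r) :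
    s' < P.T ∧ ∃ w' y', P.IsControl w' ∧ EqOn w' w (Iic s) ∧
      IsODESolution (P.field w') s₀ s' y' ∧ dist (y' s₀) (y s₀) ≤ r ∧
      P.IsUnboundedFrom (y' s') s' := by
  classical
  -- The entry `j` makes the excursions unbounded; the entry `‖y s‖ + 1` forces them to happen after
  -- `s'`, and hence gives `s' < P.T`.
  choose u Y hu hY hYs hbig using fun j : ℕ => hun (max j (‖y s‖ + 1))
  have hg := fun j => hK.isCaratheodoryField hP (hu j)
  have hsmall : ∀ j, ∀ b ≤ P.T, b ≤ s' → ∀ t ∈ Icc s b, ‖Y j t‖ ≤ ‖y s‖ + 1 := by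
    intro j b hbT hbs'
    refine ((hY j).mono (hg j) le_rfl hbT).norm_le_add_one (hg j) (by rw [hYs]) ?_
    exact (mul_le_mul_of_nonneg_left (sub_le_sub_right hbs' s) (hK.nonneg _)).trans hs'
  have hT' : s' < P.T := by
    by_contra! hle
    obtain ⟨t, ht, hlt⟩ := hbig 0
    exact absurd (hsmall 0 P.T le_rfl hle t ht) (not_le.2 ((le_max_right _ _).trans_lt hlt))
  refine ⟨hT', ?_⟩
  have hs'mem : s' ∈ Icc s s' := right_mem_Icc.2 hss'.le
  obtain ⟨x', -, φ, hφ, hlim⟩ := (isCompact_closedBall (0 : EuclideanSpace ℝ (Fin n))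
    (‖y s‖ + 1)).tendsto_subseq (x := fun j => Y j s')
    (fun j => by simpa using hsmall j s' hT'.le le_rfl s' hs'mem)
  have hun' : P.IsUnboundedFrom x' s' := by
    refine isUnboundedFrom_of_tendsto hP hT (u := fun j => u (φ j)) (y := fun j => Y (φ j))
      ⟨hs₀.trans (hs.trans hss'.le), hT'⟩ (fun j => hu _)
      (fun j => (hY _).mono (hg _) hss'.le le_rfl) (fun M => ?_) hlim
    filter_upwards [(tendsto_natCast_atTop_atTop (R := ℝ)).comp hφ.tendsto_atTop
      |>.eventually_ge_atTop M] with j hj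
    obtain ⟨t, ht, hlt⟩ := hbig (φ j)
    refine ⟨t, ⟨?_, ht.2⟩, hj.trans_lt ((le_max_left _ _).trans_lt hlt)⟩
    by_contra! htlt
    exact absurd (hsmall (φ j) s' hT'.le le_rfl t ⟨ht.1, htlt.le⟩)
      (not_le.2 ((le_max_right _ _).trans_lt hlt))
  obtain ⟨C, hC⟩ := isCompact_Icc.exists_bound_of_continuousOn hy.1
  set R := max C (‖y s‖ + 1) with hR
  have hlim0 : Tendsto (fun j => ‖x' - Y (φ j) s'‖ *
      Real.exp (2 * K (R + 1) * (s' - s₀))) atTop (𝓝 0) := by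
    have := ((tendsto_iff_norm_sub_tendsto_zero.1 hlim).mul_const
      (Real.exp (2 * K (R + 1) * (s' - s₀))))
    simpa [norm_sub_rev] using this
  obtain ⟨i, hi⟩ := (hlim0.eventually (ge_mem_nhds (lt_min one_pos hr))).exists
  set j := φ i
  let v : ℝ → EuclideanSpace ℝ (Fin m) := fun t => if t ≤ s then w t else u j t
  have hv : P.IsControl v := hw.ite (hu j) _ measurableSet_Iic
  have hgv := hK.isCaratheodoryField hP hv
  have hglue := IsODESolution.glue hgv hs hss'.le
    (hy.congr_field (h := P.field v) fun t ht x => field_congr (by simp [v, ht.2]) x)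
    (((hY j).mono (hg j) le_rfl hT'.le).congr_field (h := P.field v)
      fun t ht x => field_congr (by simp [v, ht.1]) x) (hYs j).symm
  set z : ℝ → EuclideanSpace ℝ (Fin n) := fun t => if t ≤ s then y t else Y j t with hz
  have hzR : ∀ t ∈ Icc s₀ s', ‖z t‖ ≤ R := by
    intro t ht
    rcases le_or_gt t s with h | h
    · simpa only [hz, if_pos h] using (hC t ⟨ht.1, h⟩).trans (le_max_left _ _)
    · simpa only [hz, if_neg (not_le.2 h)] using
        (hsmall j s' hT'.le le_rfl t ⟨h.le, ht.2⟩).trans (le_max_right _ _)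
  have hzs' : z s' = Y j s' := if_neg (not_le.2 hss')
  have hzs₀ : z s₀ = y s₀ := if_pos hs
  rw [← hzs'] at hi
  -- Solve backward from the exact value `x'` at time `s'`; the resulting shift at `s₀` is at most
  -- `r` by the choice of `i`.
  obtain ⟨y', hy', hy's', hnear⟩ := hglue.exists_near hgv hzR
    (right_mem_Icc.2 (hs.trans hss'.le)) (hi.trans (min_le_left _ _))
  refine ⟨v, y', hv, fun t ht => if_pos ht, hy', ?_, by rwa [hy's']⟩
  rw [dist_eq_norm, ← hzs₀]
  exact (hnear s₀ (left_mem_Icc.2 (hs.trans hss'.le))).trans (hi.trans (min_le_right _ _))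

/-- A stage of the construction of a control with a trajectory that blows up: every trajectory
which starts within `rad` of `start` and uses a control extending `ctrl` passes at time `time`
within distance `1` of `pt`, from where trajectories are unbounded. -/
structure EscapeStage (P : ControlProblem n m) (s₀ : ℝ) where
  start : EuclideanSpace ℝ (Fin n)
  rad : ℝ
  time : ℝ
  ctrl : ℝ → EuclideanSpace ℝ (Fin m)
  pt : EuclideanSpace ℝ (Fin n)
  rad_pos : 0 < rad
  le_time : s₀ ≤ time
  time_lt : time < P.T
  isControl : P.IsControl ctrl
  unbounded : P.IsUnboundedFrom pt time
  sol : ∃ y, IsODESolution (P.field ctrl) s₀ time y ∧ y s₀ = start ∧ y time = pt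
  near : ∀ w Y, P.IsControl w → EqOn w ctrl (Iic time) → IsODESolution (P.field w) s₀ time Y →
    Y s₀ ∈ Metric.closedBall start rad → ‖Y time - pt‖ ≤ 1

/-- The radius is the inverse of the Grönwall factor on `[s₀, s]`, capped by `r₀`. Only the values
of a control up to time `s` matter, so one radius serves all its extensions. -/
theorem exists_escapeStage (hP : P.IsRegular) {s₀ s r₀ : ℝ} (hs : s₀ ≤ s) (hsT : s < P.T)
    (hr₀ : 0 < r₀) {w : ℝ → EuclideanSpace ℝ (Fin m)} {y : ℝ → EuclideanSpace ℝ (Fin n)}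
    (hw : P.IsControl w) (hy : IsODESolution (P.field w) s₀ s y)
    (hun : P.IsUnboundedFrom (y s) s) :
    ∃ S : P.EscapeStage s₀, S.start = y s₀ ∧ S.rad ≤ r₀ ∧ S.time = s ∧ S.ctrl = w ∧
      S.pt = y s := by
  obtain ⟨K, hK⟩ := hP.exists_isBound
  have hg := hK.isCaratheodoryField hP hw
  obtain ⟨R, hR⟩ := isCompact_Icc.exists_bound_of_continuousOn hy.1
  have he := Real.exp_pos (2 * K (R + 1) * (s - s₀))
  have hmem : s₀ ∈ Icc s₀ s := left_mem_Icc.2 hs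
  refine ⟨⟨y s₀, min r₀ (1 / Real.exp (2 * K (R + 1) * (s - s₀))), s, w, y s,
    lt_min hr₀ (by positivity), hs, hsT, hw, hun, ⟨y, hy, rfl, rfl⟩, ?_⟩, rfl, min_le_left _ _,
    rfl, rfl, rfl⟩
  intro v Y hv hvw hY hY₀
  have hY' : IsODESolution (P.field w) s₀ s Y :=
    hY.congr_field fun t ht x => field_congr (hvw ht.2) x
  rw [mem_closedBall_iff_norm] at hY₀
  have h1 : ‖Y s₀ - y s₀‖ * Real.exp (2 * K (R + 1) * (s - s₀)) ≤ 1 :=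
    (le_div_iff₀ he).1 (hY₀.trans (min_le_right _ _))
  obtain ⟨z, hz, hz₀, hzy⟩ := hy.exists_near hg hR hmem h1
  rw [hY'.eqOn hg hz hmem hz₀.symm (right_mem_Icc.2 hs)]
  exact (hzy s (right_mem_Icc.2 hs)).trans h1

theorem EscapeStage.exists_next (hP : P.IsRegular) (hT : P.HasTrajectories)
    {K : ℝ → ℝ} (hK : P.IsBound K) {s₀ : ℝ} (hs₀ : P.t₀ ≤ s₀) (S : P.EscapeStage s₀) :
    ∃ S' : P.EscapeStage s₀, Metric.closedBall S'.start S'.rad ⊆ Metric.closedBall S.start S.rad ∧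
      EqOn S'.ctrl S.ctrl (Iic S.time) ∧ S'.time = S.time + 1 / (K (‖S.pt‖ + 1) + 1) := by
  obtain ⟨y, hy, hy₀, hys⟩ := S.sol
  have hr := S.rad_pos
  have hK0 := hK.nonneg (‖S.pt‖ + 1)
  -- The displacement of the start and the new radius are each at most half the old radius, so the
  -- balls are nested. The `+ 1` in the denominator of the time step keeps it well defined when `K`
  -- vanishes.
  obtain ⟨hlt, w', y', hw', heq, hy', hd, hun'⟩ := IsUnboundedFrom.exists_extension
    (s' := S.time + 1 / (K (‖S.pt‖ + 1) + 1)) (r := S.rad / 2) hP hT hK hs₀ S.le_time S.isControl hy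
    (hys ▸ S.unbounded) (by linarith [show 0 < 1 / (K (‖S.pt‖ + 1) + 1) by positivity])
    (by
      rw [hys, add_sub_cancel_left, mul_one_div, div_le_one (by positivity)]
      linarith) (by positivity)
  obtain ⟨S', h1, h2, h3, h4, h5⟩ := exists_escapeStage (r₀ := S.rad / 2) hP
    (S.le_time.trans (by linarith [show 0 < 1 / (K (‖S.pt‖ + 1) + 1) by positivity])) hlt
    (by positivity) hw' hy' hun'
  refine ⟨S', ?_, h4 ▸ heq, h3⟩
  refine Metric.closedBall_subset_closedBall' ?_
  rw [h1, ← hy₀]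
  linarith

/-- Iterating the stages yields one control and one starting point serving all of them. Its globally
existing trajectory is bounded and bounds all the stage points, so the times advance by a fixed
minimum yet stay below `T`. -/
theorem not_isUnboundedFrom (hP : P.IsRegular) (hT : P.HasTrajectories) {s₀ : ℝ}
    (hs₀ : s₀ ∈ Ico P.t₀ P.T) (x₀ : EuclideanSpace ℝ (Fin n)) : ¬ P.IsUnboundedFrom x₀ s₀ := by
  classical
  intro hun
  obtain ⟨K, hK⟩ := hP.exists_isBound
  obtain ⟨u₀, -, hu₀, -⟩ := hun 0
  obtain ⟨y₀, hy₀, hy₀s⟩ := hT.exists_solution hP hu₀ hs₀ x₀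
  obtain ⟨S₀, -⟩ := exists_escapeStage (y := y₀) hP le_rfl hs₀.2 one_pos hu₀
    (hy₀.mono (hK.isCaratheodoryField hP hu₀) le_rfl hs₀.2.le) (hy₀s ▸ hun)
  choose next hball hctrl htime using
    fun S : P.EscapeStage s₀ => S.exists_next hP hT hK hs₀.1
  let S : ℕ → P.EscapeStage s₀ := fun i => next^[i] S₀
  have hS : ∀ i, S (i + 1) = next (S i) := fun i => Function.iterate_succ_apply' _ _ _
  have hstep : ∀ i, (S (i + 1)).time = (S i).time + 1 / (K (‖(S i).pt‖ + 1) + 1) := fun i => by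
    rw [hS, htime]
  have hmono : Monotone fun i => (S i).time := monotone_nat_of_le_succ fun i => by
    rw [hstep]
    have := hK.nonneg (‖(S i).pt‖ + 1)
    linarith [show 0 < 1 / (K (‖(S i).pt‖ + 1) + 1) by positivity]
  have hagree : ∀ i j, i ≤ j → EqOn (S j).ctrl (S i).ctrl (Iic (S i).time) := by
    intro i j hij
    induction j, hij using Nat.le_induction with
    | base => exact fun _ _ => rfl
    | succ j hij ih =>
      intro t ht
      rw [← ih ht, hS]
      exact hctrl (S j) (le_trans ht (hmono hij))
  -- The initial point has moved at every stage; a common point of the nested balls is close enough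
  -- to all the starts.
  obtain ⟨z, hz⟩ := IsCompact.nonempty_iInter_of_sequence_nonempty_isCompact_isClosed
    (fun i => Metric.closedBall (S i).start (S i).rad)
    (fun i => by rw [hS]; exact hball (S i))
    (fun i => ⟨(S i).start, Metric.mem_closedBall_self (S i).rad_pos.le⟩)
    (isCompact_closedBall _ _) (fun i => Metric.isClosed_closedBall)
  rw [mem_iInter] at hz
  let w : ℝ → EuclideanSpace ℝ (Fin m) := fun t =>
    if h : ∃ i, t ≤ (S i).time then (S (Nat.find h)).ctrl t else u₀ t
  have hwS : ∀ i, EqOn w (S i).ctrl (Iic (S i).time) := by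
    intro i t ht
    have h : ∃ i, t ≤ (S i).time := ⟨i, ht⟩
    simp only [w, dif_pos h]
    exact (hagree _ _ (Nat.find_min' h ht) (Nat.find_spec h)).symm
  have hw : P.IsControl w := by
    refine ⟨fun t => ?_, ?_⟩
    · by_cases h : ∃ i, t ≤ (S i).time
      · simp only [w, dif_pos h]; exact (S _).isControl.1 t
      · simp only [w, dif_neg h]; exact hu₀.1 t
    -- At each `t` the stagewise controls are eventually constant in `i`, so `w` is their pointwise
    -- limit.
    · refine aemeasurable_of_tendsto_metrizable_ae atTop
        (f := fun i t => if t ≤ (S i).time then (S i).ctrl t else u₀ t)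
        (fun i => aemeasurable_ite measurableSet_Iic (S i).isControl.2 hu₀.2)
        (ae_of_all _ fun t => ?_)
      refine tendsto_const_nhds.congr' ?_
      by_cases h : ∃ i, t ≤ (S i).time
      · obtain ⟨i, hi⟩ := h
        filter_upwards [eventually_ge_atTop i] with j hj
        have := hi.trans (hmono hj)
        simp only [if_pos this]
        exact hwS j this
      · refine Eventually.of_forall fun j => ?_
        simp only [w, dif_neg h, if_neg (fun hj => h ⟨j, hj⟩)]
  have hg := hK.isCaratheodoryField hP hw
  obtain ⟨y, hy, hys⟩ := hT.exists_solution hP hw hs₀ z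
  obtain ⟨M, hM⟩ := isCompact_Icc.exists_bound_of_continuousOn hy.1
  have hpt : ∀ i, ‖(S i).pt‖ ≤ M + 1 := by
    intro i
    have h1 := (S i).near w y hw (hwS i) (hy.mono hg le_rfl (S i).time_lt.le) (hys ▸ hz i)
    have h2 := hM (S i).time ⟨(S i).le_time, (S i).time_lt.le⟩
    calc ‖(S i).pt‖ = ‖y (S i).time - (y (S i).time - (S i).pt)‖ := by simp
      _ ≤ ‖y (S i).time‖ + ‖y (S i).time - (S i).pt‖ := norm_sub_le _ _
      _ ≤ M + 1 := add_le_add h2 h1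
  have hK0 := hK.nonneg (M + 1 + 1)
  have hlow : ∀ i : ℕ, s₀ + i * (1 / (K (M + 1 + 1) + 1)) ≤ (S i).time := by
    intro i
    induction i with
    | zero => simpa using (S 0).le_time
    | succ i ih =>
      rw [hstep]
      have h3 := hK.nonneg (‖(S i).pt‖ + 1)
      have : 1 / (K (M + 1 + 1) + 1) ≤ 1 / (K (‖(S i).pt‖ + 1) + 1) :=
        one_div_le_one_div_of_le (by positivity)
          (add_le_add_left (hK.mono (add_le_add_left (hpt i) 1)) 1)
      push_cast
      linarith
  obtain ⟨i, hi⟩ := exists_nat_gt ((P.T - s₀) / (1 / (K (M + 1 + 1) + 1)))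
  rw [div_lt_iff₀ (by positivity)] at hi
  linarith [hlow i, (S i).time_lt]

/-- All trajectories with a given initial datum remain in a common ball. -/
theorem exists_trajectory_bound (hP : P.IsRegular) (hT : P.HasTrajectories) {τ : ℝ}
    (hτ : τ ∈ Ico P.t₀ P.T) (x₀ : EuclideanSpace ℝ (Fin n)) :
    ∃ M, ∀ u y, P.IsControl u → IsODESolution (P.field u) τ P.T y → y τ = x₀ →
      ∀ t ∈ Icc τ P.T, ‖y t‖ ≤ M := by
  have := not_isUnboundedFrom hP hT hτ x₀
  unfold IsUnboundedFrom at this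
  push Not at this
  exact this

end ControlProblem

/-! ### Integrated Leibniz rule for absolutely continuous curves. -/

section ProductRule

theorem intervalIntegral_deriv_mul_eq_sub {a b : ℝ} (hab : a ≤ b) {φ ψ q r : ℝ → ℝ}
    (hq : IntervalIntegrable q volume a b) (hr : IntervalIntegrable r volume a b)
    (hφ : ∀ t ∈ Icc a b, φ t = φ a + ∫ s in a..t, q s)
    (hψ : ∀ t ∈ Icc a b, ψ t = ψ a + ∫ s in a..t, r s) :
    ∫ s in a..b, (q s * ψ s + φ s * r s) = φ b * ψ b - φ a * ψ a := by
  have hac : ∀ {q : ℝ → ℝ} (c : ℝ), IntervalIntegrable q volume a b →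
      AbsolutelyContinuousOnInterval (fun t => c + ∫ s in a..t, q s) a b := fun c hq =>
    ((LipschitzWith.const c).lipschitzOnWith.absolutelyContinuousOnInterval).add
      (hq.absolutelyContinuousOnInterval_intervalIntegral left_mem_uIcc)
  have key := (hac (φ a) hq).integral_deriv_mul_eq_sub (hac (ψ a) hr)
  have ha : a ∈ Icc a b := left_mem_Icc.2 hab
  have hb : b ∈ Icc a b := right_mem_Icc.2 hab
  rw [← hφ b hb, ← hψ b hb, ← hφ a ha, ← hψ a ha] at key
  rw [← key]
  refine intervalIntegral.integral_congr_ae ?_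
  filter_upwards [hq.ae_hasDerivAt_integral, hr.ae_hasDerivAt_integral] with t h1 h2 ht
  have ht' := uIoc_subset_uIcc ht
  have ht'' : t ∈ Icc a b := by rwa [uIcc_of_le hab] at ht'
  rw [((h1 ht' a left_mem_uIcc).const_add (φ a)).deriv,
    ((h2 ht' a left_mem_uIcc).const_add (ψ a)).deriv, ← hφ t ht'', ← hψ t ht'']

variable {k : ℕ}

theorem IntervalIntegrable.euclidean_apply {q : ℝ → EuclideanSpace ℝ (Fin k)} {a b : ℝ}
    (hq : IntervalIntegrable q volume a b) (i : Fin k) :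
    IntervalIntegrable (fun t => q t i) volume a b := by
  rw [intervalIntegrable_iff] at hq ⊢
  exact (EuclideanSpace.proj (𝕜 := ℝ) i).integrable_comp hq

theorem intervalIntegral_euclidean_apply {q : ℝ → EuclideanSpace ℝ (Fin k)} {a b : ℝ}
    (hq : IntervalIntegrable q volume a b) (i : Fin k) :
    (∫ t in a..b, q t) i = ∫ t in a..b, q t i :=
  ((EuclideanSpace.proj (𝕜 := ℝ) i).intervalIntegral_comp_comm hq).symm

theorem IntervalIntegrable.inner_continuousOn {q p : ℝ → EuclideanSpace ℝ (Fin k)} {a b : ℝ}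
    (hq : IntervalIntegrable q volume a b) (hp : ContinuousOn p (uIcc a b)) :
    IntervalIntegrable (fun t => inner ℝ (p t) (q t)) volume a b := by
  simp only [PiLp.inner_apply]
  have : IntervalIntegrable (∑ i, fun t => inner ℝ (p t i) (q t i)) volume a b := by
    refine IntervalIntegrable.sum _ fun i _ => ?_
    have hpi : ContinuousOn (fun t => p t i) (uIcc a b) :=
      (EuclideanSpace.proj (𝕜 := ℝ) i).continuous.comp_continuousOn hp
    exact ((hq.euclidean_apply i).mul_continuousOn hpi).congr fun t _ => by simp
  exact this.congr fun t _ => by simp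

/-- Leibniz rule, in integrated form, for the inner product of two absolutely continuous curves. -/
theorem intervalIntegral_inner_deriv_eq_sub {a b : ℝ} (hab : a ≤ b)
    {p x q r : ℝ → EuclideanSpace ℝ (Fin k)}
    (hq : IntervalIntegrable q volume a b) (hr : IntervalIntegrable r volume a b)
    (hpc : ContinuousOn p (Icc a b)) (hxc : ContinuousOn x (Icc a b))
    (hp : ∀ t ∈ Icc a b, p t = p a + ∫ s in a..t, q s)
    (hx : ∀ t ∈ Icc a b, x t = x a + ∫ s in a..t, r s) :
    ∫ s in a..b, (inner ℝ (q s) (x s) + inner ℝ (p s) (r s))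
      = inner ℝ (p b) (x b) - inner ℝ (p a) (x a) := by
  have hsub : ∀ t ∈ Icc a b, uIcc a t ⊆ uIcc a b := fun t ht => by
    rw [uIcc_of_le ht.1, uIcc_of_le hab]; exact Icc_subset_Icc_right ht.2
  have hpi : ∀ (i : Fin k), ∀ t ∈ Icc a b, p t i = p a i + ∫ s in a..t, q s i := fun i t ht => by
    rw [← intervalIntegral_euclidean_apply (hq.mono_set (hsub t ht)), ← PiLp.add_apply, ← hp t ht]
  have hxi : ∀ (i : Fin k), ∀ t ∈ Icc a b, x t i = x a i + ∫ s in a..t, r s i := fun i t ht => by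
    rw [← intervalIntegral_euclidean_apply (hr.mono_set (hsub t ht)), ← PiLp.add_apply, ← hx t ht]
  have hci : ∀ {y : ℝ → EuclideanSpace ℝ (Fin k)} (i : Fin k), ContinuousOn y (Icc a b) →
      ContinuousOn (fun t => y t i) (uIcc a b) := fun i hy => by
    rw [uIcc_of_le hab]
    exact (EuclideanSpace.proj (𝕜 := ℝ) i).continuous.comp_continuousOn hy
  have e : ∀ s, inner ℝ (q s) (x s) + inner ℝ (p s) (r s)
      = ∑ i, (q s i * x s i + p s i * r s i) := fun s => by
    simp only [PiLp.inner_apply, Finset.sum_add_distrib]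
    congr 1 <;> exact Finset.sum_congr rfl fun i _ => by simp [mul_comm]
  simp_rw [e]
  rw [intervalIntegral.integral_finsetSum fun i _ =>
    ((hq.euclidean_apply i).mul_continuousOn (hci i hxc)).add
      ((hr.euclidean_apply i).continuousOn_mul (hci i hpc))]
  rw [Finset.sum_congr rfl fun i _ => intervalIntegral_deriv_mul_eq_sub hab
    (hq.euclidean_apply i) (hr.euclidean_apply i) (hpi i) (hxi i), Finset.sum_sub_distrib]
  simp only [PiLp.inner_apply]
  congr 1 <;> exact Finset.sum_congr rfl fun i _ => by simp [mul_comm]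

end ProductRule

/-! ### Calculus of the control Hamiltonian. -/

namespace ControlProblem

variable {n m : ℕ} {P : ControlProblem n m}

theorem controlHamiltonian_eq (x p : EuclideanSpace ℝ (Fin n)) (u : EuclideanSpace ℝ (Fin m))
    (t : ℝ) : P.controlHamiltonian x p u t = inner ℝ p (P.f x u t) - P.F x u t := by
  simp only [controlHamiltonian, PiLp.inner_apply]
  congr 1
  exact Finset.sum_congr rfl fun i _ => by simp [mul_comm]

theorem hasGradientAt_controlHamiltonian_adjoint (x p : EuclideanSpace ℝ (Fin n))
    (u : EuclideanSpace ℝ (Fin m)) (t : ℝ) :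
    HasGradientAt (fun q => P.controlHamiltonian x q u t) (P.f x u t) p := by
  simp only [controlHamiltonian_eq]
  rw [hasGradientAt_iff_hasFDerivAt]
  have h := ((InnerProductSpace.toDual ℝ (EuclideanSpace ℝ (Fin n))
    (P.f x u t)).hasFDerivAt (x := p)).sub_const (P.F x u t)
  refine h.congr_of_eventuallyEq (Eventually.of_forall fun q => ?_)
  simp [real_inner_comm]

/-- The gradient in the state of the control Hamiltonian. -/
noncomputable def stateGradient (P : ControlProblem n m) (x p : EuclideanSpace ℝ (Fin n))
    (u : EuclideanSpace ℝ (Fin m)) (t : ℝ) : EuclideanSpace ℝ (Fin n) :=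
  ContinuousLinearMap.adjoint (fderiv ℝ (fun y => P.f y u t) x) p -
    (InnerProductSpace.toDual ℝ _).symm (fderiv ℝ (fun y => P.F y u t) x)

theorem IsRegular.hasGradientAt_controlHamiltonian (hP : P.IsRegular)
    (x p : EuclideanSpace ℝ (Fin n)) {u : EuclideanSpace ℝ (Fin m)} (hu : u ∈ P.U) {t : ℝ}
    (ht : t ∈ Icc P.t₀ P.T) :
    HasGradientAt (fun y => P.controlHamiltonian y p u t) (P.stateGradient x p u t) x := by
  simp only [controlHamiltonian_eq]
  rw [hasGradientAt_iff_hasFDerivAt]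
  have h1 := (InnerProductSpace.toDual ℝ (EuclideanSpace ℝ (Fin n)) p).hasFDerivAt.comp x
    (hP.diff x u hu t ht).1.hasFDerivAt
  have h2 := h1.sub (hP.diff x u hu t ht).2.hasFDerivAt
  have e : InnerProductSpace.toDual ℝ (EuclideanSpace ℝ (Fin n)) (P.stateGradient x p u t) =
      ((InnerProductSpace.toDual ℝ (EuclideanSpace ℝ (Fin n)) p).comp
        (fderiv ℝ (fun y => P.f y u t) x)) - fderiv ℝ (fun y => P.F y u t) x := by
    ext h
    simp [stateGradient, ContinuousLinearMap.adjoint_inner_left]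
  rw [e]
  exact h2.congr_of_eventuallyEq (Eventually.of_forall fun q => by simp)

theorem IsBound.norm_stateGradient_le {K : ℝ → ℝ} (hK : P.IsBound K) {R : ℝ}
    {x : EuclideanSpace ℝ (Fin n)} (hx : ‖x‖ ≤ R) (p : EuclideanSpace ℝ (Fin n))
    {u : EuclideanSpace ℝ (Fin m)} (hu : u ∈ P.U) {t : ℝ} (ht : t ∈ Icc P.t₀ P.T) :
    ‖P.stateGradient x p u t‖ ≤ K R * (‖p‖ + 1) := by
  have h1 := hK.fderiv_f_le R x hx u hu t ht
  have h2 := hK.fderiv_F_le R x hx u hu t ht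
  calc ‖P.stateGradient x p u t‖ ≤ K R * ‖p‖ + K R := by
        refine (norm_sub_le _ _).trans (add_le_add ?_ ?_)
        · refine (ContinuousLinearMap.le_opNorm _ _).trans ?_
          rw [LinearIsometryEquiv.norm_map]
          gcongr
        · rwa [LinearIsometryEquiv.norm_map]
    _ = K R * (‖p‖ + 1) := by ring

/-- The gradient is affine in the adjoint variable, which gives the adjoint equation a Lipschitz
constant independent of the size of `p`. -/
theorem stateGradient_sub_adjoint (x p q : EuclideanSpace ℝ (Fin n))
    (u : EuclideanSpace ℝ (Fin m)) (t : ℝ) :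
    P.stateGradient x p u t - P.stateGradient x q u t =
      ContinuousLinearMap.adjoint (fderiv ℝ (fun y => P.f y u t) x) (p - q) := by
  simp [stateGradient]

theorem IsRegular.continuousOn_stateGradient (hP : P.IsRegular) :
    ContinuousOn (fun z : EuclideanSpace ℝ (Fin n) ×
      (EuclideanSpace ℝ (Fin n) × EuclideanSpace ℝ (Fin m) × ℝ) =>
        P.stateGradient z.2.1 z.1 z.2.2.1 z.2.2.2) (univ ×ˢ P.domain) := by
  unfold stateGradient
  have hsnd : MapsTo (Prod.snd : EuclideanSpace ℝ (Fin n) × (EuclideanSpace ℝ (Fin n) ×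
      EuclideanSpace ℝ (Fin m) × ℝ) → _) (univ ×ˢ P.domain) P.domain := fun z hz => hz.2
  have h1 := hP.fderiv_f_cont.comp continuousOn_snd hsnd
  have h2 := hP.fderiv_F_cont.comp continuousOn_snd hsnd
  refine ContinuousOn.sub (ContinuousOn.clm_apply ?_ continuousOn_fst) ?_
  · exact (LinearIsometryEquiv.continuous _).comp_continuousOn h1
  · exact (LinearIsometryEquiv.continuous _).comp_continuousOn h2

theorem IsRegular.continuousOn_controlHamiltonian (hP : P.IsRegular) :
    ContinuousOn (fun z : EuclideanSpace ℝ (Fin n) ×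
      (EuclideanSpace ℝ (Fin n) × EuclideanSpace ℝ (Fin m) × ℝ) =>
        P.controlHamiltonian z.2.1 z.1 z.2.2.1 z.2.2.2) (univ ×ˢ P.domain) := by
  simp only [controlHamiltonian_eq]
  have hsnd : MapsTo (Prod.snd : EuclideanSpace ℝ (Fin n) × (EuclideanSpace ℝ (Fin n) ×
      EuclideanSpace ℝ (Fin m) × ℝ) → _) (univ ×ˢ P.domain) P.domain := fun z hz => hz.2
  exact (continuousOn_fst.inner (hP.f_cont.comp continuousOn_snd hsnd)).sub
    (hP.F_cont.comp continuousOn_snd hsnd)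

/-- Uniform continuity on a compact set. It provides a linearization error uniform over curves and
controls, as the needle estimate requires. -/
theorem IsRegular.exists_stateGradient_sub_le (hP : P.IsRegular) (M C : ℝ) {η : ℝ} (hη : 0 < η) :
    ∃ δ > 0, ∀ x z p : EuclideanSpace ℝ (Fin n), ‖x‖ ≤ M → ‖z‖ ≤ M → ‖p‖ ≤ C → ‖x - z‖ ≤ δ →
      ∀ u ∈ P.U, ∀ t ∈ Icc P.t₀ P.T,
        ‖P.stateGradient x p u t - P.stateGradient z p u t‖ ≤ η := by
  have hc : IsCompact (Metric.closedBall (0 : EuclideanSpace ℝ (Fin n)) C ×ˢ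
      Metric.closedBall (0 : EuclideanSpace ℝ (Fin n)) M ×ˢ P.U ×ˢ Icc P.t₀ P.T) :=
    (isCompact_closedBall _ _).prod
      ((isCompact_closedBall _ _).prod (hP.compact.prod isCompact_Icc))
  have huc := hc.uniformContinuousOn_of_continuous (hP.continuousOn_stateGradient.mono
    (prod_mono (subset_univ _) (prod_mono (subset_univ _) le_rfl)))
  rw [Metric.uniformContinuousOn_iff_le] at huc
  obtain ⟨δ, hδ, h⟩ := huc η hη
  refine ⟨δ, hδ, fun x z p hx hz hp hxz u hu t ht => ?_⟩
  have := h (p, x, u, t) ⟨by simpa using hp, by simpa using hx, hu, ht⟩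
    (p, z, u, t) ⟨by simpa using hp, by simpa using hz, hu, ht⟩
    (by simpa [Prod.dist_eq, dist_eq_norm, hδ.le] using hxz)
  simpa [dist_eq_norm] using this

theorem IsBound.controlHamiltonian_lip {K : ℝ → ℝ} (hK : P.IsBound K) (hP : P.IsRegular) {R : ℝ}
    {x y : EuclideanSpace ℝ (Fin n)} (hx : ‖x‖ ≤ R) (hy : ‖y‖ ≤ R)
    (p : EuclideanSpace ℝ (Fin n)) {u : EuclideanSpace ℝ (Fin m)} (hu : u ∈ P.U) {t : ℝ}
    (ht : t ∈ Icc P.t₀ P.T) :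
    |P.controlHamiltonian y p u t - P.controlHamiltonian x p u t|
      ≤ K R * (‖p‖ + 1) * ‖y - x‖ := by
  have h1 := hK.f_lip hP hy hx hu ht
  have h2 := hK.F_lip hP hy hx hu ht
  rw [controlHamiltonian_eq, controlHamiltonian_eq, sub_sub_sub_comm, ← inner_sub_right]
  calc _ ≤ |inner ℝ p (P.f y u t - P.f x u t)| + |P.F y u t - P.F x u t| := abs_sub _ _
    _ ≤ ‖p‖ * (K R * ‖y - x‖) + K R * ‖y - x‖ := by
      refine add_le_add ((abs_real_inner_le_norm _ _).trans ?_) h2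
      gcongr
    _ = K R * (‖p‖ + 1) * ‖y - x‖ := by ring

/-- First-order expansion of the control Hamiltonian along a short segment. -/
theorem IsRegular.controlHamiltonian_taylor (hP : P.IsRegular) {x y p : EuclideanSpace ℝ (Fin n)}
    {u : EuclideanSpace ℝ (Fin m)} (hu : u ∈ P.U) {t : ℝ} (ht : t ∈ Icc P.t₀ P.T) {η : ℝ}
    (h : ∀ z ∈ segment ℝ x y, ‖P.stateGradient z p u t - P.stateGradient x p u t‖ ≤ η) :
    |P.controlHamiltonian y p u t - P.controlHamiltonian x p u t
      - inner ℝ (P.stateGradient x p u t) (y - x)| ≤ η * ‖y - x‖ := by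
  have hd : ∀ z, HasFDerivAt (fun y => P.controlHamiltonian y p u t)
      (InnerProductSpace.toDual ℝ _ (P.stateGradient z p u t)) z := fun z =>
    hasGradientAt_iff_hasFDerivAt.1 (hP.hasGradientAt_controlHamiltonian z p hu ht)
  have := (convex_segment (𝕜 := ℝ) x y).norm_image_sub_le_of_norm_hasFDerivWithin_le'
    (f := fun y => P.controlHamiltonian y p u t)
    (φ := InnerProductSpace.toDual ℝ _ (P.stateGradient x p u t)) (C := η)
    (fun z _ => (hd z).hasFDerivWithinAt)
    (fun z hz => by rw [← map_sub, LinearIsometryEquiv.norm_map]; exact h z hz)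
    (left_mem_segment ℝ x y) (right_mem_segment ℝ x y)
  simpa using this

end ControlProblem

/-! ### Adjoint curves and needle variations. -/

theorem IsODESolution.exists_continuous_extension {E : Type*} [NormedAddCommGroup E]
    [NormedSpace ℝ E] {g : ℝ → E → E} {a b M : ℝ} {y : ℝ → E} (hab : a ≤ b)
    (hy : IsODESolution g a b y) (hM : ∀ t ∈ Icc a b, ‖y t‖ ≤ M) :
    ∃ z, Continuous z ∧ EqOn z y (Icc a b) ∧ IsODESolution g a b z ∧ ∀ t, ‖z t‖ ≤ M := by
  have hz : EqOn (IccExtend hab fun s => y s) y (Icc a b) := fun t ht => by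
    simp [IccExtend_of_mem hab _ ht]
  refine ⟨IccExtend hab fun s => y s,
    Continuous.Icc_extend' (continuousOn_iff_continuous_domRestrict.1 hy.1), hz,
    ⟨hy.1.congr hz, fun t ht => ?_⟩, fun t => hM _ (projIcc a b hab t).2⟩
  rw [hz ht, hz (left_mem_Icc.2 hab), hy.2 t ht]
  congr 1
  refine intervalIntegral.integral_congr fun s hs => ?_
  rw [uIcc_of_le ht.1] at hs
  simp only [hz ⟨hs.1, hs.2.trans ht.2⟩]

namespace ControlProblem

variable {n m : ℕ} {P : ControlProblem n m}

/-- The vector field of the adjoint equation along a curve `x` and a control `u`. -/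
noncomputable def adjointField (P : ControlProblem n m) (x : ℝ → EuclideanSpace ℝ (Fin n))
    (u : ℝ → EuclideanSpace ℝ (Fin m)) (t : ℝ) (p : EuclideanSpace ℝ (Fin n)) :
    EuclideanSpace ℝ (Fin n) :=
  open Classical in if t ∈ Icc P.t₀ P.T then -P.stateGradient (x t) p (u t) t else 0

theorem adjointField_of_mem (x : ℝ → EuclideanSpace ℝ (Fin n))
    (u : ℝ → EuclideanSpace ℝ (Fin m)) {t : ℝ} (ht : t ∈ Icc P.t₀ P.T)
    (p : EuclideanSpace ℝ (Fin n)) :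
    P.adjointField x u t p = -P.stateGradient (x t) p (u t) t := if_pos ht

theorem IsBound.isCaratheodoryField_adjointField {K : ℝ → ℝ} (hK : P.IsBound K)
    (hP : P.IsRegular) {x : ℝ → EuclideanSpace ℝ (Fin n)} {M : ℝ} (hx : Continuous x)
    (hxM : ∀ t, ‖x t‖ ≤ M) {u : ℝ → EuclideanSpace ℝ (Fin m)} (hu : P.IsControl u) :
    IsCaratheodoryField (P.adjointField x u) (fun R => K M * (R + 1)) where
  meas y hy := by
    have h1 := (hP.aemeasurable_comp hP.fderiv_f_cont hx.aemeasurable hu).aestronglyMeasurable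
    have h2 := (hP.aemeasurable_comp hP.fderiv_F_cont hx.aemeasurable hu).aestronglyMeasurable
    have h3 := (LinearIsometryEquiv.continuous (ContinuousLinearMap.adjoint (𝕜 := ℝ)
      (E := EuclideanSpace ℝ (Fin n)) (F := EuclideanSpace ℝ (Fin n)))).comp_aestronglyMeasurable h1
    have h4 := (LinearIsometryEquiv.continuous (InnerProductSpace.toDual ℝ
      (EuclideanSpace ℝ (Fin n))).symm).comp_aestronglyMeasurable h2
    have h5 := isBoundedBilinearMap_apply.continuous.comp_aestronglyMeasurable
      (h3.prodMk hy.aestronglyMeasurable)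
    refine (h5.sub h4).neg.congr (ae_of_all _ fun t => ?_)
    by_cases ht : t ∈ Icc P.t₀ P.T
    · simp only [Pi.neg_apply, Pi.sub_apply, if_pos ht, adjointField, stateGradient]
    · simp only [Pi.neg_apply, Pi.sub_apply, if_neg ht, adjointField, map_zero]
      simp
  bound R t p hp := by
    have h0 := hK.nonneg M
    have hR := (norm_nonneg _).trans hp
    by_cases ht : t ∈ Icc P.t₀ P.T
    · rw [adjointField_of_mem x u ht, norm_neg]
      refine (hK.norm_stateGradient_le (hxM t) p (hu.1 t) ht).trans ?_
      gcongr
    · simp only [adjointField, if_neg ht, norm_zero]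
      positivity
  lip R t p q hp hq := by
    have h0 := hK.nonneg M
    have hR := (norm_nonneg _).trans hp
    by_cases ht : t ∈ Icc P.t₀ P.T
    · rw [adjointField_of_mem x u ht, adjointField_of_mem x u ht, neg_sub_neg, norm_sub_rev,
        stateGradient_sub_adjoint]
      refine (ContinuousLinearMap.le_opNorm _ _).trans ?_
      rw [LinearIsometryEquiv.norm_map]
      refine mul_le_mul_of_nonneg_right ?_ (norm_nonneg _)
      refine (hK.fderiv_f_le M _ (hxM t) _ (hu.1 t) t ht).trans ?_
      nlinarith
    · simp only [adjointField, if_neg ht, sub_zero, norm_zero]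
      positivity

/-- The adjoint equation has a solution which vanishes at the final time. -/
theorem IsBound.exists_adjoint {K : ℝ → ℝ} (hK : P.IsBound K) (hP : P.IsRegular)
    {x : ℝ → EuclideanSpace ℝ (Fin n)} {M : ℝ} (hx : Continuous x) (hxM : ∀ t, ‖x t‖ ≤ M)
    {u : ℝ → EuclideanSpace ℝ (Fin m)} (hu : P.IsControl u) {τ : ℝ} (hτ : τ ∈ Ico P.t₀ P.T) :
    ∃ p, Continuous p ∧ IsODESolution (P.adjointField x u) τ P.T p ∧ p P.T = 0 ∧
      ∀ t, ‖p t‖ ≤ Real.exp (K M * (P.T - τ)) := by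
  have hg := hK.isCaratheodoryField_adjointField hP hx hxM hu
  have hKM := hK.nonneg M
  have hTm : P.T ∈ Icc τ P.T := right_mem_Icc.2 hτ.2.le
  obtain ⟨p, hpc, hp⟩ := exists_solution_of_lipschitz (L := K M) (C := K M * (0 + 1)) hg.meas
    (fun t => hg.bound 0 t 0 (by simp)) (fun t p q => by
      by_cases ht : t ∈ Icc P.t₀ P.T
      · rw [adjointField_of_mem x u ht, adjointField_of_mem x u ht, neg_sub_neg, norm_sub_rev,
          stateGradient_sub_adjoint]
        refine (ContinuousLinearMap.le_opNorm _ _).trans ?_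
        rw [LinearIsometryEquiv.norm_map]
        exact mul_le_mul_of_nonneg_right (hK.fderiv_f_le M _ (hxM t) _ (hu.1 t) t ht)
          (norm_nonneg _)
      · simp only [adjointField, if_neg ht, sub_zero, norm_zero]
        positivity) hTm 0
  have hpT : p P.T = 0 := by simpa using hp P.T hTm
  have hsol : IsODESolution (P.adjointField x u) τ P.T p :=
    .of_sub_eq hg hpc.continuousOn hTm (by rwa [hpT])
  -- Adding 1 absorbs the inhomogeneous term coming from `F`, so that Grönwall applies in
  -- homogeneous form.
  have hbd : ∀ t ∈ Icc τ P.T, ‖p t‖ + 1 ≤ 1 * Real.exp (K M * |t - P.T|) := by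
    refine le_mul_exp_of_le_integral hKM (hpc.norm.add continuous_const).continuousOn hTm
      (fun t ht => ?_) fun t _ => by positivity
    rw [hp t ht, zero_add, add_comm]
    refine add_le_add le_rfl ?_
    have hcont : Continuous fun s => K M * (‖p s‖ + 1) := by fun_prop
    refine (intervalIntegral.norm_integral_le_abs_of_norm_le
      (ae_of_all _ fun s => hg.bound ‖p s‖ s (p s) le_rfl) (hcont.intervalIntegrable _ _)).trans ?_
    rw [intervalIntegral.integral_const_mul, abs_mul, abs_of_nonneg hKM]
  obtain ⟨q, hqc, hqp, hq, hqM⟩ := hsol.exists_continuous_extension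
    (M := Real.exp (K M * (P.T - τ))) hτ.2.le fun t ht => by
      have h1 := hbd t ht
      have : Real.exp (K M * |t - P.T|) ≤ Real.exp (K M * (P.T - τ)) := by
        have : |t - P.T| ≤ P.T - τ := by
          rw [abs_of_nonpos (sub_nonpos.2 ht.2)]; linarith [ht.1]
        gcongr
      linarith
  exact ⟨q, hqc, hq, (hqp hTm).trans hpT, hqM⟩

theorem IsRegular.intervalIntegrable_F (hP : P.IsRegular) {τ : ℝ} (hτ : τ ∈ Ico P.t₀ P.T)
    {y : ℝ → EuclideanSpace ℝ (Fin n)} (hy : Continuous y)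
    {u : ℝ → EuclideanSpace ℝ (Fin m)} (hu : P.IsControl u) {a b : ℝ} (ha : a ∈ Icc τ P.T)
    (hb : b ∈ Icc τ P.T) :
    IntervalIntegrable (fun t => P.F (y t) (u t) t) volume a b := by
  obtain ⟨K, hK⟩ := hP.exists_isBound
  obtain ⟨R, hR⟩ := isCompact_uIcc.exists_bound_of_continuousOn (f := y) (s := uIcc a b)
    hy.continuousOn
  have hmem : ∀ t ∈ uIcc a b, t ∈ Icc P.t₀ P.T := fun t ht =>
    ⟨hτ.1.trans (uIcc_subset_Icc ha hb ht).1, (uIcc_subset_Icc ha hb ht).2⟩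
  have hm := (hP.aemeasurable_comp hP.F_cont hy.aemeasurable hu).aestronglyMeasurable
  rw [intervalIntegrable_iff]
  have : IntegrableOn (fun t => if t ∈ Icc P.t₀ P.T then P.F (y t) (u t) t else 0) (uIoc a b) := by
    refine Measure.integrableOn_of_bounded (M := K R) measure_Ioc_lt_top.ne hm ?_
    refine (ae_restrict_mem measurableSet_uIoc).mono fun t ht => ?_
    have ht' := uIoc_subset_uIcc ht
    rw [if_pos (hmem t ht')]
    exact hK.F_le R _ (hR t ht') _ (hu.1 t) t (hmem t ht')
  exact this.congr_fun (fun t ht => if_pos (hmem t (uIoc_subset_uIcc ht))) measurableSet_uIoc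

theorem IsRegular.intervalIntegrable_f (hP : P.IsRegular) {τ : ℝ} (hτ : τ ∈ Ico P.t₀ P.T)
    {y : ℝ → EuclideanSpace ℝ (Fin n)} (hy : Continuous y)
    {u : ℝ → EuclideanSpace ℝ (Fin m)} (hu : P.IsControl u) {a b : ℝ} (ha : a ∈ Icc τ P.T)
    (hb : b ∈ Icc τ P.T) :
    IntervalIntegrable (fun t => P.f (y t) (u t) t) volume a b := by
  obtain ⟨K, hK⟩ := hP.exists_isBound
  refine ((hK.isCaratheodoryField hP hu).intervalIntegrable hy a b).congr fun t ht => ?_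
  have := uIcc_subset_Icc ha hb (uIoc_subset_uIcc ht)
  exact field_of_mem u ⟨hτ.1.trans this.1, this.2⟩ _

theorem IsRegular.intervalIntegrable_controlHamiltonian (hP : P.IsRegular) {τ : ℝ}
    (hτ : τ ∈ Ico P.t₀ P.T) {y p : ℝ → EuclideanSpace ℝ (Fin n)} (hy : Continuous y)
    (hp : Continuous p) {u : ℝ → EuclideanSpace ℝ (Fin m)} (hu : P.IsControl u) {a b : ℝ}
    (ha : a ∈ Icc τ P.T) (hb : b ∈ Icc τ P.T) :
    IntervalIntegrable (fun t => P.controlHamiltonian (y t) (p t) (u t) t) volume a b := by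
  simp only [controlHamiltonian_eq]
  exact ((hP.intervalIntegrable_f hτ hy hu ha hb).inner_continuousOn hp.continuousOn).sub
    (hP.intervalIntegrable_F hτ hy hu ha hb)

/-- The increment of the cost, expressed through the adjoint curve. -/
theorem IsRegular.cost_sub_cost (hP : P.IsRegular) {τ : ℝ} (hτ : τ ∈ Ico P.t₀ P.T)
    {u w : ℝ → EuclideanSpace ℝ (Fin m)} (hu : P.IsControl u) (hw : P.IsControl w)
    {x y p : ℝ → EuclideanSpace ℝ (Fin n)} {M : ℝ} (hx : Continuous x) (hxM : ∀ t, ‖x t‖ ≤ M)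
    (hy : Continuous y)
    (hp : Continuous p) (hxs : IsODESolution (P.field u) τ P.T x)
    (hys : IsODESolution (P.field w) τ P.T y) (hxy : y τ = x τ)
    (hps : IsODESolution (P.adjointField x u) τ P.T p) (hpT : p P.T = 0) :
    IntervalIntegrable (fun s => inner ℝ (P.stateGradient (x s) (p s) (u s) s) (y s - x s) -
        (P.controlHamiltonian (y s) (p s) (w s) s - P.controlHamiltonian (x s) (p s) (u s) s))
        volume τ P.T ∧
    P.cost τ w y - P.cost τ u x =
      ∫ s in τ..P.T, (inner ℝ (P.stateGradient (x s) (p s) (u s) s) (y s - x s) -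
        (P.controlHamiltonian (y s) (p s) (w s) s - P.controlHamiltonian (x s) (p s) (u s) s)) := by
  obtain ⟨K, hK⟩ := hP.exists_isBound
  have hga := hK.isCaratheodoryField_adjointField hP hx hxM hu
  have hT := hτ.2.le
  have h1 : τ ∈ Icc τ P.T := left_mem_Icc.2 hT
  have h2 : P.T ∈ Icc τ P.T := right_mem_Icc.2 hT
  have hu' := hK.isCaratheodoryField hP hu
  have hw' := hK.isCaratheodoryField hP hw
  have hmem : ∀ s ∈ uIcc τ P.T, s ∈ Icc P.t₀ P.T := fun s hs => by
    rw [uIcc_of_le hT] at hs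
    exact ⟨hτ.1.trans hs.1, hs.2⟩
  have ia := hga.intervalIntegrable hp τ P.T
  have ix := fun t => hu'.intervalIntegrable hx τ t
  have iy := fun t => hw'.intervalIntegrable hy τ t
  -- Both boundary terms vanish: `p` is zero at the final time and `y - x` at the initial time. This
  -- integral can therefore be added to the cost difference for free.
  have leib := intervalIntegral_inner_deriv_eq_sub (p := p) (x := fun t => y t - x t) hT ia
    ((iy P.T).sub (ix P.T)) hp.continuousOn (hy.sub hx).continuousOn hps.2 (fun t ht => by
      rw [intervalIntegral.integral_sub (iy t) (ix t), hys.2 t ht, hxs.2 t ht]; abel)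
  simp only [hpT, hxy, sub_self, inner_zero_left, inner_zero_right] at leib
  have iH1 := hP.intervalIntegrable_controlHamiltonian hτ hy hp hw h1 h2
  have iH2 := hP.intervalIntegrable_controlHamiltonian hτ hx hp hu h1 h2
  have iF1 := hP.intervalIntegrable_F hτ hy hw h1 h2
  have iF2 := hP.intervalIntegrable_F hτ hx hu h1 h2
  have ip : IntervalIntegrable (fun s => inner ℝ (P.adjointField x u s (p s)) (y s - x s))
      volume τ P.T :=
    (ia.inner_continuousOn (hy.sub hx).continuousOn).congr fun s _ => real_inner_comm _ _
  have iG : IntervalIntegrable (fun s => inner ℝ (P.stateGradient (x s) (p s) (u s) s) (y s - x s))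
      volume τ P.T := ip.neg.congr fun s hs => by
    simp only [Pi.neg_apply]
    rw [adjointField_of_mem x u (hmem s (uIoc_subset_uIcc hs)), inner_neg_left, neg_neg]
  have iI := iG.sub (iH1.sub iH2)
  refine ⟨iI, ?_⟩
  have il : IntervalIntegrable (fun s => inner ℝ (P.adjointField x u s (p s)) (y s - x s) +
      inner ℝ (p s) (P.field w s (y s) - P.field u s (x s))) volume τ P.T :=
    ip.add (((iy P.T).sub (ix P.T)).inner_continuousOn hp.continuousOn)
  unfold cost
  rw [← intervalIntegral.integral_sub iF1 iF2, ← add_zero (∫ s in τ..P.T, (inner ℝ _ _ - _)), ← leib,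
    ← intervalIntegral.integral_add iI il]
  refine intervalIntegral.integral_congr fun s hs => ?_
  have hs' := hmem s hs
  simp only [adjointField_of_mem x u hs', field_of_mem _ hs', controlHamiltonian_eq,
    inner_neg_left, inner_sub_right]
  ring

/-- Changing the control on an interval moves the trajectory by at most a multiple of its
length. -/
theorem IsBound.norm_sub_le_of_needle {K : ℝ → ℝ} (hK : P.IsBound K) (hP : P.IsRegular) {τ : ℝ}
    {u w : ℝ → EuclideanSpace ℝ (Fin m)} (hu : P.IsControl u)
    (hw : P.IsControl w) {a b : ℝ} (hab : a ≤ b)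
    (huw : ∀ t, t ∉ Ioc a b → w t = u t) {x y : ℝ → EuclideanSpace ℝ (Fin n)} {M : ℝ}
    (hx : Continuous x) (hxM : ∀ t, ‖x t‖ ≤ M) (hy : Continuous y) (hyM : ∀ t, ‖y t‖ ≤ M)
    (hxs : IsODESolution (P.field u) τ P.T x) (hys : IsODESolution (P.field w) τ P.T y)
    (hxy : y τ = x τ) :
    ∀ t ∈ Icc τ P.T, ‖y t - x t‖ ≤ 2 * K M * (b - a) * Real.exp (K M * (P.T - τ)) := by
  have hKM := hK.nonneg M
  have hu' := hK.isCaratheodoryField hP hu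
  have hw' := hK.isCaratheodoryField hP hw
  have hba := sub_nonneg.2 hab
  have key : ∀ t ∈ Icc τ P.T, ‖y t - x t‖ ≤ 2 * K M * (b - a) * Real.exp (K M * (t - τ)) := by
    refine le_mul_exp_of_le_integral_forward hKM (hy.sub hx).norm.continuousOn fun t ht => ?_
    have iy := hw'.intervalIntegrable hy τ t
    have ix := hu'.intervalIntegrable hx τ t
    have e : y t - x t = ∫ s in τ..t, (P.field w s (y s) - P.field u s (x s)) := by
      rw [intervalIntegral.integral_sub iy ix, hys.2 t ht, hxs.2 t ht, hxy]; abel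
    have ii : IntervalIntegrable ((Ioc a b).indicator fun _ => 2 * K M) volume τ t := by
      rw [intervalIntegrable_iff]
      exact (integrableOn_const measure_Ioc_lt_top.ne).indicator measurableSet_Ioc
    have in' : IntervalIntegrable (fun s => K M * ‖y s - x s‖) volume τ t :=
      (continuous_const.mul (hy.sub hx).norm).intervalIntegrable _ _
    -- Inside the needle both speeds are at most `K M`; outside it the controls agree and only the
    -- Lipschitz term remains.
    have hpt : ∀ s, ‖P.field w s (y s) - P.field u s (x s)‖
        ≤ (Ioc a b).indicator (fun _ => 2 * K M) s + K M * ‖y s - x s‖ := by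
      intro s
      by_cases hs : s ∈ Ioc a b
      · rw [indicator_of_mem hs]
        have h1 := hw'.bound M s _ (hyM s)
        have h2 := hu'.bound M s _ (hxM s)
        have h3 := norm_sub_le (P.field w s (y s)) (P.field u s (x s))
        have h4 : 0 ≤ K M * ‖y s - x s‖ := by positivity
        linarith
      · rw [indicator_of_notMem hs, zero_add, field_congr (huw s hs)]
        exact hu'.lip M s _ _ (hyM s) (hxM s)
    have hind : ∫ s in τ..t, (Ioc a b).indicator (fun _ => 2 * K M) s ≤ 2 * K M * (b - a) := by
      rw [intervalIntegral.integral_of_le ht.1, setIntegral_indicator measurableSet_Ioc,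
        setIntegral_const, smul_eq_mul, mul_comm]
      refine mul_le_mul_of_nonneg_left ?_ (by positivity)
      refine (measureReal_mono inter_subset_right measure_Ioc_lt_top.ne).trans ?_
      simp [Measure.real, Real.volume_Ioc, hba]
    calc ‖y t - x t‖ ≤ ∫ s in τ..t, ((Ioc a b).indicator (fun _ => 2 * K M) s
          + K M * ‖y s - x s‖) := by
          rw [e]
          exact intervalIntegral.norm_integral_le_of_norm_le ht.1 (ae_of_all _ fun s _ => hpt s)
            (ii.add in')
      _ ≤ _ := by
          rw [intervalIntegral.integral_add ii in', intervalIntegral.integral_const_mul]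
          exact add_le_add hind le_rfl
  intro t ht
  refine (key t ht).trans ?_
  have := ht.2
  gcongr

/-- Uniform estimate for the effect on the cost of a needle variation on an interval. -/
theorem IsRegular.exists_needle_estimate (hP : P.IsRegular) {τ : ℝ} (hτ : τ ∈ Ico P.t₀ P.T)
    (M C : ℝ) {η : ℝ} (hη : 0 < η) :
    ∃ δ > 0, ∀ (u v w : ℝ → EuclideanSpace ℝ (Fin m)) (x y p : ℝ → EuclideanSpace ℝ (Fin n))
      (a b : ℝ), P.IsControl u → P.IsControl v → P.IsControl w → Continuous x → Continuous y →
      Continuous p → (∀ t, ‖x t‖ ≤ M) → (∀ t, ‖y t‖ ≤ M) → (∀ t, ‖p t‖ ≤ C) →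
      IsODESolution (P.field u) τ P.T x → IsODESolution (P.field w) τ P.T y → y τ = x τ →
      IsODESolution (P.adjointField x u) τ P.T p → p P.T = 0 →
      τ ≤ a → a ≤ b → b ≤ P.T → b - a ≤ δ →
      (∀ t ∈ Ioc a b, w t = v t) → (∀ t, t ∉ Ioc a b → w t = u t) →
      P.cost τ w y - P.cost τ u x ≤ η * (b - a) -
        ∫ s in a..b, (P.controlHamiltonian (x s) (p s) (v s) s -
          P.controlHamiltonian (x s) (p s) (u s) s) := by
  obtain ⟨K, hK⟩ := hP.exists_isBound
  have hKM := hK.nonneg M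
  have hTτ : 0 < P.T - τ := sub_pos.2 hτ.2
  -- `D * (b - a)` bounds the displacement of the trajectory. `C₂` bounds, per unit displacement,
  -- the error inside the needle: the gradient term and the Lipschitz term contribute `K M * (|C| +
  -- 1)` each.
  set D := 2 * K M * Real.exp (K M * (P.T - τ)) with hD
  have hD0 : 0 ≤ D := by positivity
  set C₂ := 2 * (K M * (|C| + 1)) with hC₂
  have hC₂0 : 0 ≤ C₂ := by positivity
  obtain ⟨δ', hδ', hunif⟩ := hP.exists_stateGradient_sub_le M C
    (η := η / (2 * (D * (P.T - τ) + 1))) (by positivity)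
  set η' := η / (2 * (D * (P.T - τ) + 1)) with hη'
  have hη'0 : 0 < η' := by positivity
  -- The first entry keeps the displacement below `δ'`, so that linearization off the needle costs
  -- at most `η / 2` per unit needle length; the second gives the same bound for the error on the
  -- needle.
  refine ⟨min (δ' / (D + 1)) (η / (2 * (C₂ * D + 1))), by positivity, ?_⟩
  intro u v w x y p a b hu hv hw hx hy hp hxM hyM hpC hxs hys hxy hps hpT hτa hab hbT hδ hwv hwu
  have hba := sub_nonneg.2 hab
  have hdist : ∀ t ∈ Icc τ P.T, ‖y t - x t‖ ≤ D * (b - a) := fun t ht => by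
    have := hK.norm_sub_le_of_needle hP hu hw hab hwu hx hxM hy hyM hxs hys hxy t ht
    calc _ ≤ _ := this
      _ = D * (b - a) := by rw [hD]; ring
  have hDδ : D * (b - a) ≤ δ' := by
    have h1 := hδ.trans (min_le_left _ _)
    rw [le_div_iff₀ (by positivity)] at h1
    nlinarith
  have hCD : C₂ * (D * (b - a)) ≤ η / 2 := by
    have h1 := hδ.trans (min_le_right _ _)
    rw [le_div_iff₀ (by positivity)] at h1
    nlinarith
  have hηD : η' * (D * (b - a)) * (P.T - τ) ≤ η / 2 * (b - a) := by
    have : η' * (D * (P.T - τ)) ≤ η / 2 := by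
      rw [hη', div_mul_eq_mul_div, div_le_div_iff₀ (by positivity) two_pos]
      nlinarith
    calc _ = η' * (D * (P.T - τ)) * (b - a) := by ring
      _ ≤ _ := mul_le_mul_of_nonneg_right this hba
  obtain ⟨hint, hcost⟩ := hP.cost_sub_cost hτ hu hw hx hxM hy hp hxs hys hxy hps hpT
  rw [hcost]
  have ha : a ∈ Icc τ P.T := ⟨hτa, hab.trans hbT⟩
  have hb : b ∈ Icc τ P.T := ⟨hτa.trans hab, hbT⟩
  have hτ1 : τ ∈ Icc τ P.T := left_mem_Icc.2 hτ.2.le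
  have hτ2 : P.T ∈ Icc τ P.T := right_mem_Icc.2 hτ.2.le
  set gap : ℝ → ℝ := fun s => P.controlHamiltonian (x s) (p s) (v s) s -
          P.controlHamiltonian (x s) (p s) (u s) s with hgap
  have igap : IntervalIntegrable gap volume τ P.T :=
    (hP.intervalIntegrable_controlHamiltonian hτ hx hp hv hτ1 hτ2).sub
      (hP.intervalIntegrable_controlHamiltonian hτ hx hp hu hτ1 hτ2)
  have iind : IntervalIntegrable ((Ioc a b).indicator fun s => C₂ * (D * (b - a)) - gap s)
      volume τ P.T := by
    have := (intervalIntegrable_const (c := C₂ * (D * (b - a)))).sub igap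
    rw [intervalIntegrable_iff] at this ⊢
    exact this.indicator measurableSet_Ioc
  have hpt : ∀ s ∈ Icc τ P.T, inner ℝ (P.stateGradient (x s) (p s) (u s) s) (y s - x s) -
      (P.controlHamiltonian (y s) (p s) (w s) s - P.controlHamiltonian (x s) (p s) (u s) s)
      ≤ η' * (D * (b - a)) + (Ioc a b).indicator (fun s => C₂ * (D * (b - a)) - gap s) s := by
    intro s hs
    have hs' : s ∈ Icc P.t₀ P.T := ⟨hτ.1.trans hs.1, hs.2⟩
    have hd := hdist s hs
    by_cases hmem : s ∈ Ioc a b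
    · rw [indicator_of_mem hmem, hwv s hmem]
      have h1 := (abs_le.1 (hK.controlHamiltonian_lip hP (hxM s) (hyM s) (p s) (hv.1 s) hs')).1
      have h2 := real_inner_le_norm (P.stateGradient (x s) (p s) (u s) s) (y s - x s)
      have h3 := hK.norm_stateGradient_le (hxM s) (p s) (hu.1 s) hs'
      have h4 : K M * (‖p s‖ + 1) ≤ K M * (|C| + 1) := by
        have := (hpC s).trans (le_abs_self C)
        gcongr
      have h5 : K M * (‖p s‖ + 1) * ‖y s - x s‖ ≤ K M * (|C| + 1) * (D * (b - a)) := by gcongr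
      have h6 : ‖P.stateGradient (x s) (p s) (u s) s‖ * ‖y s - x s‖
          ≤ K M * (‖p s‖ + 1) * ‖y s - x s‖ := by gcongr
      have h7 : 0 ≤ η' * (D * (b - a)) := by positivity
      have h8 : C₂ * (D * (b - a)) = 2 * (K M * (|C| + 1) * (D * (b - a))) := by rw [hC₂]; ring
      rw [h8]
      simp only [hgap]
      linarith
    · rw [indicator_of_notMem hmem, add_zero, hwu s hmem]
      have hseg : ∀ z ∈ segment ℝ (x s) (y s),
          ‖P.stateGradient z (p s) (u s) s - P.stateGradient (x s) (p s) (u s) s‖ ≤ η' := by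
        intro z hz
        refine hunif z (x s) (p s) ?_ (hxM s) (hpC s) ?_ (u s) (hu.1 s) s hs'
        · have := (convex_closedBall (0 : EuclideanSpace ℝ (Fin n)) M).segment_subset
            (by simpa using hxM s) (by simpa using hyM s) hz
          simpa using this
        · exact (norm_sub_le_of_mem_segment hz).trans (hd.trans hDδ)
      have h1 := (abs_le.1 (hP.controlHamiltonian_taylor (hu.1 s) hs' hseg)).1
      have h2 : η' * ‖y s - x s‖ ≤ η' * (D * (b - a)) := by gcongr
      linarith
  have hle := intervalIntegral.integral_mono_on hτ.2.le hint
    ((intervalIntegrable_const (c := η' * (D * (b - a)))).add iind) hpt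
  refine hle.trans ?_
  have igab : IntervalIntegrable gap volume a b :=
    igap.mono_set (by rw [uIcc_of_le hτ.2.le]; exact uIcc_subset_Icc ha hb)
  rw [intervalIntegral.integral_add intervalIntegrable_const iind,
    intervalIntegral.integral_const, smul_eq_mul, intervalIntegral.integral_of_le hτ.2.le,
    setIntegral_indicator measurableSet_Ioc, inter_eq_self_of_subset_right (Ioc_subset_Ioc hτa hbT),
    ← intervalIntegral.integral_of_le hab,
    intervalIntegral.integral_sub intervalIntegrable_const igab,
    intervalIntegral.integral_const, smul_eq_mul]
  have h9 : (b - a) * (C₂ * (D * (b - a))) ≤ (b - a) * (η / 2) :=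
    mul_le_mul_of_nonneg_left hCD hba
  linarith

end ControlProblem

/-! ### Measurable selection and compactness of curves. -/

/-- Measurable selection of a maximizer of a continuous function over a compact set. -/
theorem exists_measurable_argmax {X : Type*} [MetricSpace X] [MeasurableSpace X] [BorelSpace X]
    {U : Set X} (hU : IsCompact U) (hne : U.Nonempty) {a b : ℝ} (hab : a ≤ b) {φ : ℝ → X → ℝ}
    (hφ : ContinuousOn (fun z : ℝ × X => φ z.1 z.2) (Icc a b ×ˢ U)) :
    ∃ u : ℝ → X, Measurable u ∧ (∀ t, u t ∈ U) ∧ ∀ t ∈ Icc a b, ∀ w ∈ U, φ t w ≤ φ t (u t) := by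
  have : Nonempty U := hne.to_subtype
  have : CompactSpace U := isCompact_iff_compactSpace.1 hU
  have : CompactSpace cantorSet := isCompact_iff_compactSpace.1 isCompact_cantorSet
  -- Parametrizing `U` by the Cantor set, a compact subset of `ℝ`, provides an order in which the
  -- least parameter of a maximizer is a canonical choice.
  obtain ⟨c, hc, hcs⟩ := exists_nat_bool_continuous_surjective_of_compact U
  let e : cantorSet → U := fun s => c (cantorSetHomeomorphNatToBool s)
  have he : Continuous e := hc.comp cantorSetHomeomorphNatToBool.continuous
  have hes : Function.Surjective e := hcs.comp cantorSetHomeomorphNatToBool.surjective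
  let ψ : ℝ → U → ℝ := fun t w => φ (projIcc a b hab t) w
  have hψ : Continuous fun z : ℝ × U => ψ z.1 z.2 := by
    refine hφ.comp_continuous (f := fun z : ℝ × U => (((projIcc a b hab z.1 : Icc a b) : ℝ), (z.2 : X)))
      ?_ fun z => ⟨(projIcc a b hab z.1).2, z.2.2⟩
    exact (continuous_subtype_val.comp (continuous_projIcc.comp continuous_fst)).prodMk
      (continuous_subtype_val.comp continuous_snd)
  let B : Set (ℝ × cantorSet) := {z | ∀ w, ψ z.1 w ≤ ψ z.1 (e z.2)}
  have hB : IsClosed B := by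
    simp only [B, ofPred_forall]
    refine isClosed_iInter fun w => isClosed_le ?_ ?_
    · exact hψ.comp (continuous_fst.prodMk continuous_const)
    · exact hψ.comp (continuous_fst.prodMk (he.comp continuous_snd))
  have hleast : ∀ t, ∃ s : cantorSet, (t, s) ∈ B ∧ ∀ s', (t, s') ∈ B → s ≤ s' := by
    intro t
    have hcl : IsCompact {s : cantorSet | (t, s) ∈ B} :=
      (hB.preimage (continuous_const.prodMk continuous_id)).isCompact
    have hnon : {s : cantorSet | (t, s) ∈ B}.Nonempty := by
      obtain ⟨s, -, hs⟩ := isCompact_univ.exists_isMaxOn univ_nonempty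
        (hψ.comp (continuous_const.prodMk continuous_id) : Continuous (ψ t)).continuousOn
      obtain ⟨s', rfl⟩ := hes s
      exact ⟨s', fun w => hs (mem_univ w)⟩
    obtain ⟨s, hs, hmin⟩ := hcl.exists_isMinOn hnon continuous_subtype_val.continuousOn
    exact ⟨s, hs, fun s' hs' => hmin hs'⟩
  choose μ hμB hμ using hleast
  have hmeas : Measurable μ := by
    refine Measurable.subtype_mk (f := fun t => (μ t : ℝ)) (h := fun t => (μ t).2) ?_
    refine measurable_of_Iic fun r => IsClosed.measurableSet ?_
    -- Sublevel sets of the least parameter are projections of closed sets along a compact factor,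
    -- hence closed; the selection is lower semicontinuous, and so measurable.
    have : (fun t => (μ t : ℝ)) ⁻¹' Iic r = Prod.fst '' (B ∩ {z | (z.2 : ℝ) ≤ r}) := by
      ext t
      constructor
      · exact fun ht => ⟨(t, μ t), ⟨hμB t, ht⟩, rfl⟩
      · rintro ⟨⟨t', s⟩, ⟨h1, h2⟩, rfl⟩
        exact (Subtype.coe_le_coe.2 (hμ t' s h1)).trans h2
    rw [this]
    exact isClosedMap_fst_of_compactSpace _
      (hB.inter (isClosed_le (continuous_subtype_val.comp continuous_snd) continuous_const))
  refine ⟨fun t => e (μ t), measurable_subtype_coe.comp (he.measurable.comp hmeas),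
    fun t => (e (μ t)).2, fun t ht w hw => ?_⟩
  have := hμB t ⟨w, hw⟩
  simpa only [ψ, projIcc_of_mem hab ht] using this

/-- Arzelà–Ascoli for equibounded, equi-Lipschitz curves. -/
theorem exists_subseq_tendsto_of_lipschitz {E : Type*} [NormedAddCommGroup E] [ProperSpace E]
    {a b C M : ℝ} (hab : a ≤ b) (X : ℕ → ℝ → E) (hM : ∀ k t, t ∈ Icc a b → ‖X k t‖ ≤ M)
    (hC : ∀ k, ∀ s ∈ Icc a b, ∀ t ∈ Icc a b, ‖X k s - X k t‖ ≤ C * |s - t|) :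
    ∃ φ : ℕ → ℕ, StrictMono φ ∧ ∃ Y : ℝ → E, Continuous Y ∧ (∀ t, ‖Y t‖ ≤ M) ∧
      ∀ t ∈ Icc a b, Tendsto (fun k => X (φ k) t) atTop (𝓝 (Y t)) := by
  have hlip : ∀ k, LipschitzWith C.toNNReal fun t : Icc a b => X k t := fun k =>
    LipschitzWith.of_dist_le_mul fun s t => by
      rw [dist_eq_norm, Subtype.dist_eq, Real.dist_eq]
      exact (hC k s s.2 t t.2).trans
        (mul_le_mul_of_nonneg_right (Real.le_coe_toNNReal C) (abs_nonneg _))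
  let F : ℕ → BoundedContinuousFunction (Icc a b) E := fun k =>
    BoundedContinuousFunction.mkOfCompact ⟨_, (hlip k).continuous⟩
  have hc : IsCompact (closure (range F)) := by
    refine BoundedContinuousFunction.arzela_ascoli (Metric.closedBall 0 M)
      (isCompact_closedBall _ _) _ ?_ ?_
    · rintro _ t ⟨k, rfl⟩
      simpa [F] using hM k t t.2
    · refine (LipschitzWith.uniformEquicontinuous _ C.toNNReal ?_).equicontinuous
      rintro ⟨_, k, rfl⟩
      exact hlip k
  obtain ⟨G, -, φ, hφ, hG⟩ := hc.tendsto_subseq (x := F) fun k => subset_closure ⟨k, rfl⟩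
  have hpt : ∀ t : Icc a b, Tendsto (fun k => X (φ k) t) atTop (𝓝 (G t)) := fun t =>
    ((BoundedContinuousFunction.lipschitz_eval_const t).continuous.tendsto G).comp hG
  refine ⟨φ, hφ, IccExtend hab G, G.continuous.Icc_extend', fun t => ?_, fun t ht => ?_⟩
  · exact le_of_tendsto (hpt (projIcc a b hab t)).norm
      (Eventually.of_forall fun k => hM _ _ (projIcc a b hab t).2)
  · rw [IccExtend_of_mem _ _ ht]
    exact hpt ⟨t, ht⟩

/-! ### The envelope theorem and convergence along near-maximizers. -/

namespace ControlProblem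

variable {n m : ℕ} {P : ControlProblem n m}

theorem IsRegular.continuous_controlHamiltonian_slice (hP : P.IsRegular) {t : ℝ}
    (ht : t ∈ Icc P.t₀ P.T) :
    ContinuousOn (fun z : EuclideanSpace ℝ (Fin n) × EuclideanSpace ℝ (Fin n) ×
      EuclideanSpace ℝ (Fin m) => P.controlHamiltonian z.1 z.2.1 z.2.2 t)
      (univ ×ˢ univ ×ˢ P.U) := by
  refine hP.continuousOn_controlHamiltonian.comp (f := fun z : EuclideanSpace ℝ (Fin n) ×
    EuclideanSpace ℝ (Fin n) × EuclideanSpace ℝ (Fin m) => (z.2.1, z.1, z.2.2, t))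
    (by fun_prop) fun z hz => ⟨mem_univ _, mem_univ _, hz.2.2, ht⟩

theorem IsRegular.continuous_stateGradient_slice (hP : P.IsRegular) {t : ℝ}
    (ht : t ∈ Icc P.t₀ P.T) :
    ContinuousOn (fun z : EuclideanSpace ℝ (Fin n) × EuclideanSpace ℝ (Fin n) ×
      EuclideanSpace ℝ (Fin m) => P.stateGradient z.1 z.2.1 z.2.2 t)
      (univ ×ˢ univ ×ˢ P.U) := by
  refine hP.continuousOn_stateGradient.comp (f := fun z : EuclideanSpace ℝ (Fin n) ×
    EuclideanSpace ℝ (Fin n) × EuclideanSpace ℝ (Fin m) => (z.2.1, z.1, z.2.2, t))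
    (by fun_prop) fun z hz => ⟨mem_univ _, mem_univ _, hz.2.2, ht⟩

theorem IsRegular.exists_argmax_control (hP : P.IsRegular) (hne : P.U.Nonempty)
    {x p : ℝ → EuclideanSpace ℝ (Fin n)} (hx : Continuous x) (hp : Continuous p) :
    ∃ u, P.IsControl u ∧ ∀ t ∈ Icc P.t₀ P.T, ∀ w ∈ P.U,
      P.controlHamiltonian (x t) (p t) w t ≤ P.controlHamiltonian (x t) (p t) (u t) t := by
  obtain ⟨u, hm, hu, hmax⟩ := exists_measurable_argmax hP.compact hne P.t₀_lt_T.le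
    (φ := fun t w => P.controlHamiltonian (x t) (p t) w t)
    (hP.continuousOn_controlHamiltonian.comp (f := fun z : ℝ × EuclideanSpace ℝ (Fin m) =>
      (p z.1, x z.1, z.2, z.1)) (by fun_prop)
      fun z hz => ⟨mem_univ _, mem_univ _, hz.2, hz.1⟩)
  exact ⟨u, ⟨hu, hm.aemeasurable⟩, hmax⟩

/-- Compactness of `U` bounds the family above, so that the real supremum is genuine and not the
default value 0. -/
theorem IsRegular.controlHamiltonian_le_hamiltonian (hP : P.IsRegular)
    (x p : EuclideanSpace ℝ (Fin n)) {t : ℝ} (ht : t ∈ Icc P.t₀ P.T)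
    {w : EuclideanSpace ℝ (Fin m)} (hw : w ∈ P.U) :
    P.controlHamiltonian x p w t ≤ P.hamiltonian x p t := by
  have hcont : ContinuousOn (fun u => P.controlHamiltonian x p u t) P.U :=
    (hP.continuous_controlHamiltonian_slice ht).comp (f := fun u => (x, p, u)) (by fun_prop)
      fun u hu => ⟨mem_univ _, mem_univ _, hu⟩
  have hb := hP.compact.bddAbove_image hcont
  refine le_ciSup (f := fun u : P.U => P.controlHamiltonian x p u t) ?_ ⟨w, hw⟩
  rwa [image_eq_range] at hb

theorem hamiltonian_eq_of_forall_le {x p : EuclideanSpace ℝ (Fin n)} {t : ℝ}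
    {u : EuclideanSpace ℝ (Fin m)} (hu : u ∈ P.U)
    (hmax : ∀ w ∈ P.U, P.controlHamiltonian x p w t ≤ P.controlHamiltonian x p u t)
    (hP : P.IsRegular) (ht : t ∈ Icc P.t₀ P.T) :
    P.hamiltonian x p t = P.controlHamiltonian x p u t := by
  have : Nonempty P.U := ⟨⟨u, hu⟩⟩
  exact le_antisymm (ciSup_le fun w => hmax w w.2) (hP.controlHamiltonian_le_hamiltonian x p ht hu)

/-- The difference `φ - ψ` has a minimum at `x`, where its derivative must vanish. -/
theorem hasGradientAt_eq_of_le {E : Type*} [NormedAddCommGroup E] [InnerProductSpace ℝ E]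
    [CompleteSpace E] {φ ψ : E → ℝ} {x g : E} (hφ : DifferentiableAt ℝ φ x)
    (hψ : HasGradientAt ψ g x) (hle : ∀ y, ψ y ≤ φ y) (heq : φ x = ψ x) : g = gradient φ x := by
  have hmin : IsLocalMin (fun y => φ y - ψ y) x := Eventually.of_forall fun y => by
    simp only [heq, sub_self]; exact sub_nonneg.2 (hle y)
  have h1 := hmin.hasFDerivAt_eq_zero
    (hφ.hasGradientAt.hasFDerivAt.sub hψ.hasFDerivAt)
  rw [← map_sub, LinearIsometryEquiv.map_eq_zero_iff, sub_eq_zero] at h1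
  exact h1.symm

/-- Envelope theorem: the data at a maximizer are determined by the gradient of `H`. -/
theorem IsRegular.eq_gradient_of_forall_le (hP : P.IsRegular) (hH : P.HamiltonianDifferentiable)
    {x p : EuclideanSpace ℝ (Fin n)} {t : ℝ} (ht : t ∈ Icc P.t₀ P.T)
    {u : EuclideanSpace ℝ (Fin m)} (hu : u ∈ P.U)
    (hmax : ∀ w ∈ P.U, P.controlHamiltonian x p w t ≤ P.controlHamiltonian x p u t) :
    P.f x u t = gradient (fun q => P.hamiltonian x q t) p ∧
    P.stateGradient x p u t = gradient (fun y => P.hamiltonian y p t) x :=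
  have heq := hamiltonian_eq_of_forall_le hu hmax hP ht
  ⟨hasGradientAt_eq_of_le (hH t ht x p).2 (hasGradientAt_controlHamiltonian_adjoint x p u t)
    (fun q => hP.controlHamiltonian_le_hamiltonian x q ht hu) heq,
   hasGradientAt_eq_of_le (hH t ht x p).1 (hP.hasGradientAt_controlHamiltonian x p hu ht)
    (fun y => hP.controlHamiltonian_le_hamiltonian y p ht hu) heq⟩

/-- A continuous quantity which takes the same value at all maximizers converges along
asymptotically maximizing controls. -/
theorem IsRegular.tendsto_of_argmax (hP : P.IsRegular) {G : Type*} [TopologicalSpace G] {t : ℝ}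
    (ht : t ∈ Icc P.t₀ P.T)
    {Ψ : EuclideanSpace ℝ (Fin n) × EuclideanSpace ℝ (Fin n) × EuclideanSpace ℝ (Fin m) → G}
    (hΨ : ContinuousOn Ψ (univ ×ˢ univ ×ˢ P.U)) {x p : EuclideanSpace ℝ (Fin n)} {g : G}
    (hconst : ∀ u ∈ P.U,
      (∀ w ∈ P.U, P.controlHamiltonian x p w t ≤ P.controlHamiltonian x p u t) → Ψ (x, p, u) = g)
    {X Q : ℕ → EuclideanSpace ℝ (Fin n)} {u : ℕ → EuclideanSpace ℝ (Fin m)} {ε : ℕ → ℝ}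
    (hX : Tendsto X atTop (𝓝 x)) (hQ : Tendsto Q atTop (𝓝 p)) (hu : ∀ k, u k ∈ P.U)
    (hε : Tendsto ε atTop (𝓝 0))
    (hmax : ∀ k, ∀ w ∈ P.U, P.controlHamiltonian (X k) (Q k) w t - ε k ≤
      P.controlHamiltonian (X k) (Q k) (u k) t) :
    Tendsto (fun k => Ψ (X k, Q k, u k)) atTop (𝓝 g) := by
  refine tendsto_of_subseq_tendsto fun ns hns => ?_
  obtain ⟨ū, hū, φ, hφ, hlim⟩ := hP.compact.tendsto_subseq (x := fun k => u (ns k)) fun k => hu _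
  refine ⟨φ, ?_⟩
  have hns' : Tendsto (fun k => ns (φ k)) atTop atTop := hns.comp hφ.tendsto_atTop
  have key : ∀ (v : ℕ → EuclideanSpace ℝ (Fin m)), (∀ k, v k ∈ P.U) → ∀ v',
      Tendsto v atTop (𝓝 v') → Tendsto (fun k => (X (ns (φ k)), Q (ns (φ k)), v k)) atTop
        (𝓝[univ ×ˢ univ ×ˢ P.U] (x, p, v')) := fun v hv v' hlim =>
    tendsto_nhdsWithin_iff.2 ⟨(hX.comp hns').prodMk_nhds ((hQ.comp hns').prodMk_nhds hlim),
      Eventually.of_forall fun k => ⟨mem_univ _, mem_univ _, hv k⟩⟩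
  have hkey := key (fun k => u (ns (φ k))) (fun _ => hu _) ū hlim
  -- Any cluster point of the controls is a maximizer for the limit state and adjoint; which one
  -- does not matter, since `Ψ` takes the same value at all of them.
  have hmax' : ∀ w ∈ P.U, P.controlHamiltonian x p w t ≤ P.controlHamiltonian x p ū t := by
    intro w hw
    have hH := hP.continuous_controlHamiltonian_slice ht
    have h1 := ((hH (x, p, w) ⟨mem_univ _, mem_univ _, hw⟩).tendsto.comp
      (key (fun _ => w) (fun _ => hw) w tendsto_const_nhds)).sub (hε.comp hns')
    have h2 := (hH (x, p, ū) ⟨mem_univ _, mem_univ _, hū⟩).tendsto.comp hkey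
    rw [sub_zero] at h1
    exact le_of_tendsto_of_tendsto' h1 h2 fun k => hmax _ w hw
  rw [← hconst ū hū hmax']
  exact (hΨ (x, p, ū) ⟨mem_univ _, mem_univ _, hū⟩).tendsto.comp hkey

end ControlProblem

/-! ### Almost optimal controls and the existence of an optimal extremal. -/

theorem tendsto_zero_of_forall_le_add {a ε : ℕ → ℝ} (ha : ∀ k, 0 ≤ a k)
    (hε : Tendsto ε atTop (𝓝 0))
    (h : ∀ η > 0, ∃ N : ℝ, ∀ k, a k ≤ N * ε k + η) : Tendsto a atTop (𝓝 0) := by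
  rw [Metric.tendsto_atTop]
  intro η hη
  obtain ⟨N, hN⟩ := h (η / 2) (by positivity)
  have h1 : Tendsto (fun k => N * ε k) atTop (𝓝 0) := by simpa using hε.const_mul N
  obtain ⟨k₀, hk₀⟩ := eventually_atTop.1 (h1.eventually (gt_mem_nhds (half_pos hη)))
  refine ⟨k₀, fun k hk => ?_⟩
  rw [Real.dist_eq, sub_zero, abs_of_nonneg (ha k)]
  linarith [hN k, hk₀ k hk]

/-- For nonnegative functions the hypothesis is convergence in `L¹`, hence in measure. This turns
the maximum condition in the mean into a pointwise one. -/
theorem exists_subseq_tendsto_ae_of_integral_tendsto_zero {a b : ℝ} (hab : a ≤ b)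
    {g : ℕ → ℝ → ℝ} (hg : ∀ k, IntervalIntegrable (g k) volume a b)
    (h0 : ∀ k, ∀ t ∈ Icc a b, 0 ≤ g k t)
    (hlim : Tendsto (fun k => ∫ t in a..b, g k t) atTop (𝓝 0)) :
    ∃ φ : ℕ → ℕ, StrictMono φ ∧ ∀ᵐ t ∂volume.restrict (Ioc a b),
      Tendsto (fun k => g (φ k) t) atTop (𝓝 0) := by
  have hi : ∀ k, Integrable (g k) (volume.restrict (Ioc a b)) := fun k =>
    (intervalIntegrable_iff_integrableOn_Ioc_of_le hab).1 (hg k)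
  have h0' : ∀ k, 0 ≤ᵐ[volume.restrict (Ioc a b)] g k := fun k =>
    (ae_restrict_mem measurableSet_Ioc).mono fun t ht => h0 k t (Ioc_subset_Icc_self ht)
  have hL : Tendsto (fun k => eLpNorm (g k - fun _ => (0 : ℝ)) 1 (volume.restrict (Ioc a b))) atTop
      (𝓝 0) := by
    have e : ∀ k, eLpNorm (g k - fun _ => (0 : ℝ)) 1 (volume.restrict (Ioc a b))
        = ENNReal.ofReal (∫ t in a..b, g k t) := fun k => by
      have : (g k - fun _ => (0 : ℝ)) = g k := by ext; simp
      rw [this, eLpNorm_one_eq_lintegral_enorm, intervalIntegral.integral_of_le hab,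
        ofReal_integral_eq_lintegral_ofReal (hi k) (h0' k)]
      refine lintegral_congr_ae ((h0' k).mono fun t ht => ?_)
      exact Real.enorm_of_nonneg ht
    simp_rw [e]
    simpa using ENNReal.tendsto_ofReal hlim
  exact (tendstoInMeasure_of_tendsto_eLpNorm one_ne_zero
    (fun k => (hi k).aestronglyMeasurable) aestronglyMeasurable_const hL).exists_seq_tendsto_ae

namespace ControlProblem

variable {n m : ℕ} {P : ControlProblem n m}

/-- Along almost optimal controls the Pontryagin maximum condition holds asymptotically in the
mean. -/
theorem IsRegular.tendsto_integral_gap (hP : P.IsRegular) (hT : P.HasTrajectories) {τ : ℝ}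
    (hτ : τ ∈ Ico P.t₀ P.T) {x₀ : EuclideanSpace ℝ (Fin n)} {M C : ℝ}
    (hM : ∀ u y, P.IsControl u → IsODESolution (P.field u) τ P.T y → y τ = x₀ →
      ∀ t ∈ Icc τ P.T, ‖y t‖ ≤ M)
    {u v : ℕ → ℝ → EuclideanSpace ℝ (Fin m)} {x p : ℕ → ℝ → EuclideanSpace ℝ (Fin n)} {ε : ℕ → ℝ}
    (hu : ∀ k, P.IsControl (u k)) (hv : ∀ k, P.IsControl (v k)) (hx : ∀ k, Continuous (x k))
    (hp : ∀ k, Continuous (p k)) (hxM : ∀ k t, ‖x k t‖ ≤ M) (hpC : ∀ k t, ‖p k t‖ ≤ C)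
    (hxs : ∀ k, IsODESolution (P.field (u k)) τ P.T (x k)) (hx₀ : ∀ k, x k τ = x₀)
    (hps : ∀ k, IsODESolution (P.adjointField (x k) (u k)) τ P.T (p k)) (hpT : ∀ k, p k P.T = 0)
    (hε : Tendsto ε atTop (𝓝 0))
    (hopt : ∀ k w y, P.IsControl w → IsODESolution (P.field w) τ P.T y → y τ = x₀ →
      P.cost τ (u k) (x k) ≤ P.cost τ w y + ε k)
    (hmax : ∀ k, ∀ t ∈ Icc P.t₀ P.T, ∀ w ∈ P.U, P.controlHamiltonian (x k t) (p k t) w t ≤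
      P.controlHamiltonian (x k t) (p k t) (v k t) t) :
    Tendsto (fun k => ∫ s in τ..P.T, (P.controlHamiltonian (x k s) (p k s) (v k s) s -
      P.controlHamiltonian (x k s) (p k s) (u k s) s)) atTop (𝓝 0) := by
  classical
  have hTτ : 0 < P.T - τ := sub_pos.2 hτ.2
  have hτ1 : τ ∈ Icc τ P.T := left_mem_Icc.2 hτ.2.le
  refine tendsto_zero_of_forall_le_add (fun k => ?_) hε fun η hη => ?_
  · refine intervalIntegral.integral_nonneg hτ.2.le fun s hs => sub_nonneg.2 ?_
    exact hmax k s ⟨hτ.1.trans hs.1, hs.2⟩ _ ((hu k).1 s)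
  obtain ⟨δ, hδ, hneedle⟩ := hP.exists_needle_estimate hτ M C (η := η / (P.T - τ)) (by positivity)
  -- The number of pieces depends on `η` but not on `k`, because `δ` is uniform in the controls and
  -- curves.
  obtain ⟨N, hN⟩ := exists_nat_gt ((P.T - τ) / δ)
  have hN0 : (0 : ℝ) < N := (by positivity : 0 ≤ (P.T - τ) / δ).trans_lt hN
  have hNδ : (P.T - τ) / N ≤ δ := by
    rw [div_lt_iff₀ hδ] at hN
    rw [div_le_iff₀ hN0]
    linarith
  refine ⟨N, fun k => ?_⟩
  set c : ℕ → ℝ := fun i => τ + i * ((P.T - τ) / N) with hc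
  have hd0 : 0 < (P.T - τ) / N := by positivity
  have hc0 : c 0 = τ := by simp [hc]
  have hcN : c N = P.T := by simp only [hc]; field_simp; ring
  have hcmono : Monotone c := fun i j hij => by
    simp only [hc]
    gcongr
  have hcmem : ∀ i ≤ N, c i ∈ Icc τ P.T := fun i hi =>
    ⟨hc0 ▸ hcmono (Nat.zero_le i), hcN ▸ hcmono hi⟩
  have hint : ∀ i < N, IntervalIntegrable (fun s =>
      P.controlHamiltonian (x k s) (p k s) (v k s) s -
      P.controlHamiltonian (x k s) (p k s) (u k s) s) volume (c i) (c (i + 1)) := fun i hi =>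
    (hP.intervalIntegrable_controlHamiltonian hτ (hx k) (hp k) (hv k) (hcmem i hi.le)
      (hcmem (i + 1) hi)).sub
    (hP.intervalIntegrable_controlHamiltonian hτ (hx k) (hp k) (hu k) (hcmem i hi.le)
      (hcmem (i + 1) hi))
  rw [← hc0, ← hcN, ← intervalIntegral.sum_integral_adjacent_intervals hint]
  -- A needle on one piece cannot improve the cost by more than `ε k`, while the estimate promises a
  -- gain of at least the integrated gap minus `η / N`.
  have hpiece : ∀ i ∈ Finset.range N, ∫ s in c i..c (i + 1),
      (P.controlHamiltonian (x k s) (p k s) (v k s) s -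
      P.controlHamiltonian (x k s) (p k s) (u k s) s) ≤ ε k + η / N := by
    intro i hi
    rw [Finset.mem_range] at hi
    have hw : P.IsControl fun t => if t ∈ Ioc (c i) (c (i + 1)) then v k t else u k t :=
      (hv k).ite (hu k) _ measurableSet_Ioc
    obtain ⟨y', hy', hy'₀⟩ := hT.exists_solution hP hw hτ x₀
    obtain ⟨y, hy, hyy, hys, hyM⟩ :=
      hy'.exists_continuous_extension hτ.2.le (hM _ _ hw hy' hy'₀)
    have hy₀ : y τ = x₀ := (hyy hτ1).trans hy'₀
    have hlen : c (i + 1) - c i = (P.T - τ) / N := by simp only [hc]; push_cast; ring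
    have h1 := hneedle (u k) (v k) _ (x k) y (p k) (c i) (c (i + 1)) (hu k) (hv k) hw (hx k) hy
      (hp k) (hxM k) hyM (hpC k) (hxs k) hys (hy₀.trans (hx₀ k).symm) (hps k) (hpT k)
      (hcmem i hi.le).1 (hcmono (Nat.le_succ i)) (hcmem (i + 1) hi).2 (hlen ▸ hNδ)
      (fun t ht => if_pos ht) (fun t ht => if_neg ht)
    have h2 := hopt k _ y hw hys hy₀
    have h3 : η / (P.T - τ) * (c (i + 1) - c i) = η / N := by rw [hlen]; field_simp
    rw [h3] at h1
    linarith
  refine (Finset.sum_le_sum hpiece).trans ?_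
  rw [Finset.sum_const, Finset.card_range, nsmul_eq_mul, mul_add]
  have : (N : ℝ) * (η / N) = η := by field_simp
  rw [this]

theorem IsRegular.exists_minimizing_sequence (hP : P.IsRegular) (hT : P.HasTrajectories)
    (hne : P.U.Nonempty) {τ : ℝ} (hτ : τ ∈ Ico P.t₀ P.T) {x₀ : EuclideanSpace ℝ (Fin n)} {M : ℝ}
    (hM : ∀ u y, P.IsControl u → IsODESolution (P.field u) τ P.T y → y τ = x₀ →
      ∀ t ∈ Icc τ P.T, ‖y t‖ ≤ M) :
    ∃ J : ℝ, (∀ w y, P.IsControl w → IsODESolution (P.field w) τ P.T y → y τ = x₀ →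
      J ≤ P.cost τ w y) ∧
      ∀ k : ℕ, ∃ u x, P.IsControl u ∧ Continuous x ∧ IsODESolution (P.field u) τ P.T x ∧
        x τ = x₀ ∧ (∀ t, ‖x t‖ ≤ M) ∧ P.cost τ u x < J + 1 / ((k : ℝ) + 1) := by
  obtain ⟨K, hK⟩ := hP.exists_isBound
  have hτ1 : τ ∈ Icc τ P.T := left_mem_Icc.2 hτ.2.le
  obtain ⟨ū, hū⟩ := hne
  let S : Set ℝ := {c | ∃ u x, P.IsControl u ∧ IsODESolution (P.field u) τ P.T x ∧ x τ = x₀ ∧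
    P.cost τ u x = c}
  have hSne : S.Nonempty := by
    obtain ⟨x, hx, hx₀⟩ := hT.exists_solution hP (u := fun _ => ū)
      ⟨fun _ => hū, aemeasurable_const⟩ hτ x₀
    exact ⟨_, fun _ => ū, x, ⟨fun _ => hū, aemeasurable_const⟩, hx, hx₀, rfl⟩
  have hSbdd : BddBelow S := by
    refine ⟨-(K M * |P.T - τ|), ?_⟩
    rintro _ ⟨u, x, hu, hx, hx₀, rfl⟩
    have h : ‖P.cost τ u x‖ ≤ K M * |P.T - τ| :=
      intervalIntegral.norm_integral_le_of_norm_le_const fun t ht => by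
        rw [uIoc_of_le hτ.2.le] at ht
        have ht' := Ioc_subset_Icc_self ht
        exact hK.F_le M _ (hM u x hu hx hx₀ t ht') _ (hu.1 t) t ⟨hτ.1.trans ht'.1, ht'.2⟩
    exact (abs_le.1 h).1
  refine ⟨sInf S, fun w y hw hy hy₀ => csInf_le hSbdd ⟨w, y, hw, hy, hy₀, rfl⟩, fun k => ?_⟩
  obtain ⟨_, ⟨u, x, hu, hx, hx₀, rfl⟩, hlt⟩ := exists_lt_of_csInf_lt hSne
    (lt_add_of_pos_right (sInf S) (by positivity : 0 < 1 / ((k : ℝ) + 1)))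
  obtain ⟨y, hy, hyx, hys, hyM⟩ := hx.exists_continuous_extension hτ.2.le (hM u x hu hx hx₀)
  refine ⟨u, y, hu, hy, hys, (hyx hτ1).trans hx₀, hyM, ?_⟩
  rwa [cost_congr (P := P) hτ.2.le (EventuallyEq.refl _ u) hyx]

/-- Asymptotically maximizing controls, with their trajectories and adjoint curves, accumulate at
a pair of curves along which the data converge to those of a maximizing control. -/
theorem IsRegular.exists_limit_curves (hP : P.IsRegular) (hH : P.HamiltonianDifferentiable)
    (hne : P.U.Nonempty) {τ : ℝ} (hτ : τ ∈ Ico P.t₀ P.T) {M C : ℝ}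
    {u v : ℕ → ℝ → EuclideanSpace ℝ (Fin m)} {x p : ℕ → ℝ → EuclideanSpace ℝ (Fin n)}
    (hu : ∀ k, P.IsControl (u k)) (hv : ∀ k, P.IsControl (v k)) (hx : ∀ k, Continuous (x k))
    (hp : ∀ k, Continuous (p k)) (hxM : ∀ k t, ‖x k t‖ ≤ M) (hpC : ∀ k t, ‖p k t‖ ≤ C)
    (hxs : ∀ k, IsODESolution (P.field (u k)) τ P.T (x k))
    (hps : ∀ k, IsODESolution (P.adjointField (x k) (u k)) τ P.T (p k))
    (hmax : ∀ k, ∀ t ∈ Icc P.t₀ P.T, ∀ w ∈ P.U, P.controlHamiltonian (x k t) (p k t) w t ≤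
      P.controlHamiltonian (x k t) (p k t) (v k t) t)
    (hgap : Tendsto (fun k => ∫ s in τ..P.T, (P.controlHamiltonian (x k s) (p k s) (v k s) s -
      P.controlHamiltonian (x k s) (p k s) (u k s) s)) atTop (𝓝 0)) :
    ∃ u' x' p', ∃ φ : ℕ → ℕ, Tendsto φ atTop atTop ∧ P.IsControl u' ∧ Continuous x' ∧
      Continuous p' ∧ (∀ t ∈ Icc τ P.T, Tendsto (fun k => x (φ k) t) atTop (𝓝 (x' t))) ∧
      (∀ t ∈ Icc τ P.T, Tendsto (fun k => p (φ k) t) atTop (𝓝 (p' t))) ∧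
      (∀ t ∈ Icc P.t₀ P.T, ∀ w ∈ P.U,
        P.controlHamiltonian (x' t) (p' t) w t ≤ P.controlHamiltonian (x' t) (p' t) (u' t) t) ∧
      (∀ᵐ t, t ∈ Ioc τ P.T → Tendsto (fun k => P.f (x (φ k) t) (u (φ k) t) t) atTop
        (𝓝 (P.f (x' t) (u' t) t))) ∧
      (∀ᵐ t, t ∈ Ioc τ P.T → Tendsto (fun k => P.F (x (φ k) t) (u (φ k) t) t) atTop
        (𝓝 (P.F (x' t) (u' t) t))) ∧
      ∀ᵐ t, t ∈ Ioc τ P.T → Tendsto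
        (fun k => P.stateGradient (x (φ k) t) (p (φ k) t) (u (φ k) t) t) atTop
        (𝓝 (P.stateGradient (x' t) (p' t) (u' t) t)) := by
  obtain ⟨K, hK⟩ := hP.exists_isBound
  have hτ1 : τ ∈ Icc τ P.T := left_mem_Icc.2 hτ.2.le
  have hτ2 : P.T ∈ Icc τ P.T := right_mem_Icc.2 hτ.2.le
  have hmem : ∀ t ∈ Icc τ P.T, t ∈ Icc P.t₀ P.T := fun t ht => ⟨hτ.1.trans ht.1, ht.2⟩
  obtain ⟨ū, hū⟩ := hne
  obtain ⟨φ₁, hφ₁, Y, hY, -, hYlim⟩ := exists_subseq_tendsto_of_lipschitz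
    (C := max (K M) (K M * (C + 1))) (M := max M C) hτ.2.le (fun k t => (x k t, p k t))
    (fun k t _ => max_le_max (hxM k t) (hpC k t)) (fun k s hs t ht => by
      have h1 : ‖x k s - x k t‖ ≤ K M * |s - t| := by
        rw [(hxs k).sub_eq (hK.isCaratheodoryField hP (hu k)) ht hs, add_sub_cancel_left]
        exact intervalIntegral.norm_integral_le_of_norm_le_const fun r _ =>
          (hK.isCaratheodoryField hP (hu k)).bound M r _ (hxM k r)
      have hga := hK.isCaratheodoryField_adjointField hP (hx k) (hxM k) (hu k)
      have h2 : ‖p k s - p k t‖ ≤ K M * (C + 1) * |s - t| := by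
        rw [(hps k).sub_eq hga ht hs, add_sub_cancel_left]
        exact intervalIntegral.norm_integral_le_of_norm_le_const fun r _ =>
          hga.bound C r _ (hpC k r)
      exact max_le
        (h1.trans (mul_le_mul_of_nonneg_right (le_max_left _ _) (abs_nonneg _)))
        (h2.trans (mul_le_mul_of_nonneg_right (le_max_right _ _) (abs_nonneg _))))
  have hint : ∀ k, IntervalIntegrable (fun s => P.controlHamiltonian (x k s) (p k s) (v k s) s -
      P.controlHamiltonian (x k s) (p k s) (u k s) s) volume τ P.T := fun k =>
    (hP.intervalIntegrable_controlHamiltonian hτ (hx k) (hp k) (hv k) hτ1 hτ2).sub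
      (hP.intervalIntegrable_controlHamiltonian hτ (hx k) (hp k) (hu k) hτ1 hτ2)
  obtain ⟨φ₂, hφ₂, hae⟩ := exists_subseq_tendsto_ae_of_integral_tendsto_zero hτ.2.le
    (fun k => hint (φ₁ k)) (fun k t ht => sub_nonneg.2 (hmax _ t (hmem t ht) _ ((hu _).1 t)))
    (hgap.comp hφ₁.tendsto_atTop)
  set φ : ℕ → ℕ := fun k => φ₁ (φ₂ k)
  have hae' : ∀ᵐ t, t ∈ Ioc τ P.T → Tendsto (fun k =>
      P.controlHamiltonian (x (φ k) t) (p (φ k) t) (v (φ k) t) t -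
        P.controlHamiltonian (x (φ k) t) (p (φ k) t) (u (φ k) t) t) atTop (𝓝 0) :=
    (ae_restrict_iff' measurableSet_Ioc).1 hae
  have hφ : Tendsto φ atTop atTop := hφ₁.tendsto_atTop.comp hφ₂.tendsto_atTop
  have hxlim : ∀ t ∈ Icc τ P.T, Tendsto (fun k => x (φ k) t) atTop (𝓝 (Y t).1) := fun t ht =>
    ((hYlim t ht).fst_nhds).comp hφ₂.tendsto_atTop
  have hplim : ∀ t ∈ Icc τ P.T, Tendsto (fun k => p (φ k) t) atTop (𝓝 (Y t).2) := fun t ht =>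
    ((hYlim t ht).snd_nhds).comp hφ₂.tendsto_atTop
  clear_value φ
  have hY1 : Continuous fun t => (Y t).1 := continuous_fst.comp hY
  have hY2 : Continuous fun t => (Y t).2 := continuous_snd.comp hY
  -- The limit control is not a limit of the `u k`: it is any measurable maximizer along the limit
  -- curves.
  obtain ⟨u', hu', hmax'⟩ := hP.exists_argmax_control ⟨ū, hū⟩ hY1 hY2
  -- The data along the sequence converge almost everywhere.
  have hconv : ∀ {G : Type} [TopologicalSpace G]
      (Ψ : ℝ → EuclideanSpace ℝ (Fin n) × EuclideanSpace ℝ (Fin n) ×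
        EuclideanSpace ℝ (Fin m) → G),
      (∀ t ∈ Icc P.t₀ P.T, ContinuousOn (Ψ t) (univ ×ˢ univ ×ˢ P.U)) →
      (∀ t ∈ Icc P.t₀ P.T, ∀ x p, ∀ u₁ ∈ P.U, ∀ u₂ ∈ P.U,
        (∀ w ∈ P.U, P.controlHamiltonian x p w t ≤ P.controlHamiltonian x p u₁ t) →
        (∀ w ∈ P.U, P.controlHamiltonian x p w t ≤ P.controlHamiltonian x p u₂ t) →
        Ψ t (x, p, u₁) = Ψ t (x, p, u₂)) →
      ∀ᵐ t, t ∈ Ioc τ P.T → Tendsto (fun k => Ψ t (x (φ k) t, p (φ k) t, u (φ k) t)) atTop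
        (𝓝 (Ψ t ((Y t).1, (Y t).2, u' t))) := by
    intro G _ Ψ hΨ huniq
    filter_upwards [hae'] with t ht htm
    have htI := Ioc_subset_Icc_self htm
    have htm' := hmem t htI
    have h1 := hxlim t htI
    have h2 := hplim t htI
    have h3 : ∀ k, u (φ k) t ∈ P.U := fun k => (hu _).1 t
    have h4 := ht htm
    have h5 : ∀ k, ∀ w ∈ P.U, P.controlHamiltonian (x (φ k) t) (p (φ k) t) w t -
        (P.controlHamiltonian (x (φ k) t) (p (φ k) t) (v (φ k) t) t -
          P.controlHamiltonian (x (φ k) t) (p (φ k) t) (u (φ k) t) t) ≤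
        P.controlHamiltonian (x (φ k) t) (p (φ k) t) (u (φ k) t) t := fun k w hw => by
      linarith [hmax (φ k) t htm' w hw]
    have h6 := fun u₁ hu₁ h₁ => huniq t htm' (Y t).1 (Y t).2 u₁ hu₁ (u' t) (hu'.1 t) h₁ (hmax' t htm')
    exact hP.tendsto_of_argmax htm' (hΨ t htm') h6 h1 h2 h3 h4 h5
  have hslice : ∀ t ∈ Icc P.t₀ P.T, ContinuousOn (fun z : EuclideanSpace ℝ (Fin n) ×
      EuclideanSpace ℝ (Fin n) × EuclideanSpace ℝ (Fin m) => (z.1, z.2.2, t))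
      (univ ×ˢ univ ×ˢ P.U) := fun t _ => by fun_prop
  have hf := hconv (fun t z => P.f z.1 z.2.2 t)
    (fun t ht => hP.f_cont.comp (hslice t ht) fun z hz => ⟨mem_univ _, hz.2.2, ht⟩)
    (fun t ht x p u₁ hu₁ u₂ hu₂ h₁ h₂ =>
      (hP.eq_gradient_of_forall_le hH ht hu₁ h₁).1.trans
        (hP.eq_gradient_of_forall_le hH ht hu₂ h₂).1.symm)
  have hF := hconv (fun t z => P.F z.1 z.2.2 t)
    (fun t ht => hP.F_cont.comp (hslice t ht) fun z hz => ⟨mem_univ _, hz.2.2, ht⟩)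
    -- Two maximizers have equal `ℋ` and, by the envelope theorem, equal `f`; hence they have equal
    -- `F`.
    (fun t ht x p u₁ hu₁ u₂ hu₂ h₁ h₂ => by
      have e₁ := (hP.eq_gradient_of_forall_le hH ht hu₁ h₁).1.trans
        (hP.eq_gradient_of_forall_le hH ht hu₂ h₂).1.symm
      have e₂ := le_antisymm (h₂ u₁ hu₁) (h₁ u₂ hu₂)
      rw [controlHamiltonian_eq, controlHamiltonian_eq, e₁] at e₂
      exact sub_right_injective e₂)
  have hG := hconv (fun t z => P.stateGradient z.1 z.2.1 z.2.2 t)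
    (fun t ht => hP.continuous_stateGradient_slice ht)
    (fun t ht x p u₁ hu₁ u₂ hu₂ h₁ h₂ =>
      (hP.eq_gradient_of_forall_le hH ht hu₁ h₁).2.trans
        (hP.eq_gradient_of_forall_le hH ht hu₂ h₂).2.symm)
  exact ⟨u', _, _, φ, hφ, hu', hY1, hY2, hxlim, hplim, hmax', hf, hF, hG⟩

/-- Asymptotically maximizing controls, with their trajectories and adjoint curves, accumulate at
a control which satisfies the maximum condition everywhere. -/
theorem IsRegular.exists_limit_extremal (hP : P.IsRegular) (hH : P.HamiltonianDifferentiable)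
    (hne : P.U.Nonempty) {τ : ℝ} (hτ : τ ∈ Ico P.t₀ P.T) {x₀ : EuclideanSpace ℝ (Fin n)} {M C : ℝ}
    {u v : ℕ → ℝ → EuclideanSpace ℝ (Fin m)} {x p : ℕ → ℝ → EuclideanSpace ℝ (Fin n)}
    (hu : ∀ k, P.IsControl (u k)) (hv : ∀ k, P.IsControl (v k)) (hx : ∀ k, Continuous (x k))
    (hp : ∀ k, Continuous (p k)) (hxM : ∀ k t, ‖x k t‖ ≤ M) (hpC : ∀ k t, ‖p k t‖ ≤ C)
    (hxs : ∀ k, IsODESolution (P.field (u k)) τ P.T (x k)) (hx₀ : ∀ k, x k τ = x₀)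
    (hps : ∀ k, IsODESolution (P.adjointField (x k) (u k)) τ P.T (p k)) (hpT : ∀ k, p k P.T = 0)
    (hmax : ∀ k, ∀ t ∈ Icc P.t₀ P.T, ∀ w ∈ P.U, P.controlHamiltonian (x k t) (p k t) w t ≤
      P.controlHamiltonian (x k t) (p k t) (v k t) t)
    (hgap : Tendsto (fun k => ∫ s in τ..P.T, (P.controlHamiltonian (x k s) (p k s) (v k s) s -
      P.controlHamiltonian (x k s) (p k s) (u k s) s)) atTop (𝓝 0)) :
    ∃ u' x' p', ∃ φ : ℕ → ℕ, Tendsto φ atTop atTop ∧ P.IsControl u' ∧ Continuous x' ∧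
      Continuous p' ∧ IsODESolution (P.field u') τ P.T x' ∧ x' τ = x₀ ∧
      IsODESolution (P.adjointField x' u') τ P.T p' ∧ p' P.T = 0 ∧
      (∀ t ∈ Icc τ P.T, ∀ w ∈ P.U,
        P.controlHamiltonian (x' t) (p' t) w t ≤ P.controlHamiltonian (x' t) (p' t) (u' t) t) ∧
      Tendsto (fun k => P.cost τ (u (φ k)) (x (φ k))) atTop (𝓝 (P.cost τ u' x')) := by
  obtain ⟨K, hK⟩ := hP.exists_isBound
  have hτ1 : τ ∈ Icc τ P.T := left_mem_Icc.2 hτ.2.le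
  have hτ2 : P.T ∈ Icc τ P.T := right_mem_Icc.2 hτ.2.le
  have hmem : ∀ t ∈ Icc τ P.T, t ∈ Icc P.t₀ P.T := fun t ht => ⟨hτ.1.trans ht.1, ht.2⟩
  obtain ⟨u', x', p', φ, hφ, hu', hx', hp', hxlim, hplim, hmax', hf, hF, hG⟩ :=
    hP.exists_limit_curves hH hne hτ hu hv hx hp hxM hpC hxs hps hmax hgap
  have hxs' : IsODESolution (P.field u') τ P.T x' := by
    refine ⟨hx'.continuousOn, fun t ht => ?_⟩
    have hlim : Tendsto (fun k => ∫ s in τ..t, P.field (u (φ k)) s (x (φ k) s)) atTop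
        (𝓝 (∫ s in τ..t, P.field u' s (x' s))) := by
      refine intervalIntegral.tendsto_integral_filter_of_dominated_convergence (fun _ => K M)
        (Eventually.of_forall fun k => ?_) (Eventually.of_forall fun k => ?_)
        intervalIntegrable_const ?_
      · exact ((hK.isCaratheodoryField hP (hu _)).meas _ (hx _)).restrict
      · exact ae_of_all _ fun s _ =>
          (hK.isCaratheodoryField hP (hu _)).bound M s _ (hxM _ s)
      · filter_upwards [hf] with s hs hsm
        rw [uIoc_of_le ht.1] at hsm
        have hsm' : s ∈ Ioc τ P.T := ⟨hsm.1, hsm.2.trans ht.2⟩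
        have := hmem s (Ioc_subset_Icc_self hsm')
        simp only [field_of_mem _ this]
        exact hs hsm'
    -- The integral equation of `x (φ k)` passes to the limit, the right-hand sides converging
    -- almost everywhere under the common bound `K M`.
    refine tendsto_nhds_unique (hxlim t ht) (((hxlim τ hτ1).add hlim).congr fun k => ?_)
    exact ((hxs _).2 t ht).symm
  have hps' : IsODESolution (P.adjointField x' u') τ P.T p' := by
    refine ⟨hp'.continuousOn, fun t ht => ?_⟩
    have hlim : Tendsto (fun k => ∫ s in τ..t, P.adjointField (x (φ k)) (u (φ k)) s (p (φ k) s))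
        atTop (𝓝 (∫ s in τ..t, P.adjointField x' u' s (p' s))) := by
      have hga := fun k => hK.isCaratheodoryField_adjointField hP (hx k) (hxM k) (hu k)
      refine intervalIntegral.tendsto_integral_filter_of_dominated_convergence
        (fun _ => K M * (C + 1))
        (Eventually.of_forall fun k => ?_) (Eventually.of_forall fun k => ?_)
        intervalIntegrable_const ?_
      · exact ((hga _).meas _ (hp _)).restrict
      · exact ae_of_all _ fun s _ => (hga _).bound C s _ (hpC _ s)
      · filter_upwards [hG] with s hs hsm
        rw [uIoc_of_le ht.1] at hsm
        have hsm' : s ∈ Ioc τ P.T := ⟨hsm.1, hsm.2.trans ht.2⟩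
        have := hmem s (Ioc_subset_Icc_self hsm')
        simp only [adjointField_of_mem _ _ this]
        exact (hs hsm').neg
    refine tendsto_nhds_unique (hplim t ht) (((hplim τ hτ1).add hlim).congr fun k => ?_)
    exact ((hps _).2 t ht).symm
  have hx₀' : x' τ = x₀ :=
    tendsto_nhds_unique (hxlim τ hτ1) (by simp only [hx₀]; exact tendsto_const_nhds)
  have hpT' : p' P.T = 0 :=
    tendsto_nhds_unique (hplim P.T hτ2) (by simp only [hpT]; exact tendsto_const_nhds)
  have hlim : Tendsto (fun k => P.cost τ (u (φ k)) (x (φ k))) atTop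
      (𝓝 (P.cost τ u' x')) := by
    refine intervalIntegral.tendsto_integral_filter_of_dominated_convergence (fun _ => K M)
      (Eventually.of_forall fun k => ?_) (Eventually.of_forall fun k => ?_)
      intervalIntegrable_const ?_
    · exact (intervalIntegrable_iff.1
        (hP.intervalIntegrable_F hτ (hx _) (hu _) hτ1 hτ2)).aestronglyMeasurable
    · refine ae_of_all _ fun s hs => ?_
      rw [uIoc_of_le hτ.2.le] at hs
      exact hK.F_le M _ (hxM _ s) _ ((hu _).1 s) s (hmem s (Ioc_subset_Icc_self hs))
    · filter_upwards [hF] with s hs hsm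
      rw [uIoc_of_le hτ.2.le] at hsm
      exact hs hsm
  exact ⟨u', _, _, φ, hφ, hu', hx', hp', hxs', hx₀', hps', hpT', fun t ht => hmax' t (hmem t ht), hlim⟩

/-- Existence of an optimal control which satisfies the maximum condition everywhere. -/
theorem IsRegular.exists_optimal (hP : P.IsRegular) (hT : P.HasTrajectories)
    (hH : P.HamiltonianDifferentiable) (hne : P.U.Nonempty) {τ : ℝ}
    (hτ : τ ∈ Ico P.t₀ P.T) (x₀ : EuclideanSpace ℝ (Fin n)) :
    ∃ u x p, P.IsControl u ∧ Continuous x ∧ Continuous p ∧ IsODESolution (P.field u) τ P.T x ∧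
      x τ = x₀ ∧ IsODESolution (P.adjointField x u) τ P.T p ∧ p P.T = 0 ∧
      (∀ t ∈ Icc τ P.T, ∀ w ∈ P.U,
        P.controlHamiltonian (x t) (p t) w t ≤ P.controlHamiltonian (x t) (p t) (u t) t) ∧
      ∀ w y, P.IsControl w → IsODESolution (P.field w) τ P.T y → y τ = x₀ →
        P.cost τ u x ≤ P.cost τ w y := by
  obtain ⟨K, hK⟩ := hP.exists_isBound
  obtain ⟨M, hM⟩ := exists_trajectory_bound hP hT hτ x₀
  obtain ⟨J, hlow, hseq⟩ := hP.exists_minimizing_sequence hT hne hτ hM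
  choose u x hu hx hxs hx₀ hxM hcost using hseq
  choose p hp hps hpT hpC using fun k => hK.exists_adjoint hP (hx k) (hxM k) (hu k) hτ
  choose v hv hmax using fun k => hP.exists_argmax_control hne (hx k) (hp k)
  have hε := tendsto_one_div_add_atTop_nhds_zero_nat (𝕜 := ℝ)
  have hgap := hP.tendsto_integral_gap hT hτ hM hu hv hx hp hxM hpC hxs hx₀ hps hpT hε
    (fun k w y hw hy hy₀ => by linarith [hcost k, hlow w y hw hy hy₀]) hmax
  obtain ⟨u', x', p', φ, hφ, hu', hx', hp', hxs', hx₀', hps', hpT', hmax', hlim⟩ :=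
    hP.exists_limit_extremal hH hne hτ hu hv hx hp hxM hpC hxs hx₀ hps hpT hmax hgap
  have hlim' : Tendsto (fun k => J + 1 / ((φ k : ℝ) + 1)) atTop (𝓝 J) := by
    simpa using (hε.comp hφ).const_add J
  exact ⟨u', x', p', hu', hx', hp', hxs', hx₀', hps', hpT', hmax', fun w y hw hy hy₀ =>
    (le_of_tendsto_of_tendsto' hlim hlim' fun k => (hcost _).le).trans (hlow w y hw hy hy₀)⟩

/-! ### From the optimal extremal to Rozonoer's hypothesis. -/

theorem isControlHamiltonianSolution_of_isODESolution (hP : P.IsRegular) {τ : ℝ}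
    (hτ : τ ∈ Ico P.t₀ P.T) {u : ℝ → EuclideanSpace ℝ (Fin m)} (hu : P.IsControl u)
    {x p : ℝ → EuclideanSpace ℝ (Fin n)} {x₀ : EuclideanSpace ℝ (Fin n)} (hx : Continuous x)
    (hp : Continuous p) (hxs : IsODESolution (P.field u) τ P.T x) (hx₀ : x τ = x₀)
    (hps : IsODESolution (P.adjointField x u) τ P.T p) (hpT : p P.T = 0) :
    P.IsControlHamiltonianSolution x₀ τ u x p := by
  obtain ⟨K, hK⟩ := hP.exists_isBound
  obtain ⟨M, hM⟩ := isCompact_Icc.exists_bound_of_continuousOn hxs.1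
  have hmem : ∀ t ∈ Icc τ P.T, t ∈ Icc P.t₀ P.T := fun t ht => ⟨hτ.1.trans ht.1, ht.2⟩
  have e₁ : ∀ t, gradient (fun q => P.controlHamiltonian (x t) q (u t) t) (p t)
      = P.f (x t) (u t) t := fun t =>
    (hasGradientAt_controlHamiltonian_adjoint _ _ _ _).gradient
  have e₂ : ∀ t ∈ Icc τ P.T, -gradient (fun y => P.controlHamiltonian y (p t) (u t) t) (x t)
      = P.adjointField x u t (p t) := fun t ht => by
    rw [(hP.hasGradientAt_controlHamiltonian _ _ (hu.1 t) (hmem t ht)).gradient,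
      adjointField_of_mem x u (hmem t ht)]
  have htraj := (isTrajectory_iff hP hu hτ).2 ⟨hxs, hx₀⟩
  refine ⟨hx.continuousOn, hp.continuousOn, ?_, ⟨?_, fun t ht => ?_⟩, hx₀, hpT⟩
  · simpa only [e₁] using htraj.2.1
  · obtain ⟨z, hz, hzx, -, hzM⟩ := hxs.exists_continuous_extension hτ.2.le hM
    refine ((hK.isCaratheodoryField_adjointField hP hz hzM hu).intervalIntegrable hp τ P.T).congr
      fun t ht => ?_
    rw [uIoc_of_le hτ.2.le] at ht
    have ht' := Ioc_subset_Icc_self ht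
    simp only [e₂ t ht', adjointField_of_mem _ u (hmem t ht'), hzx ht']
  · rw [hps.2 t ht]
    congr 1
    refine intervalIntegral.integral_congr fun s hs => ?_
    rw [uIcc_of_le ht.1] at hs
    exact (e₂ s ⟨hs.1, hs.2.trans ht.2⟩).symm

theorem rozonoerHypothesis3_of_isRegular (hP : P.IsRegular) (hT : P.HasTrajectories)
    (hH : P.HamiltonianDifferentiable) : P.RozonoerHypothesis3 := by
  intro hex τ hτ x₀ v hv
  have hne : P.U.Nonempty := ⟨v τ, hv.1.1 τ (left_mem_Icc.2 hτ.2.le)⟩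
  obtain ⟨u, x, p, hu, hx, hp, hxs, hx₀, hps, hpT, hmax, hopt⟩ :=
    hP.exists_optimal hT hH hne hτ x₀
  have hPMP : P.SatisfiesPMP x₀ τ u := ⟨hu.isAdmissible τ, x, p,
    isControlHamiltonianSolution_of_isODESolution hP hτ hu hx hp hxs hx₀ hps hpT,
    (ae_restrict_mem measurableSet_Icc).mono hmax⟩
  obtain ⟨w, -, hw⟩ := hex τ hτ x₀
  -- Uniqueness identifies the given control with the optimal one; trajectory and cost depend on a
  -- control only up to null sets.
  have huv : u =ᵐ[volume.restrict (Icc τ P.T)] v := (hw u hPMP).trans (hw v hv).symm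
  refine ⟨hv.1, x, isTrajectory_congr hτ.2.le huv ((isTrajectory_iff hP hu hτ).2 ⟨hxs, hx₀⟩),
    fun w y hw hy => ?_⟩
  obtain ⟨w', hw', hww'⟩ := hw.exists_isControl hτ.2.le
  have hae : w =ᵐ[volume.restrict (Icc τ P.T)] w' :=
    (ae_restrict_mem measurableSet_Icc).mono fun t ht => (hww' ht).symm
  have hy' := (isTrajectory_iff hP hw' hτ).1 (isTrajectory_congr hτ.2.le hae hy)
  rw [cost_congr hτ.2.le huv.symm fun t _ => rfl, cost_congr hτ.2.le hae fun t _ => rfl]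
  exact hopt w' y hw' hy'.1 hy'.2

end ControlProblem

theorem theorem4p1 {n m : ℕ} (P : ControlProblem n m)
    (h_traj : P.HasTrajectories)
    (h_cont : P.UniformlyContinuousInState)
    (h_diff : P.UniformlyDifferentiableInState)
    (h_complete : P.IsCompleteHamiltonianSystem)
    (h_compact : IsCompact P.U) :
    P.RozonoerHypothesis3 :=
  ControlProblem.rozonoerHypothesis3_of_isRegular
    ⟨h_cont.1, h_cont.2.1, h_diff.1, h_diff.2.1, h_diff.2.2.1, h_compact⟩ h_traj
    h_complete.differentiable
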